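/- Write $\mathbb T=\mathbb R/2\pi\mathbb Z$, and identify functions on $\mathbb T$ with $2\pi$-periodic functions on $\mathbb R$. For $s>1$, let $G^s(\mathbb T)$ be the class of smooth real-valued $v$ on $\mathbb T$ for which there are $M,K>0$ with $\sup_x|\partial^m v(x)|\le M K^m (m!)^s$ for all $m\ge 0$. Call $v$ transversal if for every $x$ there is $m\ge 1$ with $\partial^m v(x)\ne 0$. For $\kappa>0$ let $DC_\kappa$ be the set of $\omega$ with $$\operatorname{dist}(k\omega,2\pi\mathbb Z)>\frac{\kappa}{|k|\,(\log(1+|k|))^3}\qquad\text{for all } k\in\mathbb Z\setminus\{0\}.$$ For $\omega,\lambda,E\in\mathbb R$ and $N\ge1$, let $$M_N(x)=M_N(x,\omega,\lambda,E)=A(x+N\omega)\cdots A(x+2\omega)A(x+\omega),\qquad A(y)=\begin{pmatrix}\lambda v(y)-E&-1\\1&0\end{pmatrix},$$ be the transfer matrix of the discrete Schrödinger equation $-(u_{n+1}+u_{n-1})+\lambda v(x+n\omega)u_n=Eu_n$. With $\|\cdot\|$ the Euclidean operator norm, let $$L_N(E)=L_N(E,\omega,\lambda)=\frac1{2\pi}\int_0^{2\pi}\frac1N\log\|M_N(x)\|\,dx,\qquad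 L_{\omega,\lambda}(E)=\lim_{N\to\infty}L_N(E,\omega,\lambda).$$ **Theorem.** There are absolute constants $\tau,\sigma>0$ such that the following holds. Let $s>1$, let $v\in G^s(\mathbb T)$ be transversal, and let $\kappa>0$. There is $\lambda_0=\lambda_0(v,\kappa)>0$ such that for every $\lambda\in\mathbb R$ with $|\lambda|\ge\lambda_0$: 1. There is $N_0=N_0(\lambda,\kappa,v,s)$ such that for every $\omega\in DC_\kappa$, every $E\in\mathbb R$ and every $N\ge N_0$, $$\operatorname{mes}\Big\{x\in[0,2\pi):\Big|\frac1N\log\|M_N(x,\omega,\lambda,E)\|-L_N(E,\omega,\lambda)\Big|>N^{-\tau}\Big\}<e^{-N^\sigma},$$ where $\operatorname{mes}$ is Lebesgue measure. 2. For every $\omega\in DC_\kappa$ and every $E\in\mathbb R$, the limit defining $L_{\omega,\lambda}(E)$ exists, and $$L_{\omega,\lambda}(E)\ge\tfrac14\log|\lambda|>0.$$ -/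

import Mathlib

open MeasureTheory Filter Topology

/-- The Gevrey class `G^s(𝕋)`, `𝕋 = ℝ / 2πℤ`: a function on `𝕋` is a `2π`-periodic function on `ℝ`;
it is smooth and `sup_x |∂^m v(x)| ≤ M K^m (m!)^s` for all `m ≥ 0`, for some `M, K > 0`. -/
structure IsGevrey (s : ℝ) (v : ℝ → ℝ) : Prop where
  periodic : Function.Periodic v (2 * Real.pi)
  smooth : ContDiff ℝ ((⊤ : ℕ∞) : WithTop ℕ∞) v
  bound : ∃ M > 0, ∃ K > 0, ∀ (m : ℕ) (x : ℝ),
    |iteratedDeriv m v x| ≤ M * K ^ m * (Nat.factorial m : ℝ) ^ s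

/-- The transversality condition: `v` is not flat at any point. -/
def IsTransversal (v : ℝ → ℝ) : Prop :=
  ∀ x : ℝ, ∃ m : ℕ, 1 ≤ m ∧ iteratedDeriv m v x ≠ 0

/-- The strong Diophantine condition `DC_κ`:
`dist(kω, 2πℤ) > κ / (|k| (log(1 + |k|))^3)` for all integers `k ≠ 0`. -/
def diophantine (κ : ℝ) : Set ℝ :=
  {ω | ∀ k : ℤ, k ≠ 0 →
    κ / (|(k : ℝ)| * Real.log (1 + |(k : ℝ)|) ^ 3) <
      Metric.infDist ((k : ℝ) * ω) (Set.range fun n : ℤ => 2 * Real.pi * (n : ℝ))}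

/-- The one-step matrix `A(y)` of the equation
`-(u_{n+1} + u_{n-1}) + l v(x + nω) u_n = E u_n`; `l` is the disorder. -/
def stepMatrix (v : ℝ → ℝ) (l E y : ℝ) : Matrix (Fin 2) (Fin 2) ℝ :=
  !![l * v y - E, -1; 1, 0]

/-- The transfer matrix `M_N(x) = A(x + Nω) ⋯ A(x + 2ω) A(x + ω)`. -/
def transferMatrix (v : ℝ → ℝ) (ω l E : ℝ) : ℕ → ℝ → Matrix (Fin 2) (Fin 2) ℝ
  | 0, _ => 1
  | N + 1, x => stepMatrix v l E (x + ((N + 1 : ℕ) : ℝ) * ω) * transferMatrix v ω l E N x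

open scoped Matrix.Norms.L2Operator in
/-- `(1/N) log ‖M_N(x)‖`, with the Euclidean operator norm. -/
noncomputable def logNorm (v : ℝ → ℝ) (ω l E : ℝ) (N : ℕ) (x : ℝ) : ℝ :=
  1 / (N : ℝ) * Real.log ‖transferMatrix v ω l E N x‖

/-- `L_N(E)`: the mean over `𝕋` (normalized to have total mass one) of `(1/N) log ‖M_N(x)‖`. -/
noncomputable def lyapunovN (v : ℝ → ℝ) (ω l E : ℝ) (N : ℕ) : ℝ :=
  (2 * Real.pi)⁻¹ * ∫ x in (0 : ℝ)..(2 * Real.pi), logNorm v ω l E N x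

/-- The Lyapunov exponent `L(E) = lim_N L_N(E)`. -/
noncomputable def lyapunov (v : ℝ → ℝ) (ω l E : ℝ) : ℝ :=
  limUnder atTop (fun N : ℕ => lyapunovN v ω l E N)

/-- The Hilbert–Schmidt norm of a real `2 × 2` matrix. -/
noncomputable def hs (M : Matrix (Fin 2) (Fin 2) ℝ) : ℝ :=
  Real.sqrt (M 0 0 ^ 2 + M 0 1 ^ 2 + M 1 0 ^ 2 + M 1 1 ^ 2)

theorem hs_sq (M : Matrix (Fin 2) (Fin 2) ℝ) :
    hs M ^ 2 = M 0 0 ^ 2 + M 0 1 ^ 2 + M 1 0 ^ 2 + M 1 1 ^ 2 :=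
  Real.sq_sqrt (by positivity)

theorem hs_nonneg (M : Matrix (Fin 2) (Fin 2) ℝ) : 0 ≤ hs M := Real.sqrt_nonneg _

theorem hs_mul_le (A B : Matrix (Fin 2) (Fin 2) ℝ) : hs (A * B) ≤ hs A * hs B := by
  refine abs_le_of_sq_le_sq' ?_ (mul_nonneg (hs_nonneg _) (hs_nonneg _)) |>.2
  rw [mul_pow, hs_sq, hs_sq, hs_sq]
  simp only [Matrix.mul_apply, Fin.sum_univ_two]
  nlinarith [sq_nonneg (A 0 0 * B 1 0 - A 0 1 * B 0 0), sq_nonneg (A 0 0 * B 1 1 - A 0 1 * B 0 1),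
    sq_nonneg (A 1 0 * B 1 0 - A 1 1 * B 0 0), sq_nonneg (A 1 0 * B 1 1 - A 1 1 * B 0 1)]

theorem hs_add_le (A B : Matrix (Fin 2) (Fin 2) ℝ) : hs (A + B) ≤ hs A + hs B := by
  have key : ∀ M : Matrix (Fin 2) (Fin 2) ℝ,
      hs M = ‖(WithLp.toLp 2 (fun p : Fin 2 × Fin 2 => M p.1 p.2) :
        EuclideanSpace ℝ (Fin 2 × Fin 2))‖ := by
    intro M
    rw [EuclideanSpace.norm_eq, hs]
    congr 1
    simp [Fintype.sum_prod_type, add_assoc]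
  rw [key, key, key]
  exact norm_add_le (WithLp.toLp 2 (fun p : Fin 2 × Fin 2 => A p.1 p.2) :
    EuclideanSpace ℝ (Fin 2 × Fin 2)) (WithLp.toLp 2 (fun p : Fin 2 × Fin 2 => B p.1 p.2))

theorem hs_smul (c : ℝ) (A : Matrix (Fin 2) (Fin 2) ℝ) : hs (c • A) = |c| * hs A := by
  rw [← sq_eq_sq₀ (hs_nonneg _) (by have := hs_nonneg A; positivity), mul_pow, hs_sq, hs_sq]
  simp only [Matrix.smul_apply, smul_eq_mul, sq_abs]
  ring

theorem abs_entry_le_hs (M : Matrix (Fin 2) (Fin 2) ℝ) : |M 0 0| ≤ hs M := by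
  refine abs_le_of_sq_le_sq ?_ (hs_nonneg _)
  rw [hs_sq]; nlinarith [sq_nonneg (M 0 1), sq_nonneg (M 1 0), sq_nonneg (M 1 1)]

theorem two_le_hs_sq_of_det_eq_one {M : Matrix (Fin 2) (Fin 2) ℝ} (h : M.det = 1) :
    2 ≤ hs M ^ 2 := by
  rw [Matrix.det_fin_two] at h
  rw [hs_sq]
  nlinarith [sq_nonneg (M 0 0 - M 1 1), sq_nonneg (M 0 1 + M 1 0)]

theorem one_le_hs_of_det_eq_one {M : Matrix (Fin 2) (Fin 2) ℝ} (h : M.det = 1) : 1 ≤ hs M := by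
  nlinarith [two_le_hs_sq_of_det_eq_one h, hs_nonneg M]

/-- For `2 × 2` matrices the tensors `XAY ⊗ A` and `XA ⊗ AY` agree, after a permutation of
indices, up to a multiple of `det A`. -/
theorem abs_hs_mul_sub_le (X A Y : Matrix (Fin 2) (Fin 2) ℝ) :
    |hs (X * A * Y) * hs A - hs (X * A) * hs (A * Y)| ≤ |A.det| * (hs X * hs Y) := by
  let T (M P : Matrix (Fin 2) (Fin 2) ℝ) : EuclideanSpace ℝ ((Fin 2 × Fin 2) × (Fin 2 × Fin 2)) :=
    WithLp.toLp 2 (fun p => M p.1.1 p.1.2 * P p.2.1 p.2.2)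
  let T' (M P : Matrix (Fin 2) (Fin 2) ℝ) : EuclideanSpace ℝ ((Fin 2 × Fin 2) × (Fin 2 × Fin 2)) :=
    WithLp.toLp 2 (fun p => M p.1.1 p.2.2 * P p.2.1 p.1.2)
  let T'' (M P : Matrix (Fin 2) (Fin 2) ℝ) : EuclideanSpace ℝ ((Fin 2 × Fin 2) × (Fin 2 × Fin 2)) :=
    WithLp.toLp 2 (fun p => M p.1.1 p.2.1 * P p.2.2 p.1.2)
  have norm_T : ∀ M P, ‖T M P‖ = hs M * hs P := by
    intro M P
    rw [EuclideanSpace.norm_eq, hs, hs, ← Real.sqrt_mul (by positivity)]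
    congr 1
    simp only [T, Fintype.sum_prod_type, Fin.sum_univ_two, Real.norm_eq_abs, sq_abs]
    ring
  have norm_T' : ∀ M P, ‖T' M P‖ = hs M * hs P := by
    intro M P
    rw [EuclideanSpace.norm_eq, hs, hs, ← Real.sqrt_mul (by positivity)]
    congr 1
    simp only [T', Fintype.sum_prod_type, Fin.sum_univ_two, Real.norm_eq_abs, sq_abs]
    ring
  have norm_T'' : ∀ M P, ‖T'' M P‖ = hs M * hs P := by
    intro M P
    rw [EuclideanSpace.norm_eq, hs, hs, ← Real.sqrt_mul (by positivity)]
    congr 1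
    simp only [T'', Fintype.sum_prod_type, Fin.sum_univ_two, Real.norm_eq_abs, sq_abs]
    ring
  let J : Matrix (Fin 2) (Fin 2) ℝ := !![0, 1; -1, 0]
  have hJ1 : hs (X * J) = hs X := by
    simp only [hs]; congr 1
    simp [Matrix.mul_apply, J]; ring
  have hJ2 : hs (J.transpose * Y) = hs Y := by
    simp only [hs]; congr 1
    simp [Matrix.mul_apply, J]; ring
  have hdiff : T (X * A * Y) A - T' (X * A) (A * Y) = A.det • T'' (X * J) (J.transpose * Y) := by
    ext ⟨⟨i, j⟩, ⟨k, l⟩⟩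
    simp only [T, T', T'', PiLp.sub_apply, PiLp.smul_apply, smul_eq_mul, Matrix.mul_apply,
      Fin.sum_univ_two, Matrix.det_fin_two, J, Matrix.transpose_apply]
    fin_cases k <;> fin_cases l <;> simp <;> ring
  calc _ = |‖T (X * A * Y) A‖ - ‖T' (X * A) (A * Y)‖| := by rw [norm_T, norm_T']
    _ ≤ ‖T (X * A * Y) A - T' (X * A) (A * Y)‖ := abs_norm_sub_norm_le _ _
    _ = _ := by rw [hdiff, norm_smul, norm_T'', hJ1, hJ2, Real.norm_eq_abs]

theorem abs_log_le_of_abs_sub_one_le {r ε : ℝ} (hε : ε ≤ 1 / 2) (h : |r - 1| ≤ ε) :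
    |Real.log r| ≤ 2 * ε := by
  have h' := abs_le.1 h
  have hr : 1 / 2 ≤ r := by linarith
  have hr0 : 0 < r := by linarith
  rw [abs_le]
  constructor
  · have := Real.one_sub_inv_le_log_of_pos hr0
    have h2 : r⁻¹ ≤ 1 + 2 * ε := by
      rw [inv_le_iff_one_le_mul₀ hr0]
      nlinarith [abs_nonneg (r - 1)]
    linarith
  · have := Real.log_le_sub_one_of_pos hr0
    linarith [abs_nonneg (r - 1)]

/-- The ordered product `A k * ⋯ * A 1 * A 0`. -/
def orderedProd (A : ℕ → Matrix (Fin 2) (Fin 2) ℝ) : ℕ → Matrix (Fin 2) (Fin 2) ℝ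
  | 0 => A 0
  | k + 1 => A (k + 1) * orderedProd A k

theorem det_orderedProd {A : ℕ → Matrix (Fin 2) (Fin 2) ℝ} {m : ℕ}
    (hdet : ∀ j ≤ m, (A j).det = 1) : ∀ k ≤ m, (orderedProd A k).det = 1
  | 0, h => hdet 0 h
  | k + 1, h => by
    rw [orderedProd, Matrix.det_mul, hdet _ h, det_orderedProd hdet k (by omega), one_mul]

/-- The avalanche principle, in Hilbert–Schmidt norms. -/
theorem avalanche_principle {A : ℕ → Matrix (Fin 2) (Fin 2) ℝ} {μ : ℝ} {m : ℕ} (hμ : 4 ≤ μ)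
    (hdet : ∀ j ≤ m + 1, (A j).det = 1) (hA : ∀ j ≤ m + 1, μ ≤ hs (A j))
    (hAA : ∀ j < m + 1, hs (A (j + 1)) * hs (A j) ≤ Real.sqrt μ * hs (A (j + 1) * A j)) :
    |Real.log (hs (orderedProd A (m + 1))) + ∑ j ∈ Finset.range m, Real.log (hs (A (j + 1)))
      - ∑ j ∈ Finset.range (m + 1), Real.log (hs (A (j + 1) * A j))| ≤ (m + 1) * (4 / μ) := by
  have hμ0 : 0 < μ := by linarith
  have hsμ : Real.sqrt μ ^ 2 = μ := Real.sq_sqrt hμ0.le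
  have hsμ0 : 0 < Real.sqrt μ := Real.sqrt_pos.2 hμ0
  have hpos : ∀ {M : Matrix (Fin 2) (Fin 2) ℝ}, M.det = 1 → 0 < hs M := fun h =>
    lt_of_lt_of_le one_pos (one_le_hs_of_det_eq_one h)
  have main : ∀ k ≤ m,
      (hs (A (k + 1)) * hs (orderedProd A k) ≤ 2 * Real.sqrt μ * hs (orderedProd A (k + 1))) ∧
      |Real.log (hs (orderedProd A (k + 1))) + ∑ j ∈ Finset.range k, Real.log (hs (A (j + 1)))
        - ∑ j ∈ Finset.range (k + 1), Real.log (hs (A (j + 1) * A j))| ≤ (k + 1) * (4 / μ) := by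
    intro k
    induction k with
    | zero =>
      intro _
      constructor
      · have := hAA 0 (by omega)
        have h2 := hs_nonneg (A 1 * A 0)
        simp only [orderedProd, zero_add] at this ⊢
        nlinarith
      · simp [orderedProd]; positivity
    | succ k ih =>
      intro hk
      obtain ⟨ih1, ih2⟩ := ih (by omega)
      have dP := det_orderedProd hdet
      set a := hs (A (k + 1)) with ha
      set b := hs (orderedProd A k) with hb
      set c := hs (orderedProd A (k + 1)) with hc
      set d := hs (A (k + 2)) with hd
      set e := hs (A (k + 2) * A (k + 1)) with he
      set f := hs (orderedProd A (k + 2)) with hf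
      have ha0 : 0 < a := hpos (hdet _ (by omega))
      have hb0 : 0 < b := hpos (dP k (by omega))
      have hc0 : 0 < c := hpos (dP (k + 1) (by omega))
      have hd0 : 0 < d := hpos (hdet _ (by omega))
      have hf0 : 0 < f := hpos (dP (k + 2) (by omega))
      have he0 : 0 < e := hpos (by
        rw [Matrix.det_mul, hdet _ (by omega), hdet _ (by omega), one_mul])
      have haμ : μ ≤ a := hA _ (by omega)
      have hde : d * a ≤ Real.sqrt μ * e := hAA (k + 1) (by omega)
      have key := abs_hs_mul_sub_le (A (k + 2)) (A (k + 1)) (orderedProd A k)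
      rw [hdet (k + 1) (by omega), abs_one, one_mul, Matrix.mul_assoc] at key
      change |f * a - e * c| ≤ d * b at key
      have hdb : d * b ≤ 2 / μ * (e * c) := by
        have h1 : (d * a) * (a * b) ≤ (Real.sqrt μ * e) * (2 * Real.sqrt μ * c) := by gcongr
        have h2 : d * b * (a * a) ≤ 2 * μ * (e * c) := by
          calc _ = (d * a) * (a * b) := by ring
            _ ≤ _ := h1
            _ = 2 * (Real.sqrt μ) ^ 2 * (e * c) := by ring
            _ = _ := by rw [hsμ]
        have h3 : d * b * (μ * μ) ≤ d * b * (a * a) := by gcongr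
        rw [div_mul_eq_mul_div, le_div_iff₀ hμ0]
        have : d * b * μ * μ ≤ 2 * (e * c) * μ := by linarith
        exact le_of_mul_le_mul_right this hμ0
      have hratio : |f * a / (e * c) - 1| ≤ 2 / μ := by
        have : f * a / (e * c) - 1 = (f * a - e * c) / (e * c) := by field_simp
        rw [this, abs_div, abs_of_pos (mul_pos he0 hc0), div_le_iff₀ (mul_pos he0 hc0)]
        exact key.trans hdb
      have h2μ : 2 / μ ≤ 1 / 2 := by rw [div_le_div_iff₀ hμ0 two_pos]; linarith
      constructor
      · have h1 := (abs_le.1 hratio).1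
        have h2 : e * c ≤ 2 * (f * a) := by
          have : 1 / 2 ≤ f * a / (e * c) := by linarith
          rw [le_div_iff₀ (mul_pos he0 hc0)] at this
          linarith
        have h3 : d * a * c ≤ Real.sqrt μ * (2 * (f * a)) := by
          calc _ ≤ Real.sqrt μ * e * c := by gcongr
            _ = Real.sqrt μ * (e * c) := by ring
            _ ≤ _ := by gcongr
        have h4 : (d * c) * a ≤ (2 * Real.sqrt μ * f) * a := by linarith
        exact le_of_mul_le_mul_right h4 ha0
      · have hlog := abs_log_le_of_abs_sub_one_le h2μ hratio
        rw [Real.log_div (by positivity) (by positivity), Real.log_mul hf0.ne' ha0.ne',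
          Real.log_mul he0.ne' hc0.ne'] at hlog
        rw [Finset.sum_range_succ _ k, Finset.sum_range_succ _ (k + 1)]
        have e1 : Real.log f + (∑ j ∈ Finset.range k, Real.log (hs (A (j + 1))) + Real.log a)
          - (∑ j ∈ Finset.range (k + 1), Real.log (hs (A (j + 1) * A j)) + Real.log e) =
          (Real.log f + Real.log a - (Real.log e + Real.log c)) +
          (Real.log c + ∑ j ∈ Finset.range k, Real.log (hs (A (j + 1)))
            - ∑ j ∈ Finset.range (k + 1), Real.log (hs (A (j + 1) * A j))) := by ring
        rw [e1]
        refine (abs_add_le _ _).trans ?_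
        push_cast
        have : 2 * (2 / μ) = 4 / μ := by ring
        linarith
  exact (main m le_rfl).2

section Transfer
variable (v : ℝ → ℝ) (ω l E : ℝ)

theorem det_transferMatrix (n : ℕ) (x : ℝ) : (transferMatrix v ω l E n x).det = 1 := by
  induction n with
  | zero => simp [transferMatrix]
  | succ n ih =>
    rw [transferMatrix, Matrix.det_mul, ih, mul_one]
    simp [stepMatrix, Matrix.det_fin_two]

theorem transferMatrix_add (m n : ℕ) (x : ℝ) :
    transferMatrix v ω l E (m + n) x =
      transferMatrix v ω l E m (x + n * ω) * transferMatrix v ω l E n x := by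
  induction m with
  | zero => simp [transferMatrix]
  | succ m ih =>
    rw [show m + 1 + n = (m + n) + 1 by ring, transferMatrix, ih, transferMatrix, Matrix.mul_assoc]
    congr 2
    push_cast; ring

theorem transferMatrix_mul_eq_orderedProd (n m : ℕ) (x : ℝ) :
    transferMatrix v ω l E ((m + 1) * n) x =
      orderedProd (fun j => transferMatrix v ω l E n (x + j * (n * ω))) m := by
  induction m with
  | zero => simp [orderedProd]
  | succ m ih =>
    rw [orderedProd, ← ih, show (m + 1 + 1) * n = n + (m + 1) * n by ring, transferMatrix_add]
    congr 2
    push_cast; ring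

/-- `log` of the Hilbert–Schmidt norm of the transfer matrix. -/
noncomputable def logHS (n : ℕ) (x : ℝ) : ℝ := Real.log (hs (transferMatrix v ω l E n x))

theorem one_le_hs_transferMatrix (n : ℕ) (x : ℝ) : 1 ≤ hs (transferMatrix v ω l E n x) :=
  one_le_hs_of_det_eq_one (det_transferMatrix v ω l E n x)

theorem logHS_nonneg (n : ℕ) (x : ℝ) : 0 ≤ logHS v ω l E n x :=
  Real.log_nonneg (one_le_hs_transferMatrix v ω l E n x)

variable {v ω l E}

theorem hs_stepMatrix_le {B : ℝ} (hv : ∀ x, |v x| ≤ B) (y : ℝ) :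
    hs (stepMatrix v l E y) ≤ |l| * B + |E| + 2 := by
  have h1 : |l * v y - E| ≤ |l| * B + |E| := by
    refine (abs_sub _ _).trans ?_
    rw [abs_mul]
    gcongr
    exact hv y
  refine abs_le_of_sq_le_sq' ?_ (by linarith [abs_nonneg (l * v y - E)]) |>.2
  rw [hs_sq]
  simp only [stepMatrix, Matrix.of_apply, Matrix.cons_val', Matrix.cons_val_zero,
    Matrix.cons_val_one, Matrix.cons_val_fin_one]
  have := sq_abs (l * v y - E)
  nlinarith [abs_nonneg (l * v y - E)]

theorem hs_transferMatrix_succ_le {R : ℝ} (hR : ∀ y, hs (stepMatrix v l E y) ≤ R)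
    (n : ℕ) (x : ℝ) : hs (transferMatrix v ω l E (n + 1) x) ≤ R ^ (n + 1) := by
  have hR0 : 0 ≤ R := (hs_nonneg _).trans (hR 0)
  induction n with
  | zero => simpa [transferMatrix] using hR _
  | succ n ih =>
    rw [transferMatrix, pow_succ']
    exact (hs_mul_le _ _).trans (mul_le_mul (hR _) ih (hs_nonneg _) hR0)

theorem logHS_le {R : ℝ} (hR : ∀ y, hs (stepMatrix v l E y) ≤ R) {n : ℕ} (hn : 1 ≤ n) (x : ℝ) :
    logHS v ω l E n x ≤ n * Real.log R := by
  obtain ⟨n, rfl⟩ : ∃ k, n = k + 1 := ⟨n - 1, by omega⟩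
  have h := hs_transferMatrix_succ_le (ω := ω) hR n x
  rw [← Real.log_pow]
  exact Real.log_le_log (by linarith [one_le_hs_transferMatrix v ω l E (n + 1) x]) h

theorem logHS_add_le (m n : ℕ) (x : ℝ) :
    logHS v ω l E (m + n) x ≤ logHS v ω l E m (x + n * ω) + logHS v ω l E n x := by
  have h1 := one_le_hs_transferMatrix v ω l E m (x + n * ω)
  have h2 := one_le_hs_transferMatrix v ω l E n x
  have h3 := one_le_hs_transferMatrix v ω l E (m + n) x
  rw [logHS, logHS, logHS, ← Real.log_mul (by positivity) (by positivity)]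
  refine Real.log_le_log (by positivity) ?_
  rw [transferMatrix_add]
  exact hs_mul_le _ _

theorem hs_adjugate (M : Matrix (Fin 2) (Fin 2) ℝ) : hs M.adjugate = hs M := by
  rw [hs, hs, Matrix.adjugate_fin_two]
  congr 1
  simp
  ring

theorem logHS_le_add (m n : ℕ) (x : ℝ) :
    logHS v ω l E n x ≤ logHS v ω l E m (x + n * ω) + logHS v ω l E (m + n) x := by
  have h1 := one_le_hs_transferMatrix v ω l E m (x + n * ω)
  have h2 := one_le_hs_transferMatrix v ω l E n x
  have h3 := one_le_hs_transferMatrix v ω l E (m + n) x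
  rw [logHS, logHS, logHS, ← Real.log_mul (by positivity) (by positivity)]
  refine Real.log_le_log (by positivity) ?_
  have : transferMatrix v ω l E n x =
      (transferMatrix v ω l E m (x + n * ω)).adjugate * transferMatrix v ω l E (m + n) x := by
    rw [transferMatrix_add, ← Matrix.mul_assoc, Matrix.adjugate_mul, det_transferMatrix]
    simp
  conv_lhs => rw [this]
  refine (hs_mul_le _ _).trans ?_
  rw [hs_adjugate]

theorem transferMatrix_periodic {T : ℝ} (hv : Function.Periodic v T) (n : ℕ) :
    Function.Periodic (transferMatrix v ω l E n) T := by
  intro x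
  induction n with
  | zero => rfl
  | succ n ih =>
    rw [transferMatrix, transferMatrix, ih]
    congr 1
    rw [stepMatrix, stepMatrix, add_right_comm, hv]

theorem logHS_periodic {T : ℝ} (hv : Function.Periodic v T) (n : ℕ) :
    Function.Periodic (logHS v ω l E n) T := fun x => by
  rw [logHS, logHS, transferMatrix_periodic hv n x]

theorem continuous_transferMatrix (hv : Continuous v) (n : ℕ) :
    Continuous (transferMatrix v ω l E n) := by
  induction n with
  | zero => exact continuous_const
  | succ n ih =>
    have : Continuous fun x => stepMatrix v l E (x + ((n + 1 : ℕ) : ℝ) * ω) := by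
      refine continuous_matrix fun i j => ?_
      fin_cases i <;> fin_cases j <;> simp [stepMatrix] <;> fun_prop
    exact this.matrix_mul ih

theorem continuous_logHS (hv : Continuous v) (n : ℕ) : Continuous (logHS v ω l E n) := by
  have h := continuous_transferMatrix (ω := ω) (l := l) (E := E) hv n
  refine Continuous.log ?_ fun x =>
    (lt_of_lt_of_le one_pos (one_le_hs_transferMatrix v ω l E n x)).ne'
  unfold hs
  have hij : ∀ i j, Continuous fun x => transferMatrix v ω l E n x i j := fun i j =>
    h.matrix_elem i j
  have h00 := hij 0 0
  have h01 := hij 0 1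
  have h10 := hij 1 0
  have h11 := hij 1 1
  fun_prop

/-- Stability of the transfer matrices under perturbations of the potential. -/
theorem abs_logHS_sub_le {w : ℝ → ℝ} {R ε : ℝ} (hR1 : 1 ≤ R)
    (hR : ∀ y, hs (stepMatrix v l E y) ≤ R)
    (hR' : ∀ y, hs (stepMatrix w l E y) ≤ R) (hε : ∀ y, |v y - w y| ≤ ε) (n : ℕ) (x : ℝ) :
    |logHS v ω l E n x - logHS w ω l E n x| ≤ 2 * n * (|l| * ε) * R ^ n := by
  have hε0 : 0 ≤ ε := (abs_nonneg _).trans (hε 0)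
  have hbd : ∀ n, hs (transferMatrix v ω l E n x) ≤ 2 * R ^ n := by
    intro n
    rcases n with _ | n
    · simp only [transferMatrix, pow_zero, mul_one, hs]
      rw [Real.sqrt_le_left (by norm_num)]
      simp; norm_num
    · have := hs_transferMatrix_succ_le (ω := ω) hR n x
      linarith [hs_nonneg (transferMatrix v ω l E (n + 1) x)]
  have hdiff : ∀ n, hs (transferMatrix v ω l E n x - transferMatrix w ω l E n x) ≤
      2 * n * (|l| * ε) * R ^ n := by
    intro n
    induction n with
    | zero => simp [transferMatrix, hs]
    | succ n ih =>
      rw [transferMatrix, transferMatrix]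
      set y := x + ((n + 1 : ℕ) : ℝ) * ω
      have e1 : stepMatrix v l E y * transferMatrix v ω l E n x
          - stepMatrix w l E y * transferMatrix w ω l E n x =
          (stepMatrix v l E y - stepMatrix w l E y) * transferMatrix v ω l E n x +
          stepMatrix w l E y * (transferMatrix v ω l E n x - transferMatrix w ω l E n x) := by
        simp only [sub_mul, mul_sub]; abel
      have e2 : hs (stepMatrix v l E y - stepMatrix w l E y) ≤ |l| * ε := by
        have : hs (stepMatrix v l E y - stepMatrix w l E y) = |l| * |v y - w y| := by
          rw [← abs_mul, ← Real.sqrt_sq_eq_abs, hs]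
          congr 1
          simp [stepMatrix]; ring
        rw [this]
        gcongr
        exact hε y
      rw [e1]
      have h0 : 0 ≤ |l| * ε := by positivity
      calc _ ≤ _ := hs_add_le _ _
        _ ≤ |l| * ε * (2 * R ^ n) + R * (2 * n * (|l| * ε) * R ^ n) := by
          refine add_le_add ((hs_mul_le _ _).trans ?_) ((hs_mul_le _ _).trans ?_)
          · exact mul_le_mul e2 (hbd n) (hs_nonneg _) h0
          · exact mul_le_mul (hR' y) ih (hs_nonneg _) (by linarith)
        _ ≤ R * (|l| * ε * (2 * R ^ n)) + R * (2 * n * (|l| * ε) * R ^ n) := by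
          refine add_le_add_left (le_mul_of_one_le_left (by positivity) hR1) _
        _ = _ := by push_cast; ring
  have h1 := one_le_hs_transferMatrix v ω l E n x
  have h2 := one_le_hs_transferMatrix w ω l E n x
  have habs : |hs (transferMatrix v ω l E n x) - hs (transferMatrix w ω l E n x)| ≤
      2 * n * (|l| * ε) * R ^ n := by
    have hsub : ∀ P Q : Matrix (Fin 2) (Fin 2) ℝ, hs P - hs Q ≤ hs (P - Q) := fun P Q => by
      have := hs_add_le (P - Q) Q
      rw [sub_add_cancel] at this
      linarith
    rw [abs_le]
    constructor
    · have := hsub (transferMatrix w ω l E n x) (transferMatrix v ω l E n x)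
      have h3 : hs (transferMatrix w ω l E n x - transferMatrix v ω l E n x) =
          hs (transferMatrix v ω l E n x - transferMatrix w ω l E n x) := by
        rw [← neg_sub, ← neg_one_smul ℝ, hs_smul]; simp
      linarith [hdiff n]
    · linarith [hdiff n, hsub (transferMatrix v ω l E n x) (transferMatrix w ω l E n x)]
  have hlog : ∀ a b : ℝ, 1 ≤ a → 1 ≤ b → Real.log a - Real.log b ≤ |a - b| := by
    intro a b ha hb
    rw [← Real.log_div (by positivity) (by positivity)]
    refine (Real.log_le_sub_one_of_pos (by positivity)).trans ?_
    have : a / b - 1 = (a - b) / b := by field_simp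
    rw [this, div_le_iff₀ (by linarith)]
    exact (le_abs_self _).trans (le_mul_of_one_le_right (abs_nonneg _) hb)
  refine le_trans ?_ habs
  rw [abs_sub_le_iff]
  exact ⟨hlog _ _ h1 h2, by rw [abs_sub_comm]; exact hlog _ _ h2 h1⟩

/-- If the potential term is large along the orbit, the transfer matrix grows. -/
theorem pow_le_hs_transferMatrix {ρ : ℝ} (hρ : 2 ≤ ρ) {n : ℕ} {x : ℝ}
    (h : ∀ j < n, ρ ≤ |l * v (x + ((j + 1 : ℕ) : ℝ) * ω) - E|) :
    (ρ - 1) ^ n ≤ hs (transferMatrix v ω l E n x) := by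
  refine le_trans ?_ (abs_entry_le_hs _)
  suffices (ρ - 1) ^ n ≤ |transferMatrix v ω l E n x 0 0| ∧
      |transferMatrix v ω l E n x 1 0| ≤ |transferMatrix v ω l E n x 0 0| from this.1
  induction n with
  | zero => simp [transferMatrix]
  | succ n ih =>
    obtain ⟨h1, h2⟩ := ih fun j hj => h j (by omega)
    have h3 := h n (by omega)
    set a := l * v (x + ((n + 1 : ℕ) : ℝ) * ω) - E with ha
    set p := transferMatrix v ω l E n x 0 0
    set r := transferMatrix v ω l E n x 1 0
    have e0 : transferMatrix v ω l E (n + 1) x 0 0 = a * p - r := by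
      simp [transferMatrix, stepMatrix, Matrix.mul_apply, Fin.sum_univ_two, a, p, r]; ring
    have e1 : transferMatrix v ω l E (n + 1) x 1 0 = p := by
      simp [transferMatrix, stepMatrix, Matrix.mul_apply, Fin.sum_univ_two, p]
    rw [e0, e1]
    have h4 : (ρ - 1) * |p| ≤ |a * p - r| := by
      have := abs_sub_abs_le_abs_sub (a * p) r
      rw [abs_mul] at this
      have : ρ * |p| ≤ |a| * |p| := by gcongr
      linarith
    have hp := abs_nonneg p
    refine ⟨?_, by nlinarith⟩
    rw [pow_succ']
    exact (mul_le_mul_of_nonneg_left h1 (by linarith)).trans h4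

end Transfer

/-- Lebesgue measure on one period `(0, 2π]`. -/
noncomputable abbrev circleMeasure : Measure ℝ := volume.restrict (Set.Ioc 0 (2 * Real.pi))

theorem circleMeasure_real_eq_integral {B : Set ℝ} (hB : MeasurableSet B) :
    circleMeasure.real B = ∫ x in (0 : ℝ)..(2 * Real.pi), B.indicator (fun _ => (1 : ℝ)) x := by
  rw [intervalIntegral.integral_of_le (by positivity), integral_indicator_const _ hB]
  simp

theorem indicator_periodic {B : Set ℝ} {T : ℝ} (hp : ∀ x, x + T ∈ B ↔ x ∈ B) :
    Function.Periodic (B.indicator (fun _ => (1 : ℝ))) T := by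
  intro x
  by_cases h : x ∈ B
  · rw [Set.indicator_of_mem h, Set.indicator_of_mem ((hp x).2 h)]
  · rw [Set.indicator_of_notMem h, Set.indicator_of_notMem (fun h' => h ((hp x).1 h'))]

theorem circleMeasure_real_eq_window {B : Set ℝ} (hB : MeasurableSet B)
    (hp : ∀ x, x + 2 * Real.pi ∈ B ↔ x ∈ B) (a : ℝ) :
    circleMeasure.real B = (volume.restrict (Set.Ioc a (a + 2 * Real.pi))).real B := by
  rw [circleMeasure_real_eq_integral hB]
  have := (indicator_periodic hp).intervalIntegral_add_eq 0 a
  rw [zero_add] at this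
  rw [this, intervalIntegral.integral_of_le (by linarith [Real.pi_pos]),
    integral_indicator_const _ hB]
  simp

theorem circleMeasure_real_shift {B : Set ℝ} (hB : MeasurableSet B)
    (hp : ∀ x, x + 2 * Real.pi ∈ B ↔ x ∈ B) (c : ℝ) :
    circleMeasure.real {x | x + c ∈ B} = circleMeasure.real B := by
  have hB' : MeasurableSet {x | x + c ∈ B} := (measurable_add_const c) hB
  rw [circleMeasure_real_eq_integral hB', circleMeasure_real_eq_integral hB]
  have h1 : ∀ x, Set.indicator {x | x + c ∈ B} (fun _ => (1 : ℝ)) x =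
      B.indicator (fun _ => (1 : ℝ)) (x + c) := fun x => by
    by_cases h : x + c ∈ B
    · rw [Set.indicator_of_mem h, Set.indicator_of_mem]; exact h
    · rw [Set.indicator_of_notMem h, Set.indicator_of_notMem]; exact h
  simp_rw [h1]
  rw [intervalIntegral.integral_comp_add_right]
  have := (indicator_periodic hp).intervalIntegral_add_eq 0 c
  rw [zero_add] at this
  rw [this, zero_add, add_comm c]

/-- A set of small measure leaves a point in every arc that is longer than its measure. -/
theorem exists_notMem_of_circleMeasure_lt {B : Set ℝ} (hB : MeasurableSet B)
    (hp : ∀ x, x + 2 * Real.pi ∈ B ↔ x ∈ B) {δ : ℝ} (hδ : δ ≤ Real.pi)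
    (h : circleMeasure.real B < δ) (x : ℝ) : ∃ y, |y - x| ≤ δ ∧ y ∉ B := by
  by_contra! hcon
  have hδ0 : 0 < δ := lt_of_le_of_lt measureReal_nonneg h
  rw [circleMeasure_real_eq_window hB hp x] at h
  have hsub : Set.Ioc x (x + δ) ⊆ B ∩ Set.Ioc x (x + 2 * Real.pi) := fun y hy =>
    ⟨hcon y (by rw [abs_le]; constructor <;> linarith [hy.1, hy.2]),
      hy.1, by linarith [hy.2, Real.pi_pos]⟩
  have h2 : volume.real (Set.Ioc x (x + δ)) ≤ volume.real (B ∩ Set.Ioc x (x + 2 * Real.pi)) := by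
    refine measureReal_mono hsub (ne_of_lt ?_)
    exact lt_of_le_of_lt (measure_mono Set.inter_subset_right) measure_Ioc_lt_top
  rw [Real.volume_real_Ioc_of_le (by linarith)] at h2
  rw [measureReal_restrict_apply hB] at h
  linarith

/-- The point `e^{ix}` of the unit circle. -/
noncomputable def circPt (x : ℝ) : ℂ := Complex.exp (x * Complex.I)

theorem norm_circPt (x : ℝ) : ‖circPt x‖ = 1 := Complex.norm_exp_ofReal_mul_I x

theorem circPt_add_two_pi (x : ℝ) : circPt (x + 2 * Real.pi) = circPt x := by
  rw [circPt, circPt]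
  push_cast
  rw [add_mul, Complex.exp_periodic]

theorem circPt_add (x y : ℝ) : circPt (x + y) = circPt x * circPt y := by
  simp [circPt, add_mul, Complex.exp_add]

theorem continuous_circPt : Continuous circPt := by unfold circPt; fun_prop

theorem norm_circPt_sub (x y : ℝ) : ‖circPt x - circPt y‖ = 2 * |Real.sin ((x - y) / 2)| := by
  have h : circPt x - circPt y = circPt y * (Complex.exp (Complex.I * ((x - y : ℝ) : ℂ)) - 1) := by
    rw [mul_sub, mul_one, mul_comm Complex.I]
    change _ = circPt y * circPt (x - y) - _
    rw [← circPt_add]; congr 2; ring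
  rw [h, norm_mul, norm_circPt, one_mul, Complex.norm_exp_I_mul_ofReal_sub_one]
  simp

theorem norm_circPt_sub_le (x y : ℝ) : ‖circPt x - circPt y‖ ≤ |x - y| := by
  rw [norm_circPt_sub]
  have := Real.abs_sin_le_abs (x := (x - y) / 2)
  rw [abs_div, abs_two] at this
  linarith

theorem abs_le_of_norm_circPt_sub {x y : ℝ} (h : |x - y| ≤ Real.pi) :
    |x - y| ≤ Real.pi / 2 * ‖circPt x - circPt y‖ := by
  rw [norm_circPt_sub]
  have key : 2 / Real.pi * (|x - y| / 2) ≤ |Real.sin ((x - y) / 2)| := by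
    have h1 := Real.mul_le_sin (x := |x - y| / 2) (by positivity) (by linarith)
    refine h1.trans ?_
    rcases abs_cases (x - y) with ⟨h2, _⟩ | ⟨h2, _⟩
    · rw [h2]; exact le_abs_self _
    · rw [h2, neg_div, Real.sin_neg]; exact neg_le_abs _
  have hpi := Real.pi_pos
  have : 2 / Real.pi * (|x - y| / 2) * Real.pi ≤ |Real.sin ((x - y) / 2)| * Real.pi := by gcongr
  have h3 : 2 / Real.pi * (|x - y| / 2) * Real.pi = |x - y| := by field_simp
  linarith

theorem circleMeasure_near_le (z : ℂ) {η : ℝ} (hη : 0 < η) :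
    circleMeasure.real {x | ‖circPt x - z‖ < η} ≤ 2 * Real.pi * η := by
  by_cases hne : ∃ x₀, ‖circPt x₀ - z‖ < η
  · obtain ⟨x₀, hx₀⟩ := hne
    have hmeas : MeasurableSet {x | ‖circPt x - z‖ < η} :=
      (isOpen_lt ((continuous_circPt.sub continuous_const).norm) continuous_const).measurableSet
    rw [circleMeasure_real_eq_window hmeas (fun x => by
      simp only [Set.mem_ofPred_eq, circPt_add_two_pi]) (x₀ - Real.pi),
      measureReal_restrict_apply hmeas]
    have hsub : {x | ‖circPt x - z‖ < η} ∩ Set.Ioc (x₀ - Real.pi) (x₀ - Real.pi + 2 * Real.pi) ⊆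
        Set.Icc (x₀ - Real.pi * η) (x₀ + Real.pi * η) := by
      rintro x ⟨hx1, hx2, hx3⟩
      have h1 : |x - x₀| ≤ Real.pi := by rw [abs_le]; constructor <;> linarith
      have h2 : ‖circPt x - circPt x₀‖ ≤ 2 * η := by
        calc _ = ‖(circPt x - z) - (circPt x₀ - z)‖ := by congr 1; ring
          _ ≤ _ := norm_sub_le _ _
          _ ≤ _ := by have := Set.mem_ofPred_eq ▸ hx1; linarith
      have h3 := abs_le_of_norm_circPt_sub h1
      have h4 : |x - x₀| ≤ Real.pi * η := by nlinarith [Real.pi_pos]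
      rw [abs_le] at h4
      exact ⟨by linarith, by linarith⟩
    refine (measureReal_mono hsub (by simp)).trans ?_
    rw [Real.volume_real_Icc_of_le (by nlinarith [Real.pi_pos])]
    linarith
  · have : {x | ‖circPt x - z‖ < η} = ∅ := by
      ext x; simp only [Set.mem_ofPred_eq, Set.mem_empty_iff_false, iff_false]
      exact fun h => hne ⟨x, h⟩
    rw [this]; simp; positivity

/-- The Denjoy–Koksma inequality for a `C¹` function. -/
theorem denjoy_koksma {g g' : ℝ → ℝ} (hg : ∀ x, HasDerivAt g (g' x) x) (hg' : Continuous g')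
    (hper : Function.Periodic g (2 * Real.pi)) (hper' : Function.Periodic g' (2 * Real.pi))
    {q : ℕ} (hq : 0 < q) {p : ℤ} (hpq : IsCoprime p (q : ℤ)) {α : ℝ}
    (hα : |α - 2 * Real.pi * p / q| ≤ 2 * Real.pi / q ^ 2) (x : ℝ) :
    |∑ j ∈ Finset.range q, g (x + j * α) -
        q * ((2 * Real.pi)⁻¹ * ∫ t in (0 : ℝ)..(2 * Real.pi), g t)| ≤
      2 * ∫ t in (0 : ℝ)..(2 * Real.pi), |g' t| := by
  have hq0 : (0 : ℝ) < q := by exact_mod_cast hq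
  have hpi := Real.pi_pos
  have hqz : (0 : ℤ) < q := by exact_mod_cast hq
  set δ : ℝ := 2 * Real.pi / q with hδ
  have hδ0 : 0 < δ := by positivity
  have hqδ : q * δ = 2 * Real.pi := by rw [hδ]; field_simp
  have hgc : Continuous g := continuous_iff_continuousAt.2 fun x => (hg x).continuousAt
  have hgi : ∀ a b, IntervalIntegrable g volume a b := fun a b => hgc.intervalIntegrable a b
  have hg'i : ∀ a b, IntervalIntegrable (fun t => |g' t|) volume a b := fun a b =>
    hg'.abs.intervalIntegrable a b
  let a : ℕ → ℝ := fun k => x + k * δ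
  let b : ℕ → ℝ := fun k => x - δ + k * δ
  let I : ℕ → ℝ := fun k => δ⁻¹ * ∫ t in (a k)..(a (k + 1)), g t
  let V : ℕ → ℝ := fun k => (∫ t in (b k)..(b (k + 1)), |g' t|) + ∫ t in (a k)..(a (k + 1)), |g' t|
  let κ : ℕ → ℕ := fun j => ((j * p : ℤ) % (q : ℤ)).toNat
  have hκ : ∀ j, ((κ j : ℕ) : ℤ) = (j * p : ℤ) % (q : ℤ) := fun j =>
    Int.toNat_of_nonneg (Int.emod_nonneg _ hqz.ne')
  have hκlt : ∀ j, κ j < q := fun j => by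
    have := Int.emod_lt_of_pos (j * p : ℤ) hqz
    rw [← hκ] at this; exact_mod_cast this
  have hinj : Set.InjOn κ (Finset.range q : Set ℕ) := by
    intro i hi j hj hij
    have h1 : (i * p : ℤ) % (q : ℤ) = (j * p : ℤ) % (q : ℤ) := by rw [← hκ, ← hκ, hij]
    have h2 : (q : ℤ) ∣ (i - j) * p := by
      rw [sub_mul]; exact Int.ModEq.dvd (Int.ModEq.symm h1)
    have h3 : (q : ℤ) ∣ (i - j) := hpq.symm.dvd_of_dvd_mul_right h2
    rw [Finset.coe_range, Set.mem_Iio] at hi hj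
    have h4 := Int.eq_zero_of_abs_lt_dvd h3 (by rw [abs_lt]; constructor <;> omega)
    omega
  have hreindex : ∀ f : ℕ → ℝ, ∑ j ∈ Finset.range q, f (κ j) = ∑ k ∈ Finset.range q, f k := by
    intro f
    refine Finset.sum_nbij κ (fun j _ => Finset.mem_range.2 (hκlt j)) hinj ?_ fun _ _ => rfl
    exact Finset.surjOn_of_injOn_of_card_le κ (fun j _ => by simpa using hκlt j) hinj le_rfl
  have hba : ∀ k, b (k + 1) = a k := fun k => by simp only [a, b]; push_cast; ring
  have hak : ∀ k, a (k + 1) = a k + δ := fun k => by simp only [a]; push_cast; ring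
  have hbk : ∀ k, b k = a k - δ := fun k => by simp only [a, b]; ring
  have hvar : ∀ k y z, b k ≤ y → y ≤ a (k + 1) → b k ≤ z → z ≤ a (k + 1) →
      |g y - g z| ≤ V k := by
    intro k y z hy1 hy2 hz1 hz2
    wlog hyz : z ≤ y generalizing y z
    · rw [abs_sub_comm]
      exact this z y hz1 hz2 hy1 hy2 (by linarith)
    have hint : ∫ t in z..y, g' t = g y - g z :=
      intervalIntegral.integral_eq_sub_of_hasDerivAt (fun t _ => hg t) (hg'.intervalIntegrable _ _)
    rw [← hint]
    have hV : V k = ∫ t in (b k)..(a (k + 1)), |g' t| := by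
      simp only [V]
      rw [hba]
      exact intervalIntegral.integral_add_adjacent_intervals (hg'i _ _) (hg'i _ _)
    rw [hV]
    refine (intervalIntegral.abs_integral_le_integral_abs hyz).trans ?_
    exact intervalIntegral.integral_mono_interval hz1 hyz hy2
      (Filter.Eventually.of_forall fun t => abs_nonneg _) (hg'i _ _)
  have hcell : ∀ k z, b k ≤ z → z ≤ a (k + 1) → |g z - I k| ≤ V k := by
    intro k z hz1 hz2
    have h1 : g z - I k = δ⁻¹ * ∫ t in (a k)..(a (k + 1)), (g z - g t) := by
      rw [intervalIntegral.integral_sub (by simp) (hgi _ _), intervalIntegral.integral_const, hak]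
      simp only [I, hak, smul_eq_mul]
      field_simp
      ring
    rw [h1, abs_mul, abs_of_pos (inv_pos.2 hδ0)]
    have h2 : ‖∫ t in (a k)..(a (k + 1)), (g z - g t)‖ ≤ V k * |a (k + 1) - a k| := by
      refine intervalIntegral.norm_integral_le_of_norm_le_const fun t ht => ?_
      rw [Set.uIoc_of_le (by rw [hak]; linarith)] at ht
      exact hvar k z t hz1 hz2 (by rw [hbk]; linarith [ht.1]) ht.2
    rw [hak, add_sub_cancel_left, abs_of_pos hδ0, Real.norm_eq_abs, ← hak] at h2
    calc _ ≤ δ⁻¹ * (V k * δ) := by gcongr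
      _ = V k := by field_simp
  have hpt : ∀ j ∈ Finset.range q, |g (x + j * α) - I (κ j)| ≤ V (κ j) := by
    intro j hj
    have hjq : (j : ℝ) ≤ q := by exact_mod_cast (Finset.mem_range.1 hj).le
    set m : ℤ := (j * p : ℤ) / (q : ℤ) with hm
    have hdiv : ((j : ℝ) * p) = q * (m : ℝ) + (κ j : ℝ) := by
      have := Int.mul_ediv_add_emod (j * p : ℤ) q
      rw [← hκ] at this
      exact_mod_cast this.symm
    set θ : ℝ := j * (α - 2 * Real.pi * p / q) with hθ
    have hθδ : |θ| ≤ δ := by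
      rw [hθ, abs_mul, Nat.abs_cast]
      calc (j : ℝ) * |α - 2 * Real.pi * p / q| ≤ q * (2 * Real.pi / q ^ 2) := by gcongr
        _ = δ := by rw [hδ]; field_simp
    have hx : x + j * α = (a (κ j) + θ) + m * (2 * Real.pi) := by
      have : (j : ℝ) * (2 * Real.pi * p / q) = (κ j : ℝ) * δ + m * (2 * Real.pi) := by
        calc (j : ℝ) * (2 * Real.pi * p / q) = ((j : ℝ) * p) * (2 * Real.pi / q) := by ring
          _ = _ := by rw [hdiv, hδ]; field_simp; ring
      simp only [a, hθ]
      linear_combination this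
    rw [hx, hper.int_mul m]
    rw [abs_le] at hθδ
    exact hcell _ _ (by rw [hbk]; linarith) (by rw [hak]; linarith)
  have hsumI : ∑ k ∈ Finset.range q, I k =
      q * ((2 * Real.pi)⁻¹ * ∫ t in (0 : ℝ)..(2 * Real.pi), g t) := by
    simp only [I]
    rw [← Finset.mul_sum, intervalIntegral.sum_integral_adjacent_intervals fun k _ => hgi _ _]
    have : a q = a 0 + 2 * Real.pi := by simp only [a]; rw [hqδ]; simp
    rw [this, hper.intervalIntegral_add_eq (a 0) 0, zero_add, ← mul_assoc]
    congr 1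
    rw [hδ]; field_simp
  have hperabs : Function.Periodic (fun t => |g' t|) (2 * Real.pi) := fun t => by
    simp only [hper' t]
  have hsumV : ∑ k ∈ Finset.range q, V k = 2 * ∫ t in (0 : ℝ)..(2 * Real.pi), |g' t| := by
    simp only [V]
    rw [Finset.sum_add_distrib,
      intervalIntegral.sum_integral_adjacent_intervals fun k _ => hg'i _ _,
      intervalIntegral.sum_integral_adjacent_intervals fun k _ => hg'i _ _]
    have h1 : a q = a 0 + 2 * Real.pi := by simp only [a]; rw [hqδ]; simp
    have h2 : b q = b 0 + 2 * Real.pi := by simp only [b]; rw [hqδ]; simp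
    rw [h1, h2, hperabs.intervalIntegral_add_eq (a 0) 0,
      hperabs.intervalIntegral_add_eq (b 0) 0, zero_add]
    ring
  rw [← hsumI, ← hsumV, ← hreindex I, ← hreindex V, ← Finset.sum_sub_distrib]
  exact (Finset.abs_sum_le_sum_abs _ _).trans (Finset.sum_le_sum hpt)

theorem one_add_sq_sub_cos_pos {r : ℝ} (hr : 0 ≤ r) (hr1 : r ≠ 1) (t : ℝ) :
    0 < 1 + r ^ 2 - 2 * r * Real.cos t := by
  have h1 := Real.cos_le_one t
  have h2 : 0 < (1 - r) ^ 2 := by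
    have : 1 - r ≠ 0 := fun h => hr1 (by linarith)
    positivity
  nlinarith

theorem norm_circPt_sub_mul_sq (r t θ : ℝ) :
    ‖circPt t - r * circPt θ‖ ^ 2 = 1 + r ^ 2 - 2 * r * Real.cos (t - θ) := by
  rw [← Complex.normSq_eq_norm_sq, circPt, circPt, Complex.normSq_apply]
  simp only [Complex.sub_re, Complex.sub_im, Complex.mul_re, Complex.mul_im, Complex.ofReal_re,
    Complex.ofReal_im, Complex.exp_ofReal_mul_I_re, Complex.exp_ofReal_mul_I_im, Real.cos_sub]
  nlinarith [Real.sin_sq_add_cos_sq t, Real.sin_sq_add_cos_sq θ]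

theorem log_norm_circPt_sub_mul (r t θ : ℝ) :
    Real.log ‖circPt t - r * circPt θ‖ =
      1 / 2 * Real.log (1 + r ^ 2 - 2 * r * Real.cos (t - θ)) := by
  rw [← norm_circPt_sub_mul_sq, Real.log_pow]; push_cast; ring

/-- The mean of `log |e^{it} - r|` over the circle. -/
theorem integral_half_log {r : ℝ} (hr : 0 ≤ r) :
    (2 * Real.pi)⁻¹ * ∫ t in (0 : ℝ)..(2 * Real.pi),
      1 / 2 * Real.log (1 + r ^ 2 - 2 * r * Real.cos t) = Real.posLog r := by
  have h := circleAverage_log_norm_sub_const_eq_posLog (a := (r : ℂ))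
  rw [Complex.norm_of_nonneg hr, Real.circleAverage, smul_eq_mul] at h
  rw [← h]
  congr 1
  refine intervalIntegral.integral_congr fun t _ => ?_
  have := log_norm_circPt_sub_mul r t 0
  rw [sub_zero] at this
  simp only [← this]
  simp [circPt, circleMap]

theorem integral_abs_deriv_half_log {r : ℝ} (hr : 0 ≤ r) (hr1 : r ≠ 1) :
    ∫ t in (0 : ℝ)..(2 * Real.pi), |r * Real.sin t / (1 + r ^ 2 - 2 * r * Real.cos t)| =
      2 * (Real.log (1 + r) - Real.log |1 - r|) := by
  have hpos := one_add_sq_sub_cos_pos hr hr1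
  have hpi := Real.pi_pos
  let G : ℝ → ℝ := fun t => 1 / 2 * Real.log (1 + r ^ 2 - 2 * r * Real.cos t)
  let G' : ℝ → ℝ := fun t => r * Real.sin t / (1 + r ^ 2 - 2 * r * Real.cos t)
  have hG : ∀ t, HasDerivAt G (G' t) t := by
    intro t
    have h1 : HasDerivAt (fun t => 1 + r ^ 2 - 2 * r * Real.cos t) (2 * r * Real.sin t) t := by
      convert! ((Real.hasDerivAt_cos t).const_mul (2 * r)).const_sub (1 + r ^ 2) using 1
      ring
    convert! (h1.log (hpos t).ne').const_mul (1 / 2) using 1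
    simp only [G']; ring
  have hG'c : Continuous G' := by
    simp only [G']
    exact Continuous.div (by fun_prop) (by fun_prop) fun t => (hpos t).ne'
  have hi : ∀ a b, IntervalIntegrable (fun t => |G' t|) volume a b := fun a b =>
    hG'c.abs.intervalIntegrable a b
  have h1 : ∫ t in (0 : ℝ)..Real.pi, |G' t| = G Real.pi - G 0 := by
    rw [← intervalIntegral.integral_eq_sub_of_hasDerivAt (fun t _ => hG t)
      (hG'c.intervalIntegrable _ _)]
    refine intervalIntegral.integral_congr fun t ht => ?_
    rw [Set.uIcc_of_le hpi.le] at ht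
    exact abs_of_nonneg (div_nonneg (mul_nonneg hr (Real.sin_nonneg_of_mem_Icc ht)) (hpos t).le)
  have h2 : ∫ t in Real.pi..(2 * Real.pi), |G' t| = G Real.pi - G (2 * Real.pi) := by
    rw [← neg_sub, ← intervalIntegral.integral_eq_sub_of_hasDerivAt (fun t _ => hG t)
      (hG'c.intervalIntegrable _ _), ← intervalIntegral.integral_neg]
    refine intervalIntegral.integral_congr fun t ht => ?_
    rw [Set.uIcc_of_le (by linarith)] at ht
    refine abs_of_nonpos (div_nonpos_of_nonpos_of_nonneg (mul_nonpos_of_nonneg_of_nonpos hr ?_)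
      (hpos t).le)
    have := Real.sin_nonneg_of_mem_Icc (x := t - Real.pi) ⟨by linarith [ht.1], by linarith [ht.2]⟩
    rw [Real.sin_sub_pi] at this
    linarith
  change ∫ t in (0 : ℝ)..(2 * Real.pi), |G' t| = _
  rw [← intervalIntegral.integral_add_adjacent_intervals (hi 0 Real.pi) (hi _ _), h1, h2]
  have e1 : G Real.pi = Real.log (1 + r) := by
    simp only [G, Real.cos_pi]
    rw [show 1 + r ^ 2 - 2 * r * -1 = (1 + r) ^ 2 by ring, Real.log_pow]; push_cast; ring
  have e2 : G 0 = Real.log |1 - r| := by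
    simp only [G, Real.cos_zero]
    rw [show 1 + r ^ 2 - 2 * r * 1 = (1 - r) ^ 2 by ring, Real.log_pow, Real.log_abs]
    push_cast; ring
  have e3 : G (2 * Real.pi) = G 0 := by simp only [G, Real.cos_two_pi, Real.cos_zero]
  rw [e3, e1, e2]; ring

/-- `p / q` is a reduced fraction approximating `α / 2π` to order `q⁻²`. -/
structure GoodApprox (α : ℝ) (q : ℕ) (p : ℤ) : Prop where
  pos : 0 < q
  coprime : IsCoprime p (q : ℤ)
  approx : |α - 2 * Real.pi * p / q| ≤ 2 * Real.pi / q ^ 2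

theorem exists_eq_mul_circPt (z : ℂ) : ∃ θ : ℝ, z = ‖z‖ * circPt θ :=
  ⟨z.arg, (Complex.norm_mul_exp_arg_mul_I z).symm⟩

theorem abs_sum_log_sub_le_of_norm_ne_one {α : ℝ} {q : ℕ} {p : ℤ} (hq : GoodApprox α q p)
    {z : ℂ} (hz : ‖z‖ ≠ 1) (x : ℝ) :
    |∑ j ∈ Finset.range q, Real.log ‖circPt (x + j * α) - z‖ - q * Real.posLog ‖z‖| ≤
      4 * (Real.log (1 + ‖z‖) - Real.log |1 - ‖z‖|) := by
  obtain ⟨θ, hθ⟩ := exists_eq_mul_circPt z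
  set r := ‖z‖ with hr
  have hr0 : 0 ≤ r := norm_nonneg z
  have hpos := one_add_sq_sub_cos_pos hr0 hz
  have hlog : ∀ t, Real.log ‖circPt t - z‖ =
      1 / 2 * Real.log (1 + r ^ 2 - 2 * r * Real.cos (t - θ)) := fun t => by
    rw [← log_norm_circPt_sub_mul, ← hθ]
  have hdk := denjoy_koksma (g := fun t => 1 / 2 * Real.log (1 + r ^ 2 - 2 * r * Real.cos t))
    (g' := fun t => r * Real.sin t / (1 + r ^ 2 - 2 * r * Real.cos t)) (fun t => by
      have h1 : HasDerivAt (fun t => 1 + r ^ 2 - 2 * r * Real.cos t) (2 * r * Real.sin t) t := by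
        convert! ((Real.hasDerivAt_cos t).const_mul (2 * r)).const_sub (1 + r ^ 2) using 1
        ring
      convert! (h1.log (hpos t).ne').const_mul (1 / 2) using 1
      ring) (Continuous.div (by fun_prop) (by fun_prop) fun t => (hpos t).ne')
    (fun t => by simp only [Real.cos_add_two_pi])
    (fun t => by simp only [Real.cos_add_two_pi, Real.sin_add_two_pi])
    hq.pos hq.coprime hq.approx (x - θ)
  rw [integral_half_log hr0, integral_abs_deriv_half_log hr0 hz] at hdk
  simp_rw [hlog]
  refine le_trans (le_of_eq ?_) (hdk.trans (le_of_eq (by ring)))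
  congr 2
  refine Finset.sum_congr rfl fun j _ => ?_
  congr 5
  ring

/-- Birkhoff sums of `log |e^{it} - z|` along an orbit that stays away from `z`. -/
theorem abs_sum_log_sub_le {α : ℝ} {q : ℕ} {p : ℤ} (hq : GoodApprox α q p) (z : ℂ) {η : ℝ}
    (hη : 0 < η) (hη1 : η ≤ 1 / 4) {x : ℝ} (hx : ∀ j < q, η ≤ ‖circPt (x + j * α) - z‖) :
    |∑ j ∈ Finset.range q, Real.log ‖circPt (x + j * α) - z‖ - q * Real.posLog ‖z‖| ≤
      4 * Real.log (3 / η ^ 2) + q * (5 * η) := by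
  have far : ∀ z : ℂ, η ^ 2 ≤ |1 - ‖z‖| →
      |∑ j ∈ Finset.range q, Real.log ‖circPt (x + j * α) - z‖ - q * Real.posLog ‖z‖| ≤
      4 * Real.log (3 / η ^ 2) := by
    intro z hz
    have hpos : 0 < |1 - ‖z‖| := lt_of_lt_of_le (by positivity) hz
    have hz1 : ‖z‖ ≠ 1 := fun h => by rw [h] at hpos; simp at hpos
    refine (abs_sum_log_sub_le_of_norm_ne_one hq hz1 x).trans ?_
    have hr := norm_nonneg z
    rw [← Real.log_div (by positivity) hpos.ne']
    gcongr 4 * ?_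
    refine Real.log_le_log (by positivity) ?_
    rw [div_le_div_iff₀ hpos (by positivity)]
    rcases le_or_gt ‖z‖ 2 with h2 | h2
    · nlinarith
    · have h3 : |1 - ‖z‖| = ‖z‖ - 1 := by rw [abs_sub_comm, abs_of_pos (by linarith)]
      rw [h3]
      have h4 : η ^ 2 ≤ 1 := by nlinarith
      nlinarith
  rcases le_or_gt (η ^ 2) |1 - ‖z‖| with h | h
  · have h1 : 0 ≤ (q : ℝ) * (5 * η) := by positivity
    linarith [far z h]
  obtain ⟨θ, hθ⟩ := exists_eq_mul_circPt z
  set r := ‖z‖ with hr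
  set w : ℂ := ((1 + η ^ 2 : ℝ) : ℂ) * circPt θ with hw
  have hwn : ‖w‖ = 1 + η ^ 2 := by
    rw [hw, norm_mul, norm_circPt, mul_one, Complex.norm_of_nonneg (by positivity)]
  have hzw : ‖w - z‖ ≤ 2 * η ^ 2 := by
    have : w - z = ((1 + η ^ 2 - r : ℝ) : ℂ) * circPt θ := by
      rw [hw]; conv_lhs => rw [hθ]
      push_cast; ring
    rw [this, norm_mul, norm_circPt, mul_one, Complex.norm_real, Real.norm_eq_abs]
    rw [abs_lt] at h
    rw [abs_le]; constructor <;> nlinarith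
  have hwfar := far w (by rw [hwn]; simp)
  have hterm : ∀ j ∈ Finset.range q, |Real.log ‖circPt (x + j * α) - w‖ -
      Real.log ‖circPt (x + j * α) - z‖| ≤ 4 * η := by
    intro j hj
    have h1 := hx j (Finset.mem_range.1 hj)
    set y := circPt (x + j * α)
    have hyz : 0 < ‖y - z‖ := by linarith
    have hyw : ‖y - w‖ ≠ 0 := by
      have : ‖y - z‖ ≤ ‖y - w‖ + ‖w - z‖ := norm_sub_le_norm_sub_add_norm_sub y w z
      nlinarith
    rw [← Real.log_div hyw hyz.ne']
    have h2 : |‖y - w‖ / ‖y - z‖ - 1| ≤ 2 * η := by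
      have e : ‖y - w‖ / ‖y - z‖ - 1 = (‖y - w‖ - ‖y - z‖) / ‖y - z‖ := by field_simp
      rw [e, abs_div, abs_of_pos hyz, div_le_iff₀ hyz]
      have h3 := abs_norm_sub_norm_le (y - w) (y - z)
      have h4 : ‖(y - w) - (y - z)‖ = ‖w - z‖ := by rw [norm_sub_rev w z]; congr 1; ring
      nlinarith
    have := abs_log_le_of_abs_sub_one_le (by linarith) h2
    linarith
  have hpl : |Real.posLog ‖w‖ - Real.posLog r| ≤ η := by
    have h0 : (0 : ℝ) ≤ η ^ 2 := by positivity
    have h1 : Real.log (1 + η ^ 2) ≤ η := by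
      have := Real.log_le_sub_one_of_pos (x := 1 + η ^ 2) (by positivity)
      nlinarith
    have h2 : Real.posLog ‖w‖ = Real.log (1 + η ^ 2) := by
      rw [hwn]; exact Real.posLog_eq_log (by rw [abs_of_nonneg (by positivity)]; linarith)
    have h3 : Real.posLog r ≤ Real.posLog ‖w‖ := by
      refine Real.posLog_le_posLog (norm_nonneg z) ?_
      rw [hwn]; rw [abs_lt] at h; linarith
    have h4 := Real.posLog_nonneg (x := r)
    rw [abs_le]; constructor <;> linarith
  have hsum : |∑ j ∈ Finset.range q, Real.log ‖circPt (x + j * α) - w‖ -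
      ∑ j ∈ Finset.range q, Real.log ‖circPt (x + j * α) - z‖| ≤ q * (4 * η) := by
    rw [← Finset.sum_sub_distrib]
    refine (Finset.abs_sum_le_sum_abs _ _).trans ((Finset.sum_le_sum hterm).trans ?_)
    simp
  have hplq : |(q : ℝ) * Real.posLog ‖w‖ - q * Real.posLog r| ≤ q * η := by
    rw [← mul_sub, abs_mul, Nat.abs_cast]; gcongr
  rw [abs_le] at hwfar hsum hplq ⊢
  constructor <;> linarith [hwfar.1, hwfar.2, hsum.1, hsum.2, hplq.1, hplq.2]

open Polynomial in
theorem log_norm_eval_eq {P : ℂ[X]} {z : ℂ} (hz : P.eval z ≠ 0) :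
    Real.log ‖P.eval z‖ =
      Real.log ‖P.leadingCoeff‖ + (P.roots.map fun a => Real.log ‖z - a‖).sum := by
  have hP : P ≠ 0 := fun h => hz (by simp [h])
  have h1 : P.eval z = P.leadingCoeff * (P.roots.map fun a => z - a).prod := by
    conv_lhs => rw [(IsAlgClosed.splits P).eq_prod_roots]
    rw [eval_mul, eval_C, eval_multiset_prod, Multiset.map_map]
    simp
  have hne : (P.roots.map fun a => z - a).prod ≠ 0 := fun h => hz (by rw [h1, h, mul_zero])
  rw [h1, norm_mul, Real.log_mul (by simpa using hP) (by simpa using hne)]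
  congr 1
  have hne' : ∀ a ∈ P.roots, z - a ≠ 0 := fun a ha h =>
    hne (Multiset.prod_eq_zero (Multiset.mem_map.2 ⟨a, ha, h⟩))
  clear h1 hne
  revert hne'
  generalize P.roots = s
  intro hne'
  induction s using Multiset.induction_on with
  | empty => simp
  | cons a s ih =>
    have h1 := ih fun b hb => hne' b (Multiset.mem_cons_of_mem hb)
    have h2 := hne' a (Multiset.mem_cons_self a s)
    have h3 : (s.map fun a => z - a).prod ≠ 0 := by
      rw [Ne, Multiset.prod_eq_zero_iff, Multiset.mem_map]
      rintro ⟨b, hb, hb'⟩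
      exact hne' b (Multiset.mem_cons_of_mem hb) hb'
    simp only [Multiset.map_cons, Multiset.prod_cons, Multiset.sum_cons, norm_mul]
    rw [Real.log_mul (by simpa using h2) (by simpa using h3), h1]

theorem abs_sum_multiset_sub_le {ι : Type*} (s : Multiset ι) (J : Finset ℕ) (f : ℕ → ι → ℝ)
    (c : ι → ℝ) {D : ℝ} (h : ∀ a ∈ s, |∑ j ∈ J, f j a - c a| ≤ D) :
    |∑ j ∈ J, (s.map (f j)).sum - (s.map c).sum| ≤ s.card * D := by
  induction s using Multiset.induction_on with
  | empty => simp
  | cons a s ih =>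
    have h1 := ih fun b hb => h b (Multiset.mem_cons_of_mem hb)
    have h2 := h a (Multiset.mem_cons_self a s)
    simp only [Multiset.map_cons, Multiset.sum_cons, Multiset.card_cons, Finset.sum_add_distrib]
    push_cast
    rw [abs_le] at *
    constructor <;> linarith [h1.1, h1.2, h2.1, h2.2]

open Polynomial in
/-- Birkhoff sums of `log |P(e^{it})|` along orbits that stay away from the roots of `P`. -/
theorem abs_sum_log_eval_sub_le {P : ℂ[X]} {d : ℕ} (hd : P.natDegree ≤ d) {α : ℝ} {q : ℕ}
    {p : ℤ} (hq : GoodApprox α q p) {η : ℝ} (hη : 0 < η) (hη1 : η ≤ 1 / 4)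
    (hP : ∀ x, P.eval (circPt x) ≠ 0) (t : ℕ) {x : ℝ}
    (hx : ∀ j < t * q, ∀ a ∈ P.roots, η ≤ ‖circPt (x + j * α) - a‖) :
    |∑ j ∈ Finset.range (t * q), Real.log ‖P.eval (circPt (x + j * α))‖ -
        t * q * P.logMahlerMeasure| ≤ t * (d * (4 * Real.log (3 / η ^ 2) + q * (5 * η))) := by
  have hD0 : 0 ≤ 4 * Real.log (3 / η ^ 2) + q * (5 * η) := by
    have : 0 ≤ Real.log (3 / η ^ 2) := Real.log_nonneg (by
      rw [le_div_iff₀ (by positivity)]; nlinarith)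
    positivity
  have block : ∀ x : ℝ, (∀ j < q, ∀ a ∈ P.roots, η ≤ ‖circPt (x + j * α) - a‖) →
      |∑ j ∈ Finset.range q, Real.log ‖P.eval (circPt (x + j * α))‖ -
        q * P.logMahlerMeasure| ≤ d * (4 * Real.log (3 / η ^ 2) + q * (5 * η)) := by
    intro x hx
    have h1 := abs_sum_multiset_sub_le P.roots (Finset.range q)
      (fun j a => Real.log ‖circPt (x + j * α) - a‖) (fun a => q * Real.posLog ‖a‖)
      (fun a ha => abs_sum_log_sub_le hq a hη hη1 fun j hj => hx j hj a ha)
    simp_rw [log_norm_eval_eq (hP _)]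
    rw [logMahlerMeasure_eq_log_leadingCoeff_add_sum_log_roots, Finset.sum_add_distrib]
    rw [Multiset.sum_map_mul_left] at h1
    have hcard : (P.roots.card : ℝ) ≤ d := by exact_mod_cast (P.card_roots').trans hd
    refine le_trans (le_of_eq ?_) (h1.trans (mul_le_mul_of_nonneg_right hcard hD0))
    congr 1
    simp
    ring
  induction t with
  | zero => simp
  | succ t ih =>
    have h1 := ih fun j hj => hx j (by rw [add_mul]; omega)
    have h2 := block (x + ((t * q : ℕ) : ℝ) * α) fun j hj a ha => by
      have := hx (t * q + j) (by rw [add_mul]; omega) a ha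
      convert! this using 4
      push_cast; ring
    rw [add_mul, one_mul, Finset.sum_range_add]
    have h3 : ∀ j : ℕ, x + ((t * q : ℕ) : ℝ) * α + j * α = x + ((t * q + j : ℕ) : ℝ) * α :=
      fun j => by push_cast; ring
    simp_rw [h3] at h2
    push_cast at h1 h2 ⊢
    rw [abs_le] at *
    constructor <;> linarith [h1.1, h1.2, h2.1, h2.2]

section Boost
open Polynomial

theorem exists_circPt_eq {z : ℂ} (hz : ‖z‖ = 1) : ∃ x, z = circPt x := by
  obtain ⟨θ, hθ⟩ := exists_eq_mul_circPt z
  exact ⟨θ, by rw [hθ, hz]; simp⟩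

theorem norm_coeff_le_of_norm_eval_circPt_le {P : ℂ[X]} {M : ℝ}
    (hM : ∀ x, ‖P.eval (circPt x)‖ ≤ M) (i : ℕ) : ‖P.coeff i‖ ≤ M := by
  have hM0 : 0 ≤ M := (norm_nonneg _).trans (hM 0)
  by_cases hi : i ∈ P.support
  · refine abs_le_of_sq_le_sq' ?_ hM0 |>.2
    calc ‖P.coeff i‖ ^ 2 ≤ ∑ i ∈ P.support, ‖P.coeff i‖ ^ 2 :=
          Finset.single_le_sum (f := fun i => ‖P.coeff i‖ ^ 2) (fun _ _ => by positivity) hi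
      _ = _ := P.sum_sq_norm_coeff_eq_circleAverage
      _ ≤ M ^ 2 := by
        refine Real.circleAverage_mono_on_of_le_circle ?_ fun z hz => ?_
        · exact ContinuousOn.circleIntegrable (by norm_num) (by fun_prop)
        · obtain ⟨x, rfl⟩ := exists_circPt_eq (z := z) (by simpa using hz)
          have := hM x
          gcongr
  · rw [notMem_support_iff.1 hi]; simpa using hM0

theorem norm_eval_le_of_norm_le {P : ℂ[X]} {d : ℕ} (hd : P.natDegree ≤ d) {M : ℝ}
    (hM : ∀ x, ‖P.eval (circPt x)‖ ≤ M) {r : ℝ} (hr : 0 ≤ r) {z : ℂ} (hz : ‖z‖ ≤ 1 + r) :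
    ‖P.eval z‖ ≤ (d + 1) * ((1 + r) ^ d * M) := by
  have hM0 : 0 ≤ M := (norm_nonneg _).trans (hM 0)
  rw [eval_eq_sum_range' (Nat.lt_succ_of_le hd)]
  refine (norm_sum_le _ _).trans ?_
  have : ∀ i ∈ Finset.range (d + 1), ‖P.coeff i * z ^ i‖ ≤ (1 + r) ^ d * M := by
    intro i hi
    rw [norm_mul, norm_pow, mul_comm]
    have h1 : ‖z‖ ^ i ≤ (1 + r) ^ d :=
      (pow_le_pow_left₀ (norm_nonneg _) hz i).trans
        (pow_le_pow_right₀ (by linarith) (by have := Finset.mem_range.1 hi; omega))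
    exact mul_le_mul h1 (norm_coeff_le_of_norm_eval_circPt_le hM i) (norm_nonneg _) (by positivity)
  refine (Finset.sum_le_sum this).trans ?_
  simp

theorem norm_pow_sub_pow_le_mul {z w : ℂ} (hz : ‖z‖ ≤ 1) (hw : ‖w‖ ≤ 1) (i : ℕ) :
    ‖z ^ i - w ^ i‖ ≤ i * ‖z - w‖ := by
  induction i with
  | zero => simp
  | succ i ih =>
    have : z ^ (i + 1) - w ^ (i + 1) = z ^ i * (z - w) + (z ^ i - w ^ i) * w := by ring
    rw [this]
    refine (norm_add_le _ _).trans ?_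
    rw [norm_mul, norm_mul, norm_pow]
    have h1 : ‖z‖ ^ i ≤ 1 := pow_le_one₀ (norm_nonneg _) hz
    have h2 : ‖z ^ i - w ^ i‖ * ‖w‖ ≤ ‖z ^ i - w ^ i‖ := mul_le_of_le_one_right (norm_nonneg _) hw
    have h3 : ‖z‖ ^ i * ‖z - w‖ ≤ ‖z - w‖ := mul_le_of_le_one_left (norm_nonneg _) h1
    push_cast
    linarith

theorem norm_eval_sub_le {P : ℂ[X]} {d : ℕ} (hd : P.natDegree ≤ d) {M : ℝ}
    (hM : ∀ x, ‖P.eval (circPt x)‖ ≤ M) (x y : ℝ) :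
    ‖P.eval (circPt x) - P.eval (circPt y)‖ ≤ (d + 1) ^ 2 * |x - y| * M := by
  have hM0 : 0 ≤ M := (norm_nonneg _).trans (hM 0)
  rw [eval_eq_sum_range' (Nat.lt_succ_of_le hd), eval_eq_sum_range' (Nat.lt_succ_of_le hd),
    ← Finset.sum_sub_distrib]
  refine (norm_sum_le _ _).trans ?_
  have : ∀ i ∈ Finset.range (d + 1),
      ‖P.coeff i * circPt x ^ i - P.coeff i * circPt y ^ i‖ ≤ M * ((d + 1) * |x - y|) := by
    intro i hi
    rw [← mul_sub, norm_mul]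
    refine mul_le_mul (norm_coeff_le_of_norm_eval_circPt_le hM i) ?_ (norm_nonneg _) hM0
    refine (norm_pow_sub_pow_le_mul (norm_circPt x).le (norm_circPt y).le i).trans ?_
    have h1 : (i : ℝ) ≤ d + 1 := by exact_mod_cast (Finset.mem_range.1 hi).le
    exact mul_le_mul h1 (norm_circPt_sub_le x y) (norm_nonneg _) (by positivity)
  refine (Finset.sum_le_sum this).trans (le_of_eq ?_)
  simp; ring

theorem continuous_norm_eval_circPt (P : ℂ[X]) : Continuous fun x => ‖P.eval (circPt x)‖ :=
  (P.continuous.comp continuous_circPt).norm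

theorem log_norm_eval_le_of_small_measure {P : ℂ[X]} {d : ℕ} (hd : P.natDegree ≤ d)
    (hP : ∀ x, P.eval (circPt x) ≠ 0) {K : ℝ}
    (hsmall : circleMeasure.real {x | K < Real.log ‖P.eval (circPt x)‖} <
      1 / (6 * (d + 1 : ℝ) ^ 2)) (x : ℝ) :
    Real.log ‖P.eval (circPt x)‖ ≤ K + Real.log 2 := by
  have hlogc : Continuous fun x => Real.log ‖P.eval (circPt x)‖ :=
    (continuous_norm_eval_circPt P).log fun x => by simpa using hP x
  obtain ⟨z₀, hz₀, hmax⟩ := (isCompact_sphere (0 : ℂ) 1).exists_isMaxOn (by simp)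
    (P.continuous.norm.continuousOn)
  obtain ⟨x₀, rfl⟩ := exists_circPt_eq (z := z₀) (by simpa using hz₀)
  set M := ‖P.eval (circPt x₀)‖ with hMdef
  have hM : ∀ x, ‖P.eval (circPt x)‖ ≤ M := fun x => hmax (by simp [norm_circPt])
  have hM0 : 0 < M := by simpa [M] using hP x₀
  have hd1 : (1 : ℝ) ≤ (d + 1 : ℝ) ^ 2 := one_le_pow₀ (by linarith [Nat.cast_nonneg (α := ℝ) d])
  obtain ⟨y, hy, hyB⟩ := exists_notMem_of_circleMeasure_lt
    (isOpen_lt continuous_const hlogc).measurableSet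
    (fun x => by simp only [Set.mem_ofPred_eq, circPt_add_two_pi])
    (by
      rw [div_le_iff₀ (by positivity)]
      nlinarith [Real.pi_gt_three]) hsmall x₀
  rw [Set.mem_ofPred_eq, not_lt] at hyB
  have h1 := norm_eval_sub_le hd hM x₀ y
  rw [abs_sub_comm] at h1
  have h2 : ((d : ℝ) + 1) ^ 2 * |y - x₀| * M ≤ 1 / 6 * M := by
    gcongr
    calc ((d : ℝ) + 1) ^ 2 * |y - x₀| ≤ ((d : ℝ) + 1) ^ 2 * (1 / (6 * (d + 1 : ℝ) ^ 2)) := by gcongr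
      _ = 1 / 6 := by field_simp
  have h3 : M ≤ 2 * ‖P.eval (circPt y)‖ := by
    have := norm_sub_norm_le (P.eval (circPt x₀)) (P.eval (circPt y))
    linarith
  have hy0 : 0 < ‖P.eval (circPt y)‖ := by simpa using hP y
  calc Real.log ‖P.eval (circPt x)‖ ≤ Real.log (2 * ‖P.eval (circPt y)‖) :=
        Real.log_le_log (by simpa using hP x) ((hM x).trans h3)
    _ = Real.log 2 + Real.log ‖P.eval (circPt y)‖ := Real.log_mul (by norm_num) hy0.ne'
    _ ≤ _ := by linarith

theorem log_norm_sub_ge {w a : ℂ} {η : ℝ} (hη1 : η ≤ 1) (hη : 0 < η) (hwa : η ≤ ‖w - a‖)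
    (ha : a ≠ 0) (hw : ‖w‖ ≤ 1 / 6) :
    -(Real.log (1 / η) * (Real.posLog ‖a‖ - Real.log ‖a‖)) - 6 * ‖w‖ ≤
      Real.log ‖w - a‖ - Real.log ‖a‖ := by
  have hLη : 0 ≤ Real.log (1 / η) := Real.log_nonneg (by rw [le_div_iff₀ hη]; linarith)
  have ha0 : 0 < ‖a‖ := by simpa using ha
  have hpl : Real.log ‖a‖ ≤ Real.posLog ‖a‖ := by rw [Real.posLog_def]; exact le_max_right _ _
  rcases le_or_gt (Real.log ‖a‖) (-1) with h | h
  · have h1 : Real.log η ≤ Real.log ‖w - a‖ := Real.log_le_log hη hwa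
    have h2 := Real.posLog_nonneg (x := ‖a‖)
    have h3 : Real.log (1 / η) = -Real.log η := by rw [one_div, Real.log_inv]
    have h4 : Real.log (1 / η) * 1 ≤ Real.log (1 / η) * (Real.posLog ‖a‖ - Real.log ‖a‖) := by
      gcongr; linarith
    nlinarith [norm_nonneg w]
  · have h1 : 1 / 3 < ‖a‖ := by
      have h2 : Real.exp (-1) < ‖a‖ := (Real.lt_log_iff_exp_lt ha0).1 h
      have h3 : (1 : ℝ) / 3 ≤ Real.exp (-1) := by
        rw [Real.exp_neg, one_div]
        exact inv_anti₀ (Real.exp_pos 1) (Real.exp_one_lt_d9.le.trans (by norm_num))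
      linarith
    have h2 : ‖a‖ - ‖w‖ ≤ ‖w - a‖ := by rw [norm_sub_rev]; exact norm_sub_norm_le _ _
    have hpos : 0 < ‖w - a‖ := by linarith
    rw [← Real.log_div hpos.ne' ha0.ne']
    have h3 : 1 - 3 * ‖w‖ ≤ ‖w - a‖ / ‖a‖ := by
      rw [le_div_iff₀ ha0]
      nlinarith [norm_nonneg w]
    have h4 := Real.one_sub_inv_le_log_of_pos (div_pos hpos ha0)
    have h5 : (‖w - a‖ / ‖a‖)⁻¹ ≤ 1 + 6 * ‖w‖ := by
      rw [inv_le_iff_one_le_mul₀ (div_pos hpos ha0)]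
      nlinarith [norm_nonneg w]
    have h6 : 0 ≤ Real.log (1 / η) * (Real.posLog ‖a‖ - Real.log ‖a‖) :=
      mul_nonneg hLη (by linarith)
    linarith

theorem sum_map_ge (s : Multiset ℂ) (f g h : ℂ → ℝ) (L c : ℝ)
    (H : ∀ a ∈ s, -(L * (g a - h a)) - c ≤ f a - h a) :
    -(L * ((s.map g).sum - (s.map h).sum)) - s.card * c ≤ (s.map f).sum - (s.map h).sum := by
  induction s using Multiset.induction_on with
  | empty => simp
  | cons a s ih =>
    have h1 := ih fun b hb => H b (Multiset.mem_cons_of_mem hb)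
    have h2 := H a (Multiset.mem_cons_self a s)
    simp only [Multiset.map_cons, Multiset.sum_cons, Multiset.card_cons]
    push_cast
    linarith

/-- A lower bound for `log |P|` away from the roots of `P`, given an upper bound on the circle and
a lower bound at one nearby point. -/
theorem log_norm_eval_ge {P : ℂ[X]} {d : ℕ} (hd : P.natDegree ≤ d)
    (hP : ∀ x, 1 ≤ ‖P.eval (circPt x)‖) {K : ℝ} (hK : ∀ x, Real.log ‖P.eval (circPt x)‖ ≤ K)
    {x y : ℝ} (hxy : |y - x| ≤ 1 / (6 * (d + 1 : ℝ) ^ 2)) {η : ℝ} (hη : 0 < η) (hη1 : η ≤ 1)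
    (hx : ∀ a ∈ P.roots, η ≤ ‖circPt x - a‖) :
    Real.log ‖P.eval (circPt y)‖ -
      Real.log (1 / η) * (K + Real.log (d + 1) + 1 - Real.log ‖P.eval (circPt y)‖) - 1 ≤
      Real.log ‖P.eval (circPt x)‖ := by
  have hne : ∀ x, P.eval (circPt x) ≠ 0 := fun x h => by
    have := hP x; rw [h] at this; norm_num at this
  have hP0 : P ≠ 0 := fun h => hne 0 (by simp [h])
  have hLη : 0 ≤ Real.log (1 / η) := Real.log_nonneg (by rw [le_div_iff₀ hη]; linarith)
  have hd0 : (0 : ℝ) < d + 1 := by positivity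
  set r : ℝ := 1 / (d + 1) with hr
  have hr0 : 0 < r := by positivity
  have hr1 : r ≤ 1 := by rw [hr, div_le_iff₀ hd0]; linarith [Nat.cast_nonneg (α := ℝ) d]
  set c := circPt y with hc
  set Q : ℂ[X] := P.comp (C c + C (r : ℂ) * X) with hQ
  have hQe : ∀ w, Q.eval w = P.eval (c + r * w) := fun w => by simp [hQ, eval_comp]
  have hQd : Q.natDegree ≤ d := by
    refine (natDegree_comp_le).trans ?_
    have : (C c + C (r : ℂ) * X : ℂ[X]).natDegree ≤ 1 := by
      rw [add_comm]; exact natDegree_linear_le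
    calc _ ≤ P.natDegree * 1 := Nat.mul_le_mul_left _ this
      _ ≤ d := by omega
  have hQ0 : Q.eval 0 ≠ 0 := by rw [hQe]; simpa using hne y
  have hQ0' : Q ≠ 0 := fun h => hQ0 (by simp [h])
  set w : ℂ := (circPt x - c) / r with hw
  have hcw : c + r * w = circPt x := by
    rw [hw, mul_div_cancel₀ _ (by exact_mod_cast hr0.ne')]; ring
  have hwn : ‖w‖ ≤ 1 / (6 * (d + 1)) := by
    rw [hw, norm_div, Complex.norm_of_nonneg hr0.le, div_le_iff₀ hr0]
    refine (norm_circPt_sub_le x y).trans ?_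
    rw [abs_sub_comm]
    refine hxy.trans (le_of_eq ?_)
    rw [hr]; field_simp
  have hw6 : ‖w‖ ≤ 1 / 6 := hwn.trans (by
    refine one_div_le_one_div_of_le (by norm_num) ?_
    linarith [Nat.cast_nonneg (α := ℝ) d])
  have hroot : ∀ a ∈ Q.roots, P.eval (c + r * a) = 0 := fun a ha => by
    rw [← hQe]; exact (mem_roots hQ0').1 ha
  have hterm : ∀ a ∈ Q.roots, -(Real.log (1 / η) * (Real.posLog ‖a‖ - Real.log ‖a‖)) - 6 * ‖w‖ ≤
      Real.log ‖w - a‖ - Real.log ‖a‖ := by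
    intro a ha
    refine log_norm_sub_ge hη1 hη ?_ ?_ hw6
    · have h1 := hx (c + r * a) ((mem_roots hP0).2 (hroot a ha))
      have h2 : circPt x - (c + r * a) = r * (w - a) := by rw [← hcw]; ring
      rw [h2, norm_mul, Complex.norm_of_nonneg hr0.le] at h1
      nlinarith [norm_nonneg (w - a)]
    · rintro rfl
      exact hQ0 ((mem_roots hQ0').1 ha)
  have hsum := sum_map_ge Q.roots (fun a => Real.log ‖w - a‖) (fun a => Real.posLog ‖a‖)
    (fun a => Real.log ‖a‖) _ _ hterm
  have e1 := log_norm_eval_eq (P := Q) (z := w) (by rw [hQe, hcw]; exact hne x)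
  have e2 := log_norm_eval_eq (P := Q) (z := 0) hQ0
  have e3 := logMahlerMeasure_eq_log_leadingCoeff_add_sum_log_roots Q
  simp only [zero_sub, norm_neg] at e2
  rw [hQe, hcw] at e1
  rw [hQe, mul_zero, add_zero] at e2
  have hcard : (Q.roots.card : ℝ) * (6 * ‖w‖) ≤ 1 := by
    have h1 : (Q.roots.card : ℝ) ≤ d + 1 := by
      have : Q.roots.card ≤ d := (Q.card_roots').trans hQd
      have : (Q.roots.card : ℝ) ≤ d := by exact_mod_cast this
      linarith
    calc (Q.roots.card : ℝ) * (6 * ‖w‖) ≤ (d + 1) * (6 * (1 / (6 * (d + 1)))) := by gcongr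
      _ = 1 := by field_simp
  have hMahler : Q.logMahlerMeasure ≤ K + Real.log (d + 1) + 1 := by
    rw [logMahlerMeasure_def]
    refine Real.circleAverage_mono_on_of_le_circle ?_ fun z hz => ?_
    · exact MeromorphicOn.circleIntegrable_log_norm fun z _ =>
        (analyticOnNhd_id.aeval_polynomial Q z (Set.mem_univ z)).meromorphicAt
    · have hz1 : ‖z‖ = 1 := by simpa using hz
      have hM : ∀ x, ‖P.eval (circPt x)‖ ≤ Real.exp K := fun x => by
        rw [← Real.log_le_iff_le_exp (by linarith [hP x])]; exact hK x
      have hK0 : 0 ≤ K := (Real.log_nonneg (hP 0)).trans (hK 0)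
      have h1 : ‖Q.eval z‖ ≤ (d + 1) * ((1 + r) ^ d * Real.exp K) := by
        rw [hQe]
        refine norm_eval_le_of_norm_le hd hM hr0.le ?_
        refine (norm_add_le _ _).trans ?_
        rw [norm_mul, hz1, Complex.norm_of_nonneg hr0.le, hc, norm_circPt, mul_one]
      have h2 : (1 + r) ^ d ≤ Real.exp 1 := by
        have h3 : (1 + r) ≤ Real.exp r := by linarith [Real.add_one_le_exp r]
        calc (1 + r) ^ d ≤ Real.exp r ^ d := by gcongr
          _ = Real.exp (d * r) := by rw [← Real.exp_nat_mul]
          _ ≤ Real.exp 1 := by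
            refine Real.exp_le_exp.2 ?_
            rw [hr, mul_one_div, div_le_iff₀ hd0]; linarith
      rcases eq_or_ne (Q.eval z) 0 with h0 | h0
      · rw [h0, norm_zero, Real.log_zero]
        have : 0 ≤ Real.log (d + 1) := Real.log_nonneg (by linarith [Nat.cast_nonneg (α := ℝ) d])
        linarith
      · calc Real.log ‖Q.eval z‖ ≤ Real.log ((d + 1) * (Real.exp 1 * Real.exp K)) := by
              refine Real.log_le_log (by simpa using h0) (h1.trans ?_)
              gcongr
          _ = _ := by
            rw [Real.log_mul hd0.ne' (by positivity), Real.log_mul (by positivity) (by positivity),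
              Real.log_exp, Real.log_exp]
            ring
  have hfin : Real.log (1 / η) * ((Q.roots.map fun a => Real.posLog ‖a‖).sum -
      (Q.roots.map fun a => Real.log ‖a‖).sum) ≤
      Real.log (1 / η) * (K + Real.log (d + 1) + 1 - Real.log ‖P.eval c‖) :=
    mul_le_mul_of_nonneg_left (by linarith) hLη
  linarith

/-- Self-improvement of a deviation estimate for `log |P|` on the circle. -/
theorem log_norm_eval_boost {P : ℂ[X]} {d : ℕ} (hd : P.natDegree ≤ d)
    (hP : ∀ x, 1 ≤ ‖P.eval (circPt x)‖) {K ε : ℝ}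
    (hsmall : circleMeasure.real {x | ε < |Real.log ‖P.eval (circPt x)‖ - K|} <
      1 / (6 * (d + 1 : ℝ) ^ 2)) :
    (∀ x, Real.log ‖P.eval (circPt x)‖ ≤ K + ε + 1) ∧
    ∀ η, 0 < η → η ≤ 1 → ∀ x, (∀ a ∈ P.roots, η ≤ ‖circPt x - a‖) →
      K - ε - 1 - Real.log (1 / η) * (2 * ε + Real.log (d + 1) + 2) ≤
        Real.log ‖P.eval (circPt x)‖ := by
  have hne : ∀ x, P.eval (circPt x) ≠ 0 := fun x h => by
    have := hP x; rw [h] at this; norm_num at this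
  have hup : ∀ x, Real.log ‖P.eval (circPt x)‖ ≤ K + ε + 1 := by
    intro x
    have h1 := log_norm_eval_le_of_small_measure hd hne (K := K + ε)
      (lt_of_le_of_lt (measureReal_mono fun y hy => by
        rw [Set.mem_ofPred_eq] at hy ⊢
        exact lt_of_lt_of_le (by linarith) (le_abs_self _)) hsmall) x
    linarith [Real.log_two_lt_d9]
  refine ⟨hup, fun η hη hη1 x hx => ?_⟩
  have hlogc : Continuous fun x => Real.log ‖P.eval (circPt x)‖ :=
    (continuous_norm_eval_circPt P).log fun x => by simpa using hne x
  have hd1 : (1 : ℝ) ≤ (d + 1 : ℝ) ^ 2 := one_le_pow₀ (by linarith [Nat.cast_nonneg (α := ℝ) d])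
  have hdev : Continuous fun x => |Real.log ‖P.eval (circPt x)‖ - K| :=
    (hlogc.sub continuous_const).abs
  obtain ⟨y, hy, hyB⟩ := exists_notMem_of_circleMeasure_lt
    (isOpen_lt continuous_const hdev).measurableSet
    (fun x => by simp only [Set.mem_ofPred_eq, circPt_add_two_pi])
    (by
      rw [div_le_iff₀ (by positivity)]
      nlinarith [Real.pi_gt_three]) hsmall x
  rw [Set.mem_ofPred_eq, not_lt, abs_le] at hyB
  have h1 : ∀ x, Real.log ‖P.eval (circPt x)‖ ≤ K + ε + Real.log 2 := by
    intro x
    exact log_norm_eval_le_of_small_measure hd hne (K := K + ε)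
      (lt_of_le_of_lt (measureReal_mono fun y hy => by
        rw [Set.mem_ofPred_eq] at hy ⊢
        exact lt_of_lt_of_le (by linarith) (le_abs_self _)) hsmall) x
  have h2 := log_norm_eval_ge hd hP h1 hy hη hη1 hx
  have hLη : 0 ≤ Real.log (1 / η) := Real.log_nonneg (by rw [le_div_iff₀ hη]; linarith)
  have h3 : Real.log (1 / η) * (K + ε + Real.log 2 + Real.log (d + 1) + 1 -
      Real.log ‖P.eval (circPt y)‖) ≤ Real.log (1 / η) * (2 * ε + Real.log (d + 1) + 2) :=
    mul_le_mul_of_nonneg_left (by linarith [Real.log_two_lt_d9]) hLη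
  linarith

end Boost

section TrigPoly
open Polynomial

/-- `f` is a real trigonometric polynomial of degree at most `d`. -/
def IsTrigPoly (d : ℕ) (f : ℝ → ℝ) : Prop :=
  ∃ P : ℂ[X], P.natDegree ≤ 2 * d ∧ ∀ x, (f x : ℂ) * circPt x ^ d = P.eval (circPt x)

namespace IsTrigPoly
variable {d e : ℕ} {f g : ℝ → ℝ}

theorem mono (hf : IsTrigPoly d f) (h : d ≤ e) : IsTrigPoly e f := by
  obtain ⟨P, hP, hPe⟩ := hf
  refine ⟨P * X ^ (e - d), ?_, fun x => ?_⟩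
  · refine (natDegree_mul_le).trans ?_
    rw [natDegree_X_pow]; omega
  · rw [eval_mul, ← hPe, eval_pow, eval_X, mul_assoc, ← pow_add]; congr 2; omega

theorem const (c : ℝ) : IsTrigPoly d fun _ => c :=
  mono (d := 0) ⟨C (c : ℂ), by simp, fun x => by simp⟩ (Nat.zero_le _)

theorem add (hf : IsTrigPoly d f) (hg : IsTrigPoly d g) : IsTrigPoly d fun x => f x + g x := by
  obtain ⟨P, hP, hPe⟩ := hf
  obtain ⟨Q, hQ, hQe⟩ := hg
  refine ⟨P + Q, (natDegree_add_le _ _).trans (max_le hP hQ), fun x => ?_⟩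
  rw [eval_add, ← hPe, ← hQe]; push_cast; ring

theorem mul (hf : IsTrigPoly d f) (hg : IsTrigPoly e g) :
    IsTrigPoly (d + e) fun x => f x * g x := by
  obtain ⟨P, hP, hPe⟩ := hf
  obtain ⟨Q, hQ, hQe⟩ := hg
  refine ⟨P * Q, (natDegree_mul_le).trans (by omega), fun x => ?_⟩
  rw [eval_mul, ← hPe, ← hQe]; push_cast; ring

theorem const_mul (c : ℝ) (hf : IsTrigPoly d f) : IsTrigPoly d fun x => c * f x := by
  have := (const (d := 0) c).mul hf
  rwa [zero_add] at this

theorem sub (hf : IsTrigPoly d f) (hg : IsTrigPoly d g) : IsTrigPoly d fun x => f x - g x := by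
  have := hf.add (hg.const_mul (-1))
  simpa [sub_eq_add_neg] using this

theorem sum {ι : Type*} (s : Finset ι) {F : ι → ℝ → ℝ} (h : ∀ i ∈ s, IsTrigPoly d (F i)) :
    IsTrigPoly d fun x => ∑ i ∈ s, F i x := by
  classical
  induction s using Finset.induction_on with
  | empty => simpa using const (d := d) 0
  | insert a s ha ih =>
    have := (h a (Finset.mem_insert_self a s)).add
      (ih fun i hi => h i (Finset.mem_insert_of_mem hi))
    simpa [Finset.sum_insert ha] using this

theorem comp_add (hf : IsTrigPoly d f) (c : ℝ) : IsTrigPoly d fun x => f (x + c) := by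
  obtain ⟨P, hP, hPe⟩ := hf
  have hc : circPt c ≠ 0 := fun h => by have := norm_circPt c; rw [h] at this; simp at this
  refine ⟨C ((circPt c ^ d)⁻¹) * P.comp (C (circPt c) * X), ?_, fun x => ?_⟩
  · refine (natDegree_C_mul_le _ _).trans ((natDegree_comp_le).trans ?_)
    calc _ ≤ P.natDegree * 1 :=
          Nat.mul_le_mul_left _ ((natDegree_C_mul_le _ _).trans natDegree_X_le)
      _ ≤ _ := by omega
  · rw [eval_mul, eval_C, eval_comp, eval_mul, eval_C, eval_X, mul_comm (circPt c), ← circPt_add,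
      ← hPe, circPt_add, mul_pow]
    field_simp

theorem re_mul_circPt_pow (c : ℂ) (k : ℕ) : IsTrigPoly k fun x => (c * circPt x ^ k).re := by
  refine ⟨C (c / 2) * X ^ (2 * k) + C ((starRingEnd ℂ) c / 2), ?_, fun x => ?_⟩
  · refine (natDegree_add_le _ _).trans (max_le ?_ (by simp))
    exact (natDegree_C_mul_X_pow_le _ _)
  · have h1 : (starRingEnd ℂ) (circPt x) * circPt x = 1 := by
      rw [mul_comm, Complex.mul_conj, Complex.normSq_eq_norm_sq, norm_circPt]; simp
    have h2 : (starRingEnd ℂ) (circPt x) ^ k * circPt x ^ k = 1 := by rw [← mul_pow, h1, one_pow]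
    have h3 : (((c * circPt x ^ k).re : ℝ) : ℂ) =
        (c * circPt x ^ k + (starRingEnd ℂ) c * (starRingEnd ℂ) (circPt x) ^ k) / 2 := by
      rw [Complex.re_eq_add_conj, map_mul, map_pow]
    simp only [eval_add, eval_mul, eval_C, eval_pow, eval_X]
    rw [h3]
    linear_combination (starRingEnd ℂ) c / 2 * h2

end IsTrigPoly

theorem isTrigPoly_transferMatrix {D : ℕ} {w : ℝ → ℝ} (hw : IsTrigPoly D w) (ω l E : ℝ) (n : ℕ)
    (i j : Fin 2) : IsTrigPoly (n * D) fun x => transferMatrix w ω l E n x i j := by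
  induction n generalizing i j with
  | zero => simpa [transferMatrix] using IsTrigPoly.const _
  | succ n ih =>
    have h1 : IsTrigPoly D fun x => l * w (x + ((n + 1 : ℕ) : ℝ) * ω) - E :=
      ((hw.comp_add _).const_mul l).sub (IsTrigPoly.const E)
    have e : D + n * D = (n + 1) * D := by ring
    fin_cases i
    · have h2 := (h1.mul (ih 0 j)).sub ((ih 1 j).mono (show n * D ≤ D + n * D by omega))
      rw [e] at h2
      convert! h2 using 2 with x
      simp [transferMatrix, stepMatrix, Matrix.mul_apply, Fin.sum_univ_two]
      ring
    · have h2 := (ih 0 j).mono (show n * D ≤ D + n * D by omega)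
      rw [e] at h2
      convert! h2 using 2 with x
      simp [transferMatrix, stepMatrix, Matrix.mul_apply, Fin.sum_univ_two]

theorem exists_polynomial_hs_sq {D : ℕ} {w : ℝ → ℝ} (hw : IsTrigPoly D w) (ω l E : ℝ) (n : ℕ) :
    ∃ P : ℂ[X], P.natDegree ≤ 4 * (n * D) ∧
      ∀ x, ‖P.eval (circPt x)‖ = hs (transferMatrix w ω l E n x) ^ 2 := by
  have h := isTrigPoly_transferMatrix hw ω l E n
  have hsq : ∀ i j, IsTrigPoly (n * D + n * D) fun x => transferMatrix w ω l E n x i j ^ 2 := by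
    intro i j
    have := (h i j).mul (h i j)
    simpa [pow_two] using this
  obtain ⟨P, hP, hPe⟩ := (((hsq 0 0).add (hsq 0 1)).add (hsq 1 0)).add (hsq 1 1)
  refine ⟨P, by omega, fun x => ?_⟩
  rw [← hPe, norm_mul, norm_pow, norm_circPt, one_pow, mul_one, hs_sq, Complex.norm_real,
    Real.norm_eq_abs, abs_of_nonneg (by positivity)]

end TrigPoly

section Fourier

theorem norm_fourierCoeffOn_le {f : ℝ → ℂ} {C : ℝ} (hC : ∀ x, ‖f x‖ ≤ C) (k : ℤ) :
    ‖fourierCoeffOn Real.two_pi_pos f k‖ ≤ C := by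
  rw [fourierCoeffOn_eq_integral, norm_smul]
  have h : ‖∫ x in (0 : ℝ)..(2 * Real.pi),
      fourier (-k) (x : AddCircle (2 * Real.pi - 0)) • f x‖ ≤ C * |2 * Real.pi - 0| := by
    refine intervalIntegral.norm_integral_le_of_norm_le_const fun x _ => ?_
    rw [norm_smul]
    have : ‖fourier (-k) (x : AddCircle (2 * Real.pi - 0))‖ = 1 := by
      rw [fourier_apply]; exact Circle.norm_coe _
    rw [this, one_mul]; exact hC x
  have hpi := Real.two_pi_pos
  rw [sub_zero, abs_of_pos hpi] at h
  rw [sub_zero, Real.norm_of_nonneg (by positivity)]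
  calc 1 / (2 * Real.pi) * _ ≤ 1 / (2 * Real.pi) * (C * (2 * Real.pi)) := by
        gcongr
    _ = C := by field_simp

theorem norm_fourierCoeffOn_eq_of_hasDerivAt {f f' : ℝ → ℂ} (hf : ∀ x, HasDerivAt f (f' x) x)
    (hf' : Continuous f') (hper : f (2 * Real.pi) = f 0) {k : ℤ} (hk : k ≠ 0) :
    ‖fourierCoeffOn Real.two_pi_pos f k‖ = ‖fourierCoeffOn Real.two_pi_pos f' k‖ / |(k : ℝ)| := by
  rw [fourierCoeffOn_of_hasDerivAt Real.two_pi_pos hk (fun x _ => hf x)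
    (hf'.intervalIntegrable _ _), hper, sub_self, mul_zero, zero_sub]
  have hpi := Real.pi_pos
  have hk' : (0 : ℝ) < |(k : ℝ)| := abs_pos.2 (by exact_mod_cast hk)
  simp only [norm_mul, norm_neg, norm_div, norm_one, Complex.norm_real, Complex.norm_I,
    Complex.norm_intCast, Complex.ofReal_zero, sub_zero, Complex.norm_ofNat,
    Real.norm_of_nonneg hpi.le]
  rw [show ‖(2 : ℝ)‖ = 2 by simp]
  field_simp

theorem norm_fourierCoeffOn_iteratedDeriv_le {v : ℝ → ℝ} (hper : Function.Periodic v (2 * Real.pi))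
    (hv : ContDiff ℝ ((⊤ : ℕ∞) : WithTop ℕ∞) v) {k : ℤ} (hk : k ≠ 0) (m : ℕ) :
    ‖fourierCoeffOn Real.two_pi_pos (fun x => (v x : ℂ)) k‖ =
      ‖fourierCoeffOn Real.two_pi_pos (fun x => ((iteratedDeriv m v x : ℝ) : ℂ)) k‖ /
        |(k : ℝ)| ^ m := by
  induction m with
  | zero => simp
  | succ m ih =>
    have hcd : ContDiff ℝ ((⊤ : ℕ∞) : WithTop ℕ∞) (iteratedDeriv m v) := by
      refine hv.iterate_deriv m |> fun h => ?_
      rwa [← iteratedDeriv_eq_iterate] at h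
    have hd : ∀ x, HasDerivAt (iteratedDeriv m v) (iteratedDeriv (m + 1) v x) x := fun x => by
      rw [iteratedDeriv_succ]
      exact (hcd.differentiable (by simp)).differentiableAt.hasDerivAt
    have hc : Continuous (iteratedDeriv (m + 1) v) := hv.continuous_iteratedDeriv _ (by
      exact_mod_cast le_top)
    have hp : ∀ m, Function.Periodic (iteratedDeriv m v) (2 * Real.pi) := fun m x => by
      have h1 := iteratedDeriv_comp_add_const m v (2 * Real.pi)
      have h2 : (fun z => v (z + 2 * Real.pi)) = v := funext hper
      rw [h2] at h1
      exact (congrFun h1 x).symm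
    rw [ih, norm_fourierCoeffOn_eq_of_hasDerivAt (fun x => (hd x).ofReal_comp)
      (Complex.continuous_ofReal.comp hc) (by
        have := hp m 0; rw [zero_add] at this; rw [this]) hk, div_div, ← pow_succ']

theorem exists_trigPoly_approx {v : ℝ → ℝ} (hper : Function.Periodic v (2 * Real.pi))
    (hv : ContDiff ℝ ((⊤ : ℕ∞) : WithTop ℕ∞) v) {m : ℕ} (hm : 2 ≤ m) {C : ℝ}
    (hC : ∀ x, |iteratedDeriv m v x| ≤ C) {D : ℕ} (hD : 0 < D) :
    ∃ w, IsTrigPoly D w ∧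
      ∀ x, |v x - w x| ≤ C / (D : ℝ) ^ (m - 2) * ∑' k : ℤ, 1 / (k : ℝ) ^ 2 := by
  have : Fact (0 < 2 * Real.pi) := ⟨Real.two_pi_pos⟩
  have hC0 : 0 ≤ C := (abs_nonneg _).trans (hC 0)
  let vc : ℝ → ℂ := fun x => (v x : ℂ)
  have hvc : Function.Periodic vc (2 * Real.pi) := fun x => by simp only [vc, hper x]
  let F : C(AddCircle (2 * Real.pi), ℂ) := ⟨hvc.lift, continuous_coinduced_dom.mpr
    (Complex.continuous_ofReal.comp hv.continuous)⟩
  have hFv : ∀ x : ℝ, F (x : AddCircle (2 * Real.pi)) = (v x : ℂ) := fun x => rfl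
  let c : ℤ → ℂ := fun k => fourierCoeff F k
  have hc : ∀ k, c k = fourierCoeffOn Real.two_pi_pos vc k := by
    intro k
    simp only [c]
    rw [fourierCoeff_eq_intervalIntegral _ _ 0, fourierCoeffOn_eq_integral, zero_add, sub_zero]
    congr 1
  have hcb : ∀ k : ℤ, k ≠ 0 → ‖c k‖ ≤ C / |(k : ℝ)| ^ m := by
    intro k hk
    rw [hc, norm_fourierCoeffOn_iteratedDeriv_le hper hv hk m]
    gcongr
    refine norm_fourierCoeffOn_le (fun x => ?_) k
    rw [Complex.norm_real]; exact hC x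
  have hZ : Summable fun k : ℤ => 1 / (k : ℝ) ^ 2 :=
    Real.summable_one_div_int_pow.mpr one_lt_two
  have hk1 : ∀ k : ℤ, k ≠ 0 → (1 : ℝ) ≤ |(k : ℝ)| := fun k hk => by
    exact_mod_cast Int.one_le_abs hk
  have hsummn : Summable fun k => ‖c k‖ := by
    have h1 : Summable fun k : ℤ => C * (1 / (k : ℝ) ^ 2) + if k = 0 then ‖c 0‖ else 0 :=
      (hZ.mul_left C).add (summable_of_hasFiniteSupport ((Set.finite_singleton 0).subset (by
        intro k hk; by_contra h; simp_all)))
    refine Summable.of_nonneg_of_le (fun _ => norm_nonneg _) (fun k => ?_) h1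
    by_cases hk : k = 0
    · simp [hk]
    · rw [if_neg hk, add_zero]
      refine (hcb k hk).trans ?_
      rw [div_eq_mul_one_div, ← sq_abs]
      gcongr
      exact hk1 k hk
  have hsum : Summable c := hsummn.of_norm
  have hpt := fun x : ℝ => has_pointwise_sum_fourier_series_of_summable hsum
    (x : AddCircle (2 * Real.pi))
  have hf : ∀ (k : ℤ) (x : ℝ), fourier k (x : AddCircle (2 * Real.pi)) = circPt x ^ k := by
    intro k x
    rw [fourier_coe_apply, circPt, ← Complex.exp_int_mul]
    congr 1
    have : (Real.pi : ℂ) ≠ 0 := by exact_mod_cast Real.pi_ne_zero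
    push_cast; field_simp
  let s : Finset ℤ := Finset.Icc (-(D : ℤ)) D
  refine ⟨fun x => ∑ k ∈ s, (c k * circPt x ^ k).re, ?_, fun x => ?_⟩
  · refine IsTrigPoly.sum s fun k hk => ?_
    have hk' : k.natAbs ≤ D := by
      have := Finset.mem_Icc.1 hk; omega
    rcases Int.natAbs_eq k with h | h
    · refine IsTrigPoly.mono (d := k.natAbs) ?_ hk'
      have h2 := IsTrigPoly.re_mul_circPt_pow (c k) k.natAbs
      convert! h2 using 4 with x
      conv_lhs => rw [h]
      rw [zpow_natCast]
    · refine IsTrigPoly.mono (d := k.natAbs) ?_ hk'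
      have h2 := IsTrigPoly.re_mul_circPt_pow ((starRingEnd ℂ) (c k)) k.natAbs
      convert! h2 using 2 with x
      have h1 : circPt x ^ k = (starRingEnd ℂ) (circPt x ^ k.natAbs) := by
        conv_lhs => rw [h]
        rw [zpow_neg, zpow_natCast, ← inv_pow, map_pow]
        congr 1
        rw [Complex.inv_def, Complex.normSq_eq_norm_sq, norm_circPt]; simp
      rw [h1, ← Complex.conj_re, map_mul, Complex.conj_conj]
  · have h1 := hpt x
    simp only [hFv] at h1
    have h2 : (v x : ℂ) - ∑ k ∈ s, c k * circPt x ^ k =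
        ∑' k : ((s : Set ℤ)ᶜ : Set ℤ), c k * circPt x ^ (k : ℤ) := by
      have h3 := h1.summable.sum_add_tsum_compl (s := s)
      rw [h1.tsum_eq] at h3
      rw [← h3]
      simp only [smul_eq_mul]
      simp only [hf, c]
      ring
    have h3 : |v x - ∑ k ∈ s, (c k * circPt x ^ k).re| ≤
        ‖(v x : ℂ) - ∑ k ∈ s, c k * circPt x ^ k‖ := by
      refine le_trans (le_of_eq ?_) (Complex.abs_re_le_norm _)
      simp
    refine h3.trans ?_
    rw [h2, ← tsum_mul_left]
    have h4 : ∀ k : ((s : Set ℤ)ᶜ : Set ℤ), ‖c k * circPt x ^ (k : ℤ)‖ ≤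
        C / (D : ℝ) ^ (m - 2) * (1 / ((k : ℤ) : ℝ) ^ 2) := by
      rintro ⟨k, hk⟩
      have hkD : (D : ℝ) ≤ |(k : ℝ)| := by
        have : ¬ (-(D : ℤ) ≤ k ∧ k ≤ D) := fun h => hk (Finset.mem_coe.2 (Finset.mem_Icc.2 h))
        have h5 : (D : ℤ) ≤ |k| := by
          rcases abs_cases k with ⟨h, _⟩ | ⟨h, _⟩ <;> omega
        exact_mod_cast h5
      have hk0 : k ≠ 0 := by
        rintro rfl
        have : (0 : ℝ) < D := by exact_mod_cast hD
        simp at hkD; linarith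
      rw [norm_mul, norm_zpow, norm_circPt, one_zpow, mul_one]
      refine (hcb k hk0).trans ?_
      have hD' : (0 : ℝ) < D := by exact_mod_cast hD
      have h6 : |(k : ℝ)| ^ m = |(k : ℝ)| ^ (m - 2) * (k : ℝ) ^ 2 := by
        rw [← sq_abs (k : ℝ), ← pow_add]; congr 1; omega
      rw [h6, div_mul_div_comm, mul_one]
      have : (0 : ℝ) < (k : ℝ) ^ 2 := by
        have : (k : ℝ) ≠ 0 := by exact_mod_cast hk0
        positivity
      gcongr
    have hZ' : Summable fun k : ℤ => C / (D : ℝ) ^ (m - 2) * (1 / (k : ℝ) ^ 2) := hZ.mul_left _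
    refine (tsum_of_norm_bounded (hZ'.subtype _).hasSum h4).trans ?_
    exact hZ'.tsum_subtype_le _ _ (fun k => by positivity)

/-- Gevrey functions are well approximated by trigonometric polynomials. -/
theorem IsGevrey.exists_approx {s : ℝ} {v : ℝ → ℝ} (hv : IsGevrey s v) :
    ∃ A n₁ : ℕ, ∀ n ≥ n₁, ∃ w, IsTrigPoly (n ^ A) w ∧
      ∀ x, |v x - w x| ≤ Real.exp (-(n : ℝ) ^ 3) := by
  obtain ⟨M, hM, K, hK, hb⟩ := hv.bound
  set p := ⌈s⌉₊ with hp
  set Z := ∑' k : ℤ, 1 / (k : ℝ) ^ 2 with hZ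
  have hZ0 : 0 ≤ Z := tsum_nonneg fun k => by positivity
  refine ⟨4 * p + 3, max (max ⌈K⌉₊ ⌈M * Z⌉₊) (max 3 (2 * (4 * p + 3))), fun n hn => ?_⟩
  have hnK : K ≤ n := (Nat.le_ceil K).trans (by
    exact_mod_cast (le_max_left _ _).trans ((le_max_left _ _).trans hn))
  have hnZ : M * Z ≤ n := (Nat.le_ceil _).trans (by
    exact_mod_cast (le_max_right _ _).trans ((le_max_left _ _).trans hn))
  have hn3 : 3 ≤ n := (le_max_left _ _).trans ((le_max_right _ _).trans hn)
  have hnA : 2 * (4 * p + 3) ≤ n := (le_max_right _ _).trans ((le_max_right _ _).trans hn)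
  have hn3' : (3 : ℝ) ≤ n := by exact_mod_cast hn3
  set A := 4 * p + 3 with hA
  set m := n ^ 4 with hm
  have hnm : n ≤ m := Nat.le_self_pow (by norm_num) n
  obtain ⟨w, hw, hvw⟩ := exists_trigPoly_approx hv.periodic hv.smooth (m := m) (by omega)
    (fun x => hb m x) (D := n ^ A) (by positivity)
  refine ⟨w, hw, fun x => (hvw x).trans ?_⟩
  have hfac : (Nat.factorial m : ℝ) ^ s ≤ ((n : ℝ) ^ (4 * p)) ^ m := by
    have h1 : (1 : ℝ) ≤ Nat.factorial m := by
      exact_mod_cast Nat.one_le_iff_ne_zero.2 (Nat.factorial_ne_zero m)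
    calc (Nat.factorial m : ℝ) ^ s ≤ (Nat.factorial m : ℝ) ^ (p : ℝ) :=
          Real.rpow_le_rpow_of_exponent_le h1 (Nat.le_ceil s)
      _ = (Nat.factorial m : ℝ) ^ p := Real.rpow_natCast _ _
      _ ≤ ((m : ℝ) ^ m) ^ p := by
        gcongr; exact_mod_cast Nat.factorial_le_pow m
      _ = ((n : ℝ) ^ (4 * p)) ^ m := by
        rw [hm]; push_cast; rw [← pow_mul, ← pow_mul, ← pow_mul]; congr 1; ring
  have hpos : (0 : ℝ) < ((n ^ A : ℕ) : ℝ) ^ (m - 2) := by positivity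
  rw [div_mul_eq_mul_div, div_le_iff₀ hpos]
  have hX : ((n ^ A : ℕ) : ℝ) ^ m = ((n ^ A : ℕ) : ℝ) ^ (m - 2) * ((n : ℝ) ^ (2 * A)) := by
    rw [show m = m - 2 + 2 by omega, pow_add]
    simp only [Nat.add_sub_cancel]
    push_cast; rw [← pow_mul (n : ℝ) A 2, mul_comm A 2]
  have hexp : Real.exp ((n : ℝ) ^ 3) * (M * Z) ≤ (n : ℝ) ^ m := by
    have h1 : Real.exp 1 ≤ n := Real.exp_one_lt_d9.le.trans (by linarith)
    have h2 : (n : ℝ) ≤ Real.exp n := by linarith [Real.add_one_le_exp (n : ℝ)]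
    calc Real.exp ((n : ℝ) ^ 3) * (M * Z) ≤ Real.exp ((n : ℝ) ^ 3) * Real.exp n := by
          gcongr; linarith
      _ = Real.exp ((n : ℝ) ^ 3 + n) := by rw [Real.exp_add]
      _ ≤ Real.exp (m : ℝ) := by
        refine Real.exp_le_exp.2 ?_
        rw [hm]; push_cast
        nlinarith [pow_pos (show (0 : ℝ) < n by linarith) 3, sq_nonneg ((n : ℝ) - 1)]
      _ = Real.exp 1 ^ m := by rw [← Real.exp_nat_mul, mul_one]
      _ ≤ _ := by gcongr
  have hn0 : (0 : ℝ) < n := by linarith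
  have h2A : (n : ℝ) ^ (2 * A) ≤ (n : ℝ) ^ m := pow_le_pow_right₀ (by linarith) (by omega)
  have key : (M * K ^ m * (Nat.factorial m : ℝ) ^ s * Z) * ((n : ℝ) ^ (2 * A)) ≤
      (Real.exp (-(n : ℝ) ^ 3) * ((n ^ A : ℕ) : ℝ) ^ (m - 2)) * ((n : ℝ) ^ (2 * A)) := by
    rw [mul_assoc (Real.exp _), ← hX]
    have e1 : ((n ^ A : ℕ) : ℝ) ^ m =
        ((n : ℝ) ^ (4 * p)) ^ m * ((n : ℝ) ^ m * (n : ℝ) ^ m * (n : ℝ) ^ m) := by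
      push_cast
      rw [hA, pow_add, mul_pow]; congr 1; ring
    rw [e1]
    calc (M * K ^ m * (Nat.factorial m : ℝ) ^ s * Z) * ((n : ℝ) ^ (2 * A))
        ≤ (M * (n : ℝ) ^ m * ((n : ℝ) ^ (4 * p)) ^ m * Z) * (n : ℝ) ^ m := by gcongr
      _ = Real.exp (-(n : ℝ) ^ 3) * (((n : ℝ) ^ (4 * p)) ^ m *
          ((Real.exp ((n : ℝ) ^ 3) * (M * Z)) * (n : ℝ) ^ m * (n : ℝ) ^ m)) := by
        have : Real.exp (-(n : ℝ) ^ 3) * Real.exp ((n : ℝ) ^ 3) = 1 := by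
          rw [← Real.exp_add]; simp
        linear_combination (-(((n : ℝ) ^ (4 * p)) ^ m * (M * Z) * (n : ℝ) ^ m * (n : ℝ) ^ m)) * this
      _ ≤ _ := by gcongr
  exact le_of_mul_le_mul_right key (by positivity)

end Fourier

section Sublevel

theorem exists_separated_points {E : Set ℝ} {δ : ℝ} (hδ : 0 < δ) (hb : BddBelow E) :
    ∀ k : ℕ, ENNReal.ofReal (2 * k * δ) < volume E →
      ∃ x : ℕ → ℝ, (∀ i < k, x i ∈ E) ∧ ∀ i, i + 1 < k → x i + δ ≤ x (i + 1) := by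
  intro k
  induction k generalizing E with
  | zero => exact fun _ => ⟨fun _ => 0, fun i hi => absurd hi (by omega), fun i hi => by omega⟩
  | succ k ih =>
    intro hE
    have hne : E.Nonempty := by
      by_contra h
      rw [Set.not_nonempty_iff_eq_empty] at h
      rw [h] at hE; simp at hE
    obtain ⟨y, hyE, hy⟩ := exists_lt_of_csInf_lt hne (show sInf E < sInf E + δ by linarith)
    have hsub : E ⊆ Set.Icc (sInf E) (sInf E + 2 * δ) ∪ (E ∩ Set.Ici (y + δ)) := by
      intro z hz
      rcases le_or_gt (y + δ) z with h | h
      · exact Or.inr ⟨hz, h⟩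
      · exact Or.inl ⟨csInf_le hb hz, by linarith⟩
    have hvol : volume E ≤ ENNReal.ofReal (2 * δ) + volume (E ∩ Set.Ici (y + δ)) := by
      refine (measure_mono hsub).trans ((measure_union_le _ _).trans ?_)
      rw [Real.volume_Icc, add_sub_cancel_left]
    have hk : ENNReal.ofReal (2 * k * δ) < volume (E ∩ Set.Ici (y + δ)) := by
      by_contra hcon
      rw [not_lt] at hcon
      have h1 := hE.trans_le (hvol.trans (add_le_add le_rfl hcon))
      rw [← ENNReal.ofReal_add (by positivity) (by positivity)] at h1
      refine lt_irrefl _ (h1.trans_le (le_of_eq ?_))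
      congr 1; push_cast; ring
    obtain ⟨x, hx1, hx2⟩ := ih (hb.mono Set.inter_subset_left) hk
    refine ⟨fun i => if i = 0 then y else x (i - 1), fun i hi => ?_, fun i hi => ?_⟩
    · rcases i with _ | i
      · simpa using hyE
      · simpa using (hx1 i (by omega)).1
    · rcases i with _ | i
      · simpa using (hx1 0 (by omega)).2
      · simpa using hx2 i (by omega)

theorem exists_abs_iteratedDeriv_le {v : ℝ → ℝ} (hv : ContDiff ℝ ((⊤ : ℕ∞) : WithTop ℕ∞) v)
    {a b δ : ℝ} (hδ : 0 < δ) (m : ℕ) : ∀ {t : ℝ} (x : ℕ → ℝ),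
      (∀ i < 2 ^ m, x i ∈ Set.Icc a b ∧ |v (x i)| ≤ t) →
      (∀ i, i + 1 < 2 ^ m → x i + δ ≤ x (i + 1)) →
      ∃ ξ ∈ Set.Icc a b, |iteratedDeriv m v ξ| ≤ t * (2 / δ) ^ m := by
  induction m generalizing v with
  | zero => intro t x h _; exact ⟨x 0, (h 0 (by simp)).1, by simpa using (h 0 (by simp)).2⟩
  | succ m ih =>
    intro t x h hsep
    have hdiff : Differentiable ℝ v := hv.differentiable (by simp)
    have hpow : 2 ^ (m + 1) = 2 * 2 ^ m := by ring
    have hmvt : ∀ i, ∃ y, i < 2 ^ m →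
        (x (2 * i) < y ∧ y < x (2 * i + 1) ∧ |deriv v y| ≤ 2 * t / δ) := by
      intro i
      by_cases hi : i < 2 ^ m
      · have h1 := hsep (2 * i) (by omega)
        obtain ⟨y, hy, hy'⟩ := exists_deriv_eq_slope v (show x (2 * i) < x (2 * i + 1) by linarith)
          hv.continuous.continuousOn hdiff.differentiableOn
        refine ⟨y, fun _ => ⟨hy.1, hy.2, ?_⟩⟩
        have h2 := (h (2 * i) (by omega)).2
        have h3 := (h (2 * i + 1) (by omega)).2
        have hd : 0 < x (2 * i + 1) - x (2 * i) := by linarith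
        rw [hy', abs_div, abs_of_pos hd, div_le_div_iff₀ hd hδ]
        have h4 : |v (x (2 * i + 1)) - v (x (2 * i))| ≤ 2 * t := (abs_sub _ _).trans (by linarith)
        have ht : 0 ≤ 2 * t := (abs_nonneg _).trans h4
        exact mul_le_mul h4 (by linarith) hδ.le ht
      · exact ⟨0, fun h => absurd h hi⟩
    choose y hy using hmvt
    have hv' : ContDiff ℝ ((⊤ : ℕ∞) : WithTop ℕ∞) (deriv v) := hv.iterate_deriv 1
    obtain ⟨ξ, hξ, hξ'⟩ := ih hv' y (t := 2 * t / δ) (fun i hi => by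
      obtain ⟨h1, h2, h3⟩ := hy i hi
      have h4 := (h (2 * i) (by omega)).1
      have h5 := (h (2 * i + 1) (by omega)).1
      exact ⟨⟨by linarith [h4.1], by linarith [h5.2]⟩, h3⟩) (fun i hi => by
      obtain ⟨_, h2, _⟩ := hy i (by omega)
      obtain ⟨h1, _, _⟩ := hy (i + 1) hi
      have := hsep (2 * i + 1) (by omega)
      rw [show 2 * (i + 1) = 2 * i + 1 + 1 by ring] at h1
      linarith)
    refine ⟨ξ, hξ, ?_⟩
    rw [iteratedDeriv_succ']
    refine hξ'.trans (le_of_eq ?_)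
    rw [pow_succ]; ring

theorem volume_sublevel_le {v : ℝ → ℝ} (hv : ContDiff ℝ ((⊤ : ℕ∞) : WithTop ℕ∞) v)
    {a b c : ℝ} {m : ℕ} (hm : 1 ≤ m) (hc : 0 < c)
    (hder : ∀ x ∈ Set.Icc a b, c ≤ |iteratedDeriv m v x|) (e : ℝ) {t : ℝ} (ht : 0 < t) :
    volume {x ∈ Set.Icc a b | |v x - e| < t} ≤
      ENNReal.ofReal (2 * 2 ^ m * (2 * (2 * t / c) ^ (1 / (m : ℝ)))) := by
  by_contra! hcon
  set δ := 2 * (2 * t / c) ^ (1 / (m : ℝ)) with hδ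
  have hδ0 : 0 < δ := by positivity
  obtain ⟨x, hx1, hx2⟩ := exists_separated_points hδ0 (E := {x ∈ Set.Icc a b | |v x - e| < t})
    ⟨a, fun x hx => hx.1.1⟩ (2 ^ m) (by exact_mod_cast hcon)
  obtain ⟨ξ, hξ, hξ'⟩ := exists_abs_iteratedDeriv_le (v := fun x => v x - e)
    (hv.sub contDiff_const) hδ0 m x (t := t)
    (fun i hi => ⟨(hx1 i hi).1, (hx1 i hi).2.le⟩) hx2
  have h1 : iteratedDeriv m (fun x => v x - e) ξ = iteratedDeriv m v ξ := by
    obtain ⟨k, rfl⟩ : ∃ k, m = k + 1 := ⟨m - 1, by omega⟩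
    rw [iteratedDeriv_succ', iteratedDeriv_succ']
    congr 1
    ext y
    rw [deriv_sub_const]
  rw [h1] at hξ'
  have h2 : (2 / δ) ^ m = c / (2 * t) := by
    have h3 : ((2 * t / c) ^ (1 / (m : ℝ))) ^ m = 2 * t / c := by
      rw [one_div, Real.rpow_inv_natCast_pow (by positivity) (by omega)]
    rw [hδ, ← div_div, div_self two_ne_zero, div_pow, one_pow, h3, one_div_div]
  rw [h2] at hξ'
  have h4 := hder ξ hξ
  have h5 : t * (c / (2 * t)) = c / 2 := by field_simp
  linarith

/-- A transversal potential has sublevel sets of power-law measure, uniformly in the level. -/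
theorem exists_sublevel_bound {v : ℝ → ℝ} (hv : ContDiff ℝ ((⊤ : ℕ∞) : WithTop ℕ∞) v)
    (htr : IsTransversal v) : ∃ C > (0 : ℝ), ∃ b > (0 : ℝ), ∀ (e t : ℝ), 0 < t → t ≤ 1 →
      circleMeasure.real {x | |v x - e| < t} ≤ C * t ^ b := by
  have hloc : ∀ x : ℝ, ∃ m : ℕ, 1 ≤ m ∧ ∃ c > (0 : ℝ), ∃ r > (0 : ℝ),
      ∀ y ∈ Set.Icc (x - r) (x + r), c ≤ |iteratedDeriv m v y| := by
    intro x
    obtain ⟨m, hm, hne⟩ := htr x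
    have hcont : Continuous fun y => |iteratedDeriv m v y| :=
      (hv.continuous_iteratedDeriv m (by exact_mod_cast le_top)).abs
    have hpos : 0 < |iteratedDeriv m v x| := abs_pos.2 hne
    have hev := hcont.continuousAt.eventually (lt_mem_nhds (half_lt_self hpos))
    obtain ⟨r, hr, hball⟩ := Metric.eventually_nhds_iff.1 hev
    refine ⟨m, hm, _, half_pos hpos, r / 2, by positivity, fun y hy => (hball ?_).le⟩
    rw [Real.dist_eq, abs_lt]
    constructor <;> linarith [hy.1, hy.2]
  choose m hm c hc r hr hder using hloc
  obtain ⟨s, hs⟩ := (isCompact_Icc (a := (0 : ℝ)) (b := 2 * Real.pi)).elim_finite_subcover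
    (fun x : ℝ => Set.Ioo (x - r x) (x + r x)) (fun x => isOpen_Ioo)
    (fun x _ => Set.mem_iUnion.2 ⟨x, by constructor <;> linarith [hr x]⟩)
  set m₀ := s.sup m + 1 with hm₀
  let Cx : ℝ → ℝ := fun x => 2 * 2 ^ m x * (2 * (2 / c x) ^ (1 / (m x : ℝ)))
  have hCx : ∀ x, 0 ≤ Cx x := fun x => by have := hc x; positivity
  refine ⟨∑ x ∈ s, Cx x + 1, by have := Finset.sum_nonneg (s := s) fun x _ => hCx x; linarith,
    1 / (m₀ : ℝ), by positivity, fun e t ht ht1 => ?_⟩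
  have hpiece : ∀ x ∈ s, volume.real {y ∈ Set.Icc (x - r x) (x + r x) | |v y - e| < t} ≤
      Cx x * t ^ (1 / (m₀ : ℝ)) := by
    intro x hx
    have h1 := volume_sublevel_le hv (hm x) (hc x) (hder x) e ht
    have hcx := hc x
    refine (ENNReal.toReal_le_of_le_ofReal (by positivity) h1).trans ?_
    have h2 : (2 * t / c x) ^ (1 / (m x : ℝ)) =
        (2 / c x) ^ (1 / (m x : ℝ)) * t ^ (1 / (m x : ℝ)) := by
      rw [← Real.mul_rpow (by positivity) ht.le]; congr 1; ring
    have h3 : t ^ (1 / (m x : ℝ)) ≤ t ^ (1 / (m₀ : ℝ)) := by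
      refine Real.rpow_le_rpow_of_exponent_ge ht ht1 ?_
      have h4 : (0 : ℝ) < m x := by exact_mod_cast hm x
      refine one_div_le_one_div_of_le h4 ?_
      have : m x ≤ m₀ := (Finset.le_sup hx).trans (Nat.le_succ _)
      exact_mod_cast this
    rw [h2]
    calc _ = Cx x * t ^ (1 / (m x : ℝ)) := by simp only [Cx]; ring
      _ ≤ _ := mul_le_mul_of_nonneg_left h3 (hCx x)
  have hcov : {x | |v x - e| < t} ∩ Set.Ioc 0 (2 * Real.pi) ⊆
      ⋃ x ∈ s, {y ∈ Set.Icc (x - r x) (x + r x) | |v y - e| < t} := by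
    rintro y ⟨hy1, hy2⟩
    obtain ⟨x, hx⟩ := Set.mem_iUnion.1 (hs (Set.Ioc_subset_Icc_self hy2))
    obtain ⟨hxs, hx⟩ := Set.mem_iUnion.1 hx
    exact Set.mem_iUnion₂.2 ⟨x, hxs, Set.Ioo_subset_Icc_self hx, hy1⟩
  have hmeas : MeasurableSet {x | |v x - e| < t} :=
    (isOpen_lt (hv.continuous.sub continuous_const).abs continuous_const).measurableSet
  rw [measureReal_restrict_apply hmeas]
  have hfin : volume (⋃ x ∈ s, {y ∈ Set.Icc (x - r x) (x + r x) | |v y - e| < t}) ≠ ⊤ := by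
    refine ne_of_lt ((measure_biUnion_finset_le s _).trans_lt ?_)
    refine ENNReal.sum_lt_top.2 fun x _ => ?_
    exact (measure_mono (fun y hy => hy.1)).trans_lt
      (measure_Icc_lt_top (a := x - r x) (b := x + r x))
  calc _ ≤ volume.real (⋃ x ∈ s, {y ∈ Set.Icc (x - r x) (x + r x) | |v y - e| < t}) :=
        measureReal_mono hcov hfin
    _ ≤ ∑ x ∈ s, volume.real {y ∈ Set.Icc (x - r x) (x + r x) | |v y - e| < t} :=
        measureReal_biUnion_finset_le s _
    _ ≤ ∑ x ∈ s, Cx x * t ^ (1 / (m₀ : ℝ)) := Finset.sum_le_sum hpiece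
    _ = (∑ x ∈ s, Cx x) * t ^ (1 / (m₀ : ℝ)) := by rw [Finset.sum_mul]
    _ ≤ _ := by
      have := Real.rpow_nonneg ht.le (1 / (m₀ : ℝ))
      linarith

end Sublevel

/-- The mean over the circle of `log` of the Hilbert–Schmidt norm of the transfer matrix. -/
noncomputable def meanHS (v : ℝ → ℝ) (ω l E : ℝ) (n : ℕ) : ℝ :=
  (2 * Real.pi)⁻¹ * ∫ x in (0 : ℝ)..(2 * Real.pi), logHS v ω l E n x

theorem mean_mono {f g : ℝ → ℝ} (hf : Continuous f) (hg : Continuous g) (h : ∀ x, f x ≤ g x) :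
    (2 * Real.pi)⁻¹ * ∫ x in (0 : ℝ)..(2 * Real.pi), f x ≤
      (2 * Real.pi)⁻¹ * ∫ x in (0 : ℝ)..(2 * Real.pi), g x := by
  have hpi := Real.two_pi_pos
  gcongr
  exact intervalIntegral.integral_mono_on hpi.le (hf.intervalIntegrable _ _)
    (hg.intervalIntegrable _ _) fun x _ => h x

theorem mean_const (c : ℝ) : (2 * Real.pi)⁻¹ * ∫ _ in (0 : ℝ)..(2 * Real.pi), c = c := by
  rw [intervalIntegral.integral_const]
  simp only [sub_zero, smul_eq_mul]
  have := Real.pi_ne_zero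
  field_simp

theorem abs_mean_sub_mean_le {f g : ℝ → ℝ} (hf : Continuous f) (hg : Continuous g) {c : ℝ}
    (h : ∀ x, |f x - g x| ≤ c) :
    |(2 * Real.pi)⁻¹ * (∫ x in (0 : ℝ)..(2 * Real.pi), f x) -
      (2 * Real.pi)⁻¹ * ∫ x in (0 : ℝ)..(2 * Real.pi), g x| ≤ c := by
  rw [← mul_sub, ← intervalIntegral.integral_sub (hf.intervalIntegrable _ _)
    (hg.intervalIntegrable _ _), abs_le]
  constructor
  · rw [← mean_const (-c)]
    exact mean_mono continuous_const (hf.sub hg) fun x => (abs_le.1 (h x)).1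
  · conv_rhs => rw [← mean_const c]
    exact mean_mono (hf.sub hg) continuous_const fun x => (abs_le.1 (h x)).2

/-- A function close to `c` off a set of small measure has mean close to `c`. -/
theorem abs_mean_sub_le {f : ℝ → ℝ} (hf : Continuous f) {c ε H β : ℝ} (hε : 0 ≤ ε) (hH : 0 ≤ H)
    (hbd : ∀ x, |f x - c| ≤ H) (hβ : circleMeasure.real {x | ε < |f x - c|} ≤ β) :
    |(2 * Real.pi)⁻¹ * (∫ x in (0 : ℝ)..(2 * Real.pi), f x) - c| ≤ ε + H * β := by
  have hpi := Real.two_pi_pos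
  have hpi1 : 1 ≤ 2 * Real.pi := by linarith [Real.pi_gt_three]
  set Z := {x | ε < |f x - c|} with hZ
  have hc : Continuous fun x => |f x - c| := (hf.sub continuous_const).abs
  have hZm : MeasurableSet Z := (isOpen_lt continuous_const hc).measurableSet
  have hindi : IntervalIntegrable (Z.indicator fun _ => (1 : ℝ)) volume 0 (2 * Real.pi) := by
    rw [intervalIntegrable_iff_integrableOn_Ioc_of_le hpi.le]
    exact (integrable_const (1 : ℝ)).indicator hZm
  have h1 : ∀ x, |f x - c| ≤ ε + H * Z.indicator (fun _ => (1 : ℝ)) x := by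
    intro x
    by_cases hx : x ∈ Z
    · rw [Set.indicator_of_mem hx]; linarith [hbd x]
    · rw [Set.indicator_of_notMem hx]
      rw [hZ, Set.mem_ofPred_eq, not_lt] at hx
      linarith
  have e1 : (2 * Real.pi)⁻¹ * (∫ x in (0 : ℝ)..(2 * Real.pi), f x) - c =
      (2 * Real.pi)⁻¹ * ∫ x in (0 : ℝ)..(2 * Real.pi), (f x - c) := by
    rw [intervalIntegral.integral_sub (hf.intervalIntegrable _ _) (by simp), mul_sub, mean_const]
  rw [e1, abs_mul, abs_of_pos (inv_pos.2 hpi)]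
  calc (2 * Real.pi)⁻¹ * |∫ x in (0 : ℝ)..(2 * Real.pi), (f x - c)|
      ≤ (2 * Real.pi)⁻¹ * ∫ x in (0 : ℝ)..(2 * Real.pi),
        (ε + H * Z.indicator (fun _ => (1 : ℝ)) x) := by
        gcongr
        refine (intervalIntegral.abs_integral_le_integral_abs hpi.le).trans ?_
        exact intervalIntegral.integral_mono_on hpi.le (hc.intervalIntegrable _ _)
          ((intervalIntegrable_const).add (hindi.const_mul H)) fun x _ => h1 x
    _ = ε + (2 * Real.pi)⁻¹ * (H * circleMeasure.real Z) := by
        rw [intervalIntegral.integral_add intervalIntegrable_const (hindi.const_mul H), mul_add,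
          mean_const, intervalIntegral.integral_const_mul, ← circleMeasure_real_eq_integral hZm]
    _ ≤ ε + 1 * (H * β) := by
        have h0 : 0 ≤ circleMeasure.real Z := measureReal_nonneg
        gcongr
        exact inv_le_one_of_one_le₀ hpi1
    _ = _ := by ring

section Approx
open Polynomial
variable {v : ℝ → ℝ} {ω l E B : ℝ}

theorem meanHS_nonneg (n : ℕ) : 0 ≤ meanHS v ω l E n := by
  have hpi := Real.two_pi_pos
  refine mul_nonneg (by positivity) (intervalIntegral.integral_nonneg hpi.le fun x _ => ?_)
  exact logHS_nonneg v ω l E n x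

theorem meanHS_le (hv : Continuous v) {R : ℝ} (hR : ∀ y, hs (stepMatrix v l E y) ≤ R) {n : ℕ}
    (hn : 1 ≤ n) : meanHS v ω l E n ≤ n * Real.log R := by
  conv_rhs => rw [← mean_const (n * Real.log R)]
  exact mean_mono (continuous_logHS hv n) continuous_const fun x => logHS_le hR hn x

/-- `log ‖M_n‖²` is exponentially close to `log |P|` for a polynomial `P` of controlled degree. -/
theorem exists_polynomial_approx_logHS (hv : ∀ x, |v x| ≤ B - 1) {n A : ℕ}
    (hn : 4 ≤ n) {w : ℝ → ℝ} (hw : IsTrigPoly (n ^ A) w)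
    (hvw : ∀ x, |v x - w x| ≤ Real.exp (-(n : ℝ) ^ 3))
    (hS : Real.log (|l| * B + |E| + 2) ≤ n) (hB1 : 1 ≤ B) :
    ∃ P : ℂ[X], P.natDegree ≤ 4 * n ^ (A + 1) ∧ (∀ x, 1 ≤ ‖P.eval (circPt x)‖) ∧
      ∀ x, |2 * logHS v ω l E n x - Real.log ‖P.eval (circPt x)‖| ≤ Real.exp (-(n : ℝ)) := by
  have hn' : (4 : ℝ) ≤ n := by exact_mod_cast hn
  set R := |l| * B + |E| + 2 with hR
  have hR2 : 2 ≤ R := by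
    have : 0 ≤ |l| * B + |E| := by positivity
    linarith
  have hlR : |l| ≤ R := by
    have : |l| * 1 ≤ |l| * B := by gcongr
    linarith [abs_nonneg E]
  have hRn : R ≤ Real.exp n := (Real.log_le_iff_le_exp (by linarith)).1 hS
  obtain ⟨P, hPd, hP⟩ := exists_polynomial_hs_sq hw ω l E n
  refine ⟨P, hPd.trans (by rw [pow_succ]; ring_nf; exact le_rfl), fun x => ?_, fun x => ?_⟩
  · rw [hP]
    exact one_le_pow₀ (one_le_hs_transferMatrix w ω l E n x)
  · have hwB : ∀ x, |w x| ≤ B := by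
      intro x
      have h1 : |w x| ≤ |v x| + |v x - w x| := by
        have := abs_sub (v x) (v x - w x)
        rwa [sub_sub_cancel] at this
      have h2 : Real.exp (-(n : ℝ) ^ 3) ≤ 1 := Real.exp_le_one_iff.2 (by
        have : 0 ≤ (n : ℝ) ^ 3 := by positivity
        linarith)
      linarith [hv x, hvw x]
    have h1 := abs_logHS_sub_le (ω := ω) (by linarith : 1 ≤ R)
      (hs_stepMatrix_le (l := l) (E := E) fun x => (hv x).trans (by linarith))
      (hs_stepMatrix_le (l := l) (E := E) hwB) hvw n x
    have h2 : Real.log ‖P.eval (circPt x)‖ = 2 * logHS w ω l E n x := by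
      rw [hP, Real.log_pow, logHS]; push_cast; ring
    rw [h2, ← mul_sub, abs_mul, abs_two]
    have h3 : 2 * (n : ℝ) * (|l| * Real.exp (-(n : ℝ) ^ 3)) * R ^ n ≤
        2 * Real.exp n * (Real.exp n * Real.exp (-(n : ℝ) ^ 3)) * Real.exp n ^ n := by
      have h4 : (n : ℝ) ≤ Real.exp n := by linarith [Real.add_one_le_exp (n : ℝ)]
      gcongr
      exact hlR.trans hRn
    have h5 : 2 * (2 * Real.exp n * (Real.exp n * Real.exp (-(n : ℝ) ^ 3)) * Real.exp n ^ n) ≤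
        Real.exp (-(n : ℝ)) := by
      have h6 : (4 : ℝ) ≤ Real.exp n := by linarith [Real.add_one_le_exp (n : ℝ)]
      have e1 : 2 * (2 * Real.exp n * (Real.exp n * Real.exp (-(n : ℝ) ^ 3)) * Real.exp n ^ n) =
          4 * Real.exp (n + n + -(n : ℝ) ^ 3 + n * n) := by
        rw [← Real.exp_nat_mul (n : ℝ) n, Real.exp_add, Real.exp_add, Real.exp_add]; ring
      rw [e1]
      calc 4 * Real.exp (n + n + -(n : ℝ) ^ 3 + n * n)
          ≤ Real.exp n * Real.exp (n + n + -(n : ℝ) ^ 3 + n * n) := by gcongr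
        _ = Real.exp (n + (n + n + -(n : ℝ) ^ 3 + n * n)) := by rw [← Real.exp_add]
        _ ≤ _ := Real.exp_le_exp.2 (by
          have hn0 : (0 : ℝ) < n := by linarith
          nlinarith [sq_nonneg ((n : ℝ) - 4), mul_pos hn0 hn0])
    linarith

theorem circleMeasure_near_roots_le {P : ℂ[X]} {d : ℕ} (hd : P.natDegree ≤ d) {η : ℝ}
    (hη : 0 < η) (m : ℕ) (α : ℝ) :
    circleMeasure.real {x | ∃ j < m, ∃ a ∈ P.roots, ‖circPt (x + j * α) - a‖ < η} ≤
      m * (d * (2 * Real.pi * η)) := by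
  classical
  have hsub : {x | ∃ j < m, ∃ a ∈ P.roots, ‖circPt (x + j * α) - a‖ < η} ⊆
      ⋃ j ∈ Finset.range m, ⋃ a ∈ P.roots.toFinset,
        {x | ‖circPt x - a * circPt (-(j * α))‖ < η} := by
    rintro x ⟨j, hj, a, ha, h⟩
    refine Set.mem_iUnion₂.2 ⟨j, Finset.mem_range.2 hj,
      Set.mem_iUnion₂.2 ⟨a, Multiset.mem_toFinset.2 ha, ?_⟩⟩
    have h1 : circPt x - a * circPt (-(j * α)) = (circPt (x + j * α) - a) * circPt (-(j * α)) := by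
      rw [sub_mul, ← circPt_add]; congr 2; ring
    rw [Set.mem_ofPred_eq, h1, norm_mul, norm_circPt, mul_one]
    exact h
  have hpi := Real.pi_pos
  calc _ ≤ circleMeasure.real (⋃ j ∈ Finset.range m, ⋃ a ∈ P.roots.toFinset,
          {x | ‖circPt x - a * circPt (-(j * α))‖ < η}) :=
            measureReal_mono hsub (measure_ne_top _ _)
    _ ≤ ∑ j ∈ Finset.range m, circleMeasure.real (⋃ a ∈ P.roots.toFinset,
          {x | ‖circPt x - a * circPt (-(j * α))‖ < η}) := measureReal_biUnion_finset_le _ _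
    _ ≤ ∑ j ∈ Finset.range m, (d * (2 * Real.pi * η)) := by
        refine Finset.sum_le_sum fun j _ => (measureReal_biUnion_finset_le _ _).trans ?_
        refine (Finset.sum_le_sum fun a _ => circleMeasure_near_le _ hη).trans ?_
        rw [Finset.sum_const, nsmul_eq_mul]
        have : P.roots.toFinset.card ≤ d :=
          (Multiset.toFinset_card_le _).trans ((P.card_roots').trans hd)
        gcongr
    _ = _ := by rw [Finset.sum_const, Finset.card_range, nsmul_eq_mul]

/-- Birkhoff sums of a function that is close to `log |P|`. -/
theorem exists_birkhoff_exceptional {f : ℝ → ℝ} (hf : Continuous f) {P : ℂ[X]} {d : ℕ}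
    (hd : P.natDegree ≤ d) (hP : ∀ x, 1 ≤ ‖P.eval (circPt x)‖) {θ : ℝ}
    (hfP : ∀ x, |2 * f x - Real.log ‖P.eval (circPt x)‖| ≤ θ)
    {α : ℝ} {q : ℕ} {p : ℤ} (hq : GoodApprox α q p) {η : ℝ} (hη : 0 < η) (hη1 : η ≤ 1 / 4)
    (t : ℕ) : ∃ Z : Set ℝ, circleMeasure.real Z ≤ t * q * (d * (2 * Real.pi * η)) ∧
      ∀ x ∉ Z, |∑ j ∈ Finset.range (t * q), f (x + j * α) -
        t * q * ((2 * Real.pi)⁻¹ * ∫ x in (0 : ℝ)..(2 * Real.pi), f x)| ≤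
        t * (d * (4 * Real.log (3 / η ^ 2) + q * (5 * η))) + t * q * θ := by
  have hne : ∀ x, P.eval (circPt x) ≠ 0 := fun x h => by
    have := hP x; rw [h] at this; norm_num at this
  refine ⟨{x | ∃ j < t * q, ∃ a ∈ P.roots, ‖circPt (x + j * α) - a‖ < η}, ?_, fun x hx => ?_⟩
  · have := circleMeasure_near_roots_le hd hη (t * q) α
    push_cast at this
    exact this
  · have hx' : ∀ j < t * q, ∀ a ∈ P.roots, η ≤ ‖circPt (x + j * α) - a‖ := by
      intro j hj a ha
      by_contra! h
      exact hx ⟨j, hj, a, ha, h⟩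
    have h1 := abs_sum_log_eval_sub_le hd hq hη hη1 hne t hx'
    have hlogc : Continuous fun x => Real.log ‖P.eval (circPt x)‖ :=
      (continuous_norm_eval_circPt P).log fun x => by simpa using hne x
    have hmean : |2 * ((2 * Real.pi)⁻¹ * ∫ x in (0 : ℝ)..(2 * Real.pi), f x) -
        P.logMahlerMeasure| ≤ θ := by
      have h2 := abs_mean_sub_mean_le (f := fun x => 2 * f x) (continuous_const.mul hf)
        hlogc (c := θ) hfP
      rw [intervalIntegral.integral_const_mul] at h2
      rw [logMahlerMeasure_def, Real.circleAverage, smul_eq_mul]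
      have h3 : ∀ x : ℝ, circleMap 0 1 x = circPt x := fun x => by simp [circleMap, circPt]
      simp_rw [h3]
      rw [mul_left_comm]
      exact h2
    have hsum : |2 * ∑ j ∈ Finset.range (t * q), f (x + j * α) -
        ∑ j ∈ Finset.range (t * q), Real.log ‖P.eval (circPt (x + j * α))‖| ≤ t * q * θ := by
      rw [Finset.mul_sum, ← Finset.sum_sub_distrib]
      refine (Finset.abs_sum_le_sum_abs _ _).trans
        ((Finset.sum_le_sum fun (j : ℕ) _ => hfP (x + (j : ℝ) * α)).trans ?_)
      simp
    set F := (2 * Real.pi)⁻¹ * ∫ x in (0 : ℝ)..(2 * Real.pi), f x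
    have hmean' : |(t : ℝ) * q * (2 * F) - t * q * P.logMahlerMeasure| ≤ t * q * θ := by
      rw [← mul_sub, abs_mul, abs_of_nonneg (by positivity : (0 : ℝ) ≤ t * q)]
      gcongr
    have hD0 : 0 ≤ (t : ℝ) * (d * (4 * Real.log (3 / η ^ 2) + q * (5 * η))) :=
      (abs_nonneg _).trans h1
    rw [abs_le] at *
    constructor <;> linarith [h1.1, h1.2, hsum.1, hsum.2, hmean'.1, hmean'.2]

/-- The avalanche principle for transfer matrices cut into `m` blocks of length `n`. -/
theorem abs_logHS_blocks_le {R : ℝ} (hR : ∀ y, hs (stepMatrix v l E y) ≤ R) {n m : ℕ}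
    (hn : 4 ≤ n) (hm : 2 ≤ m) (hS : 2 ≤ Real.log R) {x : ℝ}
    (h1 : ∀ j < m, 9 / 10 * (n * Real.log R) ≤ logHS v ω l E n (x + j * (n * ω)))
    (h2 : ∀ j < m, 18 / 10 * (n * Real.log R) ≤ logHS v ω l E (2 * n) (x + j * (n * ω))) :
    |logHS v ω l E (m * n) x - (∑ j ∈ Finset.range m, logHS v ω l E (2 * n) (x + j * (n * ω)) -
      ∑ j ∈ Finset.range m, logHS v ω l E n (x + j * (n * ω)))| ≤
      2 * (n * Real.log R) + m * (4 * Real.exp (-(n : ℝ))) := by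
  obtain ⟨k, rfl⟩ : ∃ k, m = k + 2 := ⟨m - 2, by omega⟩
  set S := Real.log R with hSdef
  have hn' : (4 : ℝ) ≤ n := by exact_mod_cast hn
  set μ := Real.exp (9 / 10 * (n * S)) with hμ
  let A : ℕ → Matrix (Fin 2) (Fin 2) ℝ := fun j => transferMatrix v ω l E n (x + j * (n * ω))
  have hAlog : ∀ j, Real.log (hs (A j)) = logHS v ω l E n (x + j * (n * ω)) := fun j => rfl
  have hAA : ∀ j : ℕ, A (j + 1) * A j = transferMatrix v ω l E (2 * n) (x + j * (n * ω)) := by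
    intro j
    rw [two_mul, transferMatrix_add]
    simp only [A]
    congr 2
    push_cast; ring
  have hAAlog : ∀ j, Real.log (hs (A (j + 1) * A j)) = logHS v ω l E (2 * n) (x + j * (n * ω)) :=
    fun j => by rw [hAA, logHS]
  have hApos : ∀ j, 0 < hs (A j) := fun j =>
    lt_of_lt_of_le one_pos (one_le_hs_transferMatrix _ _ _ _ _ _)
  have hAApos : ∀ j, 0 < hs (A (j + 1) * A j) := fun j => by
    rw [hAA]; exact lt_of_lt_of_le one_pos (one_le_hs_transferMatrix _ _ _ _ _ _)
  have hup : ∀ y, logHS v ω l E n y ≤ n * S := fun y => logHS_le hR (by omega) y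
  have hup2 : ∀ y, logHS v ω l E (2 * n) y ≤ 2 * (n * S) := fun y => by
    have := logHS_le (ω := ω) hR (show 1 ≤ 2 * n by omega) y
    push_cast at this
    linarith
  have hμn : Real.exp n ≤ μ := Real.exp_le_exp.2 (by nlinarith)
  have hμ4 : 4 ≤ μ := by linarith [Real.add_one_le_exp (n : ℝ)]
  have hap := avalanche_principle (A := A) (m := k) hμ4
    (fun j _ => det_transferMatrix _ _ _ _ _ _)
    (fun j hj => by
      rw [hμ, ← Real.le_log_iff_exp_le (hApos j)]
      exact h1 j (by omega))
    (fun j hj => by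
      rw [← Real.log_le_log_iff (mul_pos (hApos _) (hApos _))
        (mul_pos (Real.sqrt_pos.2 (by positivity)) (hAApos j)),
        Real.log_mul (hApos _).ne' (hApos _).ne', Real.log_mul (by positivity) (hAApos j).ne',
        Real.log_sqrt (by positivity), hμ, Real.log_exp, hAAlog, hAlog, hAlog]
      have e1 := hup (x + ((j + 1 : ℕ) : ℝ) * (n * ω))
      have e2 := hup (x + j * (n * ω))
      have e3 := h2 j (by omega)
      have : 0 ≤ (n : ℝ) * S := by positivity
      linarith)
  rw [← transferMatrix_mul_eq_orderedProd] at hap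
  change |logHS v ω l E ((k + 2) * n) x + _ - _| ≤ _ at hap
  simp_rw [hAAlog, hAlog] at hap
  have s2 : ∑ j ∈ Finset.range (k + 2), logHS v ω l E (2 * n) (x + j * (n * ω)) =
      ∑ j ∈ Finset.range (k + 1), logHS v ω l E (2 * n) (x + j * (n * ω)) +
      logHS v ω l E (2 * n) (x + ((k + 1 : ℕ) : ℝ) * (n * ω)) := Finset.sum_range_succ _ _
  have s1 : ∑ j ∈ Finset.range (k + 2), logHS v ω l E n (x + j * (n * ω)) =
      ∑ j ∈ Finset.range k, logHS v ω l E n (x + ((j + 1 : ℕ) : ℝ) * (n * ω)) +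
      logHS v ω l E n (x + ((0 : ℕ) : ℝ) * (n * ω)) +
      logHS v ω l E n (x + ((k + 1 : ℕ) : ℝ) * (n * ω)) := by
    rw [Finset.sum_range_succ, Finset.sum_range_succ']
  rw [s1, s2]
  have b1 := hup2 (x + ((k + 1 : ℕ) : ℝ) * (n * ω))
  have b2 := hup (x + ((0 : ℕ) : ℝ) * (n * ω))
  have b3 := hup (x + ((k + 1 : ℕ) : ℝ) * (n * ω))
  have c1 := logHS_nonneg v ω l E (2 * n) (x + ((k + 1 : ℕ) : ℝ) * (n * ω))
  have c2 := logHS_nonneg v ω l E n (x + ((0 : ℕ) : ℝ) * (n * ω))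
  have c3 := logHS_nonneg v ω l E n (x + ((k + 1 : ℕ) : ℝ) * (n * ω))
  have herr : ((k : ℝ) + 1) * (4 / μ) ≤ ((k + 2 : ℕ) : ℝ) * (4 * Real.exp (-(n : ℝ))) := by
    have : 4 / μ ≤ 4 * Real.exp (-(n : ℝ)) := by
      rw [Real.exp_neg, div_eq_mul_inv]; gcongr
    push_cast
    have h0 : 0 ≤ 4 * Real.exp (-(n : ℝ)) := by positivity
    have h00 : 0 ≤ 4 / μ := by positivity
    nlinarith [Nat.cast_nonneg (α := ℝ) k]
  rw [abs_le] at *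
  constructor <;> linarith [hap.1, hap.2]

theorem abs_logHS_sub_logHS_le {R : ℝ} (hR : ∀ y, hs (stepMatrix v l E y) ≤ R)
    (r n : ℕ) (x : ℝ) : |logHS v ω l E (r + n) x - logHS v ω l E n x| ≤ r * Real.log R := by
  rcases r with _ | r
  · simp
  have h1 := logHS_add_le (v := v) (ω := ω) (l := l) (E := E) (r + 1) n x
  have h2 := logHS_le_add (v := v) (ω := ω) (l := l) (E := E) (r + 1) n x
  have h3 := logHS_le (ω := ω) hR (show 1 ≤ r + 1 by omega) (x + n * ω)
  rw [abs_le]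
  constructor <;> linarith

end Approx

theorem exists_goodApprox {κ ω : ℝ} (hω : ω ∈ diophantine κ) {n : ℕ} (hn : 1 ≤ n) {Q : ℕ}
    (hQ : 1 ≤ Q) : ∃ (q : ℕ) (p : ℤ), GoodApprox (n * ω) q p ∧ q ≤ Q ∧
      κ * (Q + 1) ≤ 2 * Real.pi * ((q : ℝ) * n) ^ 4 := by
  have hpi := Real.pi_pos
  obtain ⟨r, hr, hrQ⟩ := Real.exists_rat_abs_sub_le_and_den_le (n * ω / (2 * Real.pi)) hQ
  have hq0 : (0 : ℝ) < r.den := by exact_mod_cast r.pos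
  have hn0 : (0 : ℝ) < n := by exact_mod_cast hn
  have hqQ : (r.den : ℝ) ≤ Q := by exact_mod_cast hrQ
  have hrr : (r : ℝ) = r.num / r.den := by exact_mod_cast (Rat.num_div_den r).symm
  have h1 : |n * ω - 2 * Real.pi * r.num / r.den| ≤ 2 * Real.pi / ((Q + 1) * r.den) := by
    have e : n * ω - 2 * Real.pi * r.num / r.den = 2 * Real.pi * (n * ω / (2 * Real.pi) - r) := by
      rw [hrr]; field_simp
    rw [e, abs_mul, abs_of_pos (by positivity)]
    calc 2 * Real.pi * |n * ω / (2 * Real.pi) - r| ≤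
          2 * Real.pi * (1 / ((Q + 1) * r.den)) := by gcongr
      _ = _ := by ring
  refine ⟨r.den, r.num, ⟨r.pos, ?_, ?_⟩, hrQ, ?_⟩
  · rw [Int.isCoprime_iff_gcd_eq_one]; simpa [Int.gcd] using r.reduced
  · refine h1.trans ?_
    rw [pow_two]
    gcongr
    linarith
  · have hk : ((r.den * n : ℕ) : ℤ) ≠ 0 := by
      have := r.pos; positivity
    have h2 := hω _ hk
    set k : ℝ := (r.den : ℝ) * n with hkdef
    have hkc : (((r.den * n : ℕ) : ℤ) : ℝ) = k := by push_cast; rfl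
    have hk1 : 1 ≤ k := by
      have : 1 ≤ r.den * n := Nat.one_le_iff_ne_zero.2 (by have := r.pos; positivity)
      rw [hkdef]; exact_mod_cast this
    rw [hkc, abs_of_pos (by linarith)] at h2
    have h3 : Metric.infDist (k * ω) (Set.range fun n : ℤ => 2 * Real.pi * (n : ℝ)) ≤
        2 * Real.pi / (Q + 1) := by
      refine (Metric.infDist_le_dist_of_mem (Set.mem_range_self r.num)).trans ?_
      rw [Real.dist_eq]
      have e : k * ω - 2 * Real.pi * r.num = r.den * (n * ω - 2 * Real.pi * r.num / r.den) := by
        rw [hkdef]; field_simp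
      simp only [e]
      rw [abs_mul, abs_of_pos hq0]
      calc r.den * |n * ω - 2 * Real.pi * r.num / r.den| ≤
            r.den * (2 * Real.pi / ((Q + 1) * r.den)) := by gcongr
        _ = _ := by field_simp
    have hlog0 : 0 < Real.log (1 + k) := Real.log_pos (by linarith)
    have hlog1 : Real.log (1 + k) ≤ k := by
      have := Real.log_le_sub_one_of_pos (show 0 < 1 + k by linarith); linarith
    have h4 := h2.trans_le h3
    rw [div_lt_div_iff₀ (by positivity) (by positivity)] at h4
    have h5 : k * Real.log (1 + k) ^ 3 ≤ k ^ 4 := by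
      calc k * Real.log (1 + k) ^ 3 ≤ k * k ^ 3 := by gcongr
        _ = k ^ 4 := by ring
    have h6 : 2 * Real.pi * (k * Real.log (1 + k) ^ 3) ≤ 2 * Real.pi * k ^ 4 := by gcongr
    linarith

section Step
open Polynomial
variable {v : ℝ → ℝ} {ω l E : ℝ}

theorem exists_weak_deviation (hvc : Continuous v) (hvp : Function.Periodic v (2 * Real.pi))
    {R : ℝ} (hR : ∀ y, hs (stepMatrix v l E y) ≤ R) {n : ℕ} (hn : 4 ≤ n)
    (hS : 2 ≤ Real.log R) {q : ℕ} {p : ℤ} (hq : GoodApprox (n * ω) q p) {d : ℕ}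
    {P₁ P₂ : ℂ[X]} (hd₁ : P₁.natDegree ≤ d) (hd₂ : P₂.natDegree ≤ d)
    (hP₁ : ∀ x, 1 ≤ ‖P₁.eval (circPt x)‖) (hP₂ : ∀ x, 1 ≤ ‖P₂.eval (circPt x)‖)
    (hU₁ : ∀ x, |2 * logHS v ω l E n x - Real.log ‖P₁.eval (circPt x)‖| ≤ Real.exp (-(n : ℝ)))
    (hU₂ : ∀ x, |2 * logHS v ω l E (2 * n) x - Real.log ‖P₂.eval (circPt x)‖| ≤
      Real.exp (-(n : ℝ)))
    {η β : ℝ} (hη : 0 < η) (hη1 : η ≤ 1 / 4) {t r N : ℕ} (hN : N = r + t * q * n)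
    (htq : 2 ≤ t * q)
    (hβ₁ : circleMeasure.real {x | logHS v ω l E n x < 9 / 10 * (n * Real.log R)} ≤ β)
    (hβ₂ : circleMeasure.real {x | logHS v ω l E (2 * n) x < 18 / 10 * (n * Real.log R)} ≤ β) :
    ∃ Z : Set ℝ, circleMeasure.real Z ≤ t * q * (2 * β + 2 * (d * (2 * Real.pi * η))) ∧
      ∀ x ∉ Z, |logHS v ω l E N x - N * ((meanHS v ω l E (2 * n) - meanHS v ω l E n) / n)| ≤
        3 * (r * Real.log R) + 2 * (n * Real.log R) + t * q * (6 * Real.exp (-(n : ℝ))) +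
          2 * (t * (d * (4 * Real.log (3 / η ^ 2) + q * (5 * η)))) := by
  have hn0 : (0 : ℝ) < n := by exact_mod_cast (show 0 < n by omega)
  set S := Real.log R with hSdef
  obtain ⟨Z₁, hZ₁, hx₁⟩ := exists_birkhoff_exceptional (continuous_logHS (ω := ω) (l := l) (E := E)
    hvc n) hd₁ hP₁ hU₁ hq hη hη1 t
  obtain ⟨Z₂, hZ₂, hx₂⟩ := exists_birkhoff_exceptional (continuous_logHS (ω := ω) (l := l) (E := E)
    hvc (2 * n)) hd₂ hP₂ hU₂ hq hη hη1 t
  set B₁ := {x | logHS v ω l E n x < 9 / 10 * (n * S)} with hB₁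
  set B₂ := {x | logHS v ω l E (2 * n) x < 18 / 10 * (n * S)} with hB₂
  have hshift : ∀ (k : ℕ) (c b : ℝ), circleMeasure.real {x | logHS v ω l E k x < c} ≤ b →
      ∀ a : ℝ, circleMeasure.real {x | x + a ∈ {x | logHS v ω l E k x < c}} ≤ b := by
    intro k c b h a
    rw [circleMeasure_real_shift
      (isOpen_lt (continuous_logHS hvc k) continuous_const).measurableSet
      (fun x => by simp only [Set.mem_ofPred_eq, logHS_periodic hvp k x])]
    exact h
  let W : Set ℝ := ⋃ j ∈ Finset.range (t * q),
    ({x | x + (j : ℝ) * (n * ω) ∈ B₁} ∪ {x | x + (j : ℝ) * (n * ω) ∈ B₂})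
  have hW : circleMeasure.real W ≤ t * q * (2 * β) := by
    refine (measureReal_biUnion_finset_le _ _).trans ?_
    have : ∀ j ∈ Finset.range (t * q), circleMeasure.real
        ({x | x + (j : ℝ) * (n * ω) ∈ B₁} ∪ {x | x + (j : ℝ) * (n * ω) ∈ B₂}) ≤ 2 * β := by
      intro j _
      refine (measureReal_union_le _ _).trans ?_
      have h1 : circleMeasure.real {x | x + (j : ℝ) * (n * ω) ∈ B₁} ≤ β :=
        hshift n _ β hβ₁ (j * (n * ω))
      have h2 : circleMeasure.real {x | x + (j : ℝ) * (n * ω) ∈ B₂} ≤ β :=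
        hshift (2 * n) _ β hβ₂ (j * (n * ω))
      linarith
    refine (Finset.sum_le_sum this).trans ?_
    simp
  refine ⟨W ∪ (Z₁ ∪ Z₂), ?_, fun x hx => ?_⟩
  · have h1 := measureReal_union_le (μ := circleMeasure) W (Z₁ ∪ Z₂)
    have h2 := measureReal_union_le (μ := circleMeasure) Z₁ Z₂
    linarith
  · simp only [Set.mem_union, not_or] at hx
    obtain ⟨hxW, hxZ₁, hxZ₂⟩ := hx
    have hxB : ∀ j < t * q, x + (j : ℝ) * (n * ω) ∉ B₁ ∧ x + (j : ℝ) * (n * ω) ∉ B₂ := by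
      intro j hj
      by_contra hcon
      refine hxW (Set.mem_iUnion₂.2 ⟨j, Finset.mem_range.2 hj, ?_⟩)
      by_contra h
      rw [Set.mem_union, not_or] at h
      exact hcon ⟨h.1, h.2⟩
    have hap := abs_logHS_blocks_le hR hn htq hS (x := x)
      (fun j hj => not_lt.1 (hxB j hj).1) (fun j hj => not_lt.1 (hxB j hj).2)
    have hb1 := hx₁ x hxZ₁
    have hb2 := hx₂ x hxZ₂
    have hrem := abs_logHS_sub_logHS_le (ω := ω) hR r (t * q * n) x
    rw [← hN] at hrem
    change |_ - (t : ℝ) * q * meanHS v ω l E n| ≤ _ at hb1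
    change |_ - (t : ℝ) * q * meanHS v ω l E (2 * n)| ≤ _ at hb2
    have m1 := meanHS_nonneg (v := v) (ω := ω) (l := l) (E := E) n
    have m2 := meanHS_nonneg (v := v) (ω := ω) (l := l) (E := E) (2 * n)
    have m3 := meanHS_le (ω := ω) hvc hR (show 1 ≤ n by omega)
    have m4 := meanHS_le (ω := ω) hvc hR (show 1 ≤ 2 * n by omega)
    push_cast at m4 hap
    set Λ := (meanHS v ω l E (2 * n) - meanHS v ω l E n) / n with hΛ
    have hΛn : meanHS v ω l E (2 * n) - meanHS v ω l E n = n * Λ := by rw [hΛ]; field_simp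
    have hΛS : |Λ| ≤ 2 * S := by
      rw [hΛ, abs_div, abs_of_pos hn0, div_le_iff₀ hn0, abs_le]
      have : 0 ≤ (n : ℝ) * S := by positivity
      constructor <;> nlinarith
    have hrΛ : |(r : ℝ) * Λ| ≤ 2 * (r * S) := by
      rw [abs_mul, Nat.abs_cast]
      calc (r : ℝ) * |Λ| ≤ r * (2 * S) := by gcongr
        _ = _ := by ring
    have hNΛ : (N : ℝ) * Λ =
        r * Λ + (t * q * meanHS v ω l E (2 * n) - t * q * meanHS v ω l E n) := by
      rw [← mul_sub, hΛn, hN]; push_cast; ring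
    rw [hNΛ]
    rw [abs_le] at *
    constructor <;>
      linarith [hap.1, hap.2, hb1.1, hb1.2, hb2.1, hb2.2, hrem.1, hrem.2, hrΛ.1, hrΛ.2]

end Step

/-- The exponent by which the scales grow in the induction. -/
@[irreducible] def scaleExp (A : ℕ) : ℕ := 64 * (A + 6)

theorem scaleExp_eq (A : ℕ) : scaleExp A = 64 * (A + 6) := by rw [scaleExp]

theorem scaleExp_ne_zero (A : ℕ) : scaleExp A ≠ 0 := by rw [scaleExp_eq]; omega

/-- The power of the scale that controls the exceptional sets in the induction. -/
@[irreducible] def measExp (A : ℕ) : ℕ := 2 * scaleExp A * (2 * A + 4)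

theorem measExp_eq (A : ℕ) : measExp A = 2 * scaleExp A * (2 * A + 4) := by rw [measExp]

theorem eventually_pow_le_exp (C : ℝ) (b : ℕ) :
    ∀ᶠ T : ℝ in atTop, C * T ^ b ≤ Real.exp (T / 2) := by
  have h := (isLittleO_pow_exp_pos_mul_atTop b (show (0 : ℝ) < 1 / 2 by norm_num)).const_mul_left C
  filter_upwards [h.bound one_pos] with T hT
  rw [one_mul, Real.norm_eq_abs, Real.norm_eq_abs, abs_of_pos (Real.exp_pos _)] at hT
  refine (le_abs_self _).trans (hT.trans (le_of_eq ?_))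
  congr 1; ring

section
open Polynomial
variable {v : ℝ → ℝ}

/-- The boosted deviation estimate at scale `N`, where `T ^ 64 = N`. -/
theorem boosted_deviation (hvc : Continuous v) {ω l E R : ℝ}
    (hR : ∀ y, hs (stepMatrix v l E y) ≤ R) {N A : ℕ} {T Λ : ℝ} (hT : 40 ≤ T)
    (hTN : T ^ 64 = N) (hexp : 20000 * T ^ (128 * A + 193) ≤ Real.exp (T / 2))
    (hS0 : 0 ≤ Real.log R) (hST : Real.log R ≤ T) (hΛ : |Λ| ≤ 2 * Real.log R) {P : ℂ[X]}
    (hPd : P.natDegree ≤ 4 * N ^ (A + 1)) (hP : ∀ x, 1 ≤ ‖P.eval (circPt x)‖)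
    (hU : ∀ x, |2 * logHS v ω l E N x - Real.log ‖P.eval (circPt x)‖| ≤ 1)
    {Z : Set ℝ} (hZ : circleMeasure.real Z < 1 / (150 * (N : ℝ) ^ (2 * A + 2)))
    (hxZ : ∀ x ∉ Z, |logHS v ω l E N x - N * Λ| ≤ T ^ 60) :
    |meanHS v ω l E N - N * Λ| ≤ T ^ 62 ∧
      circleMeasure.real {x | T ^ 62 < |logHS v ω l E N x - N * Λ|} ≤ Real.exp (-(T / 2)) := by
  have hT0 : 0 < T := by linarith
  have hT1 : 1 ≤ T := by linarith
  have hN1 : (1 : ℝ) ≤ N := by rw [← hTN]; exact one_le_pow₀ hT1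
  have hN0 : (0 : ℝ) < N := by linarith
  have hNn : 1 ≤ N := by exact_mod_cast hN1
  have hp60 : T ^ 61 = T * T ^ 60 := by ring
  have hp62 : T ^ 62 = T * (T * T ^ 60) := by ring
  have h60 : T ≤ T ^ 60 := le_self_pow₀ hT1 (by norm_num)
  constructor
  · have hbd : ∀ x, |logHS v ω l E N x - N * Λ| ≤ 3 * (N * Real.log R) := by
      intro x
      refine (abs_sub _ _).trans ?_
      rw [abs_of_nonneg (logHS_nonneg v ω l E N x), abs_mul, Nat.abs_cast]
      have h1 := logHS_le (ω := ω) hR hNn x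
      have h2 : (N : ℝ) * |Λ| ≤ N * (2 * Real.log R) := by gcongr
      linarith
    have hmean := abs_mean_sub_le (continuous_logHS (ω := ω) (l := l) (E := E) hvc N)
      (c := N * Λ) (ε := T ^ 60) (by positivity) (by positivity) hbd
      (β := 1 / (150 * (N : ℝ) ^ (2 * A + 2)))
      ((measureReal_mono (fun x hx => by
        by_contra h
        exact absurd (hxZ x h) (not_le.2 hx)) (measure_ne_top _ _)).trans hZ.le)
    refine hmean.trans ?_
    have h1 : 3 * (N * Real.log R) * (1 / (150 * (N : ℝ) ^ (2 * A + 2))) ≤ T := by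
      have h2 : (N : ℝ) ≤ (N : ℝ) ^ (2 * A + 2) := le_self_pow₀ hN1 (by omega)
      rw [mul_one_div, div_le_iff₀ (by positivity)]
      calc 3 * (N * Real.log R) ≤ 3 * ((N : ℝ) ^ (2 * A + 2) * T) := by gcongr
        _ ≤ _ := by
          have : 0 ≤ (N : ℝ) ^ (2 * A + 2) * T := by positivity
          linarith
    have h2 : 0 < T ^ 60 := by positivity
    have h3 : 2 * T ^ 60 ≤ T * T ^ 60 := by gcongr; linarith
    have h4 : 1 * (T * T ^ 60) ≤ T * (T * T ^ 60) := by gcongr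
    linarith
  · set ε := 2 * T ^ 60 + 1 with hε
    have hd1 : ((4 * N ^ (A + 1) : ℕ) : ℝ) + 1 ≤ 5 * (N : ℝ) ^ (A + 1) := by
      push_cast
      have : (1 : ℝ) ≤ (N : ℝ) ^ (A + 1) := one_le_pow₀ hN1
      linarith
    have hsmall : circleMeasure.real {x | ε < |Real.log ‖P.eval (circPt x)‖ - 2 * (N * Λ)|} <
        1 / (6 * (((4 * N ^ (A + 1) : ℕ) : ℝ) + 1) ^ 2) := by
      have hsub : {x | ε < |Real.log ‖P.eval (circPt x)‖ - 2 * (N * Λ)|} ⊆ Z := by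
        intro x hx
        by_contra h
        rw [Set.mem_ofPred_eq] at hx
        have h1 := hxZ x h
        have h2 := hU x
        refine absurd hx (not_lt.2 ?_)
        rw [abs_le] at *
        constructor <;> linarith [h1.1, h1.2, h2.1, h2.2]
      refine ((measureReal_mono hsub (measure_ne_top _ _)).trans_lt hZ).trans_le ?_
      refine one_div_le_one_div_of_le (by positivity) ?_
      calc 6 * (((4 * N ^ (A + 1) : ℕ) : ℝ) + 1) ^ 2 ≤ 6 * (5 * (N : ℝ) ^ (A + 1)) ^ 2 := by gcongr
        _ = _ := by ring
    obtain ⟨hup, hlow⟩ := log_norm_eval_boost hPd hP hsmall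
    set η := Real.exp (-T) with hη
    have hLη : Real.log (1 / η) = T := by rw [hη, one_div, ← Real.exp_neg, neg_neg, Real.log_exp]
    have hsub : {x | T ^ 62 < |logHS v ω l E N x - N * Λ|} ⊆
        {x | ∃ j < 1, ∃ a ∈ P.roots, ‖circPt (x + ((j : ℕ) : ℝ) * 0) - a‖ < η} := by
      intro x hx
      by_contra h
      have hx' : ∀ a ∈ P.roots, η ≤ ‖circPt x - a‖ := by
        intro a ha
        by_contra! h'
        exact h ⟨0, by norm_num, a, ha, by simpa using h'⟩
      have h1 := hlow η (Real.exp_pos _) (Real.exp_le_one_iff.2 (by linarith)) x hx'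
      rw [hLη] at h1
      have h2 := hup x
      have h3 := hU x
      have hlog : Real.log (((4 * N ^ (A + 1) : ℕ) : ℝ) + 1) ≤ T := by
        rw [Real.log_le_iff_le_exp (by positivity)]
        refine hd1.trans ?_
        have e1 : 5 * (N : ℝ) ^ (A + 1) ≤ 20000 * T ^ (128 * A + 193) := by
          rw [← hTN, ← pow_mul]
          have := pow_le_pow_right₀ hT1 (show 64 * (A + 1) ≤ 128 * A + 193 by omega)
          have h0 : 0 ≤ T ^ (128 * A + 193) := by positivity
          linarith
        exact e1.trans (hexp.trans (Real.exp_le_exp.2 (by linarith)))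
      have h4 : T * (2 * ε + Real.log (((4 * N ^ (A + 1) : ℕ) : ℝ) + 1) + 2) ≤
          T * (2 * ε + T + 2) := by gcongr
      rw [Set.mem_ofPred_eq] at hx
      refine absurd hx (not_lt.2 ?_)
      have hbig : T * (2 * ε + T + 2) + ε + 2 ≤ 2 * T ^ 62 := by
        rw [hε, hp62]
        nlinarith [mul_pos hT0 (show 0 < T ^ 60 by positivity)]
      rw [abs_le] at *
      constructor <;> nlinarith [h3.1, h3.2]
    refine (measureReal_mono hsub (measure_ne_top _ _)).trans
      ((circleMeasure_near_roots_le hPd (Real.exp_pos _) 1 0).trans ?_)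
    push_cast
    have hpi4 := Real.pi_lt_d2
    have e1 : 4 * (N : ℝ) ^ (A + 1) * (2 * Real.pi) ≤ Real.exp (T / 2) := by
      refine le_trans ?_ hexp
      rw [← hTN, ← pow_mul]
      have := pow_le_pow_right₀ hT1 (show 64 * (A + 1) ≤ 128 * A + 193 by omega)
      have h0 : 0 ≤ T ^ (128 * A + 193) := by positivity
      have h1 : 0 ≤ T ^ (64 * (A + 1)) := by positivity
      nlinarith [Real.pi_pos]
    calc 1 * (4 * (N : ℝ) ^ (A + 1) * (2 * Real.pi * η)) =
          4 * (N : ℝ) ^ (A + 1) * (2 * Real.pi) * η := by ring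
      _ ≤ Real.exp (T / 2) * η := by gcongr
      _ = Real.exp (-(T / 2)) := by rw [hη, ← Real.exp_add]; congr 1; ring

end

section
variable {v : ℝ → ℝ}

theorem scale_measure_lt {N n t q d A : ℕ} {T η : ℝ} (hn4 : 4 ≤ n) (hTN : T ^ 64 = N)
    (hT601 : 601 ≤ T) (hNn : N ≤ 2 * (n + 1) ^ scaleExp A) (htqN : (t : ℝ) * q ≤ N)
    (hdT : (d : ℝ) ≤ T) (hη0 : 0 < η) (hexp1 : 20000 * T ^ (128 * A + 193) * η ≤ 1) :
    (t : ℝ) * q * (2 * (1 / (n : ℝ) ^ measExp A) + 2 * (d * (2 * Real.pi * η))) <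
      1 / (150 * (N : ℝ) ^ (2 * A + 2)) := by
  have hT1 : 1 ≤ T := by linarith
  have hTp : 0 < T := by linarith
  have hN0 : (0 : ℝ) < N := by rw [← hTN]; positivity
  set D := (N : ℝ) ^ (2 * A + 2) with hD
  have hD0 : 0 < D := by positivity
  have hNQ : (N : ℝ) ^ (2 * A + 4) ≤ (n : ℝ) ^ measExp A := by
    have h1 : N ≤ n ^ (2 * scaleExp A) := by
      calc N ≤ 2 * (n + 1) ^ scaleExp A := hNn
        _ ≤ 2 ^ scaleExp A * (n + 1) ^ scaleExp A := by
          gcongr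
          exact Nat.le_self_pow (scaleExp_ne_zero A) 2
        _ = (2 * (n + 1)) ^ scaleExp A := by rw [mul_pow]
        _ ≤ (n ^ 2) ^ scaleExp A := by gcongr; nlinarith
        _ = _ := by rw [← pow_mul]
    have h2 : (N : ℝ) ≤ (n : ℝ) ^ (2 * scaleExp A) := by exact_mod_cast h1
    calc (N : ℝ) ^ (2 * A + 4) ≤ ((n : ℝ) ^ (2 * scaleExp A)) ^ (2 * A + 4) := by gcongr
      _ = _ := by rw [← pow_mul, measExp_eq]
  have hN601 : 601 ≤ (N : ℝ) := by
    rw [← hTN]; exact hT601.trans (le_self_pow₀ hT1 (by norm_num))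
  have e1 : (t : ℝ) * q * (2 * (1 / (n : ℝ) ^ measExp A)) < 1 / (300 * D) := by
    calc (t : ℝ) * q * (2 * (1 / (n : ℝ) ^ measExp A))
        ≤ N * (2 * (1 / (N : ℝ) ^ (2 * A + 4))) := by gcongr
      _ = 2 / (N * D) := by rw [hD]; field_simp; ring
      _ < 1 / (300 * D) := by
        rw [div_lt_div_iff₀ (by positivity) (by positivity)]
        nlinarith
  have e2 : (t : ℝ) * q * (2 * (d * (2 * Real.pi * η))) ≤ 1 / (300 * D) := by
    have hpi : Real.pi ≤ 4 := Real.pi_le_four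
    calc (t : ℝ) * q * (2 * (d * (2 * Real.pi * η))) ≤ N * (2 * (T * (2 * 4 * η))) := by gcongr
      _ = 16 * (N * T * η) := by ring
      _ ≤ 1 / (300 * D) := by
        rw [le_div_iff₀ (by positivity)]
        have e3 : 16 * (N * T * η) * (300 * D) = 4800 * T ^ (128 * A + 193) * η := by
          rw [hD, ← hTN]; ring
        rw [e3]
        have : 0 ≤ T ^ (128 * A + 193) * η := by positivity
        linarith
  have e4 : 1 / (150 * D) = 1 / (300 * D) + 1 / (300 * D) := by field_simp; norm_num
  rw [e4]
  linarith

theorem scale_error_le {N n t q d r A : ℕ} {T S : ℝ} (hS2 : 2 ≤ S) (hSn : S ≤ n) (hnT : (n : ℝ) ≤ T)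
    (hT601 : 601 ≤ T) (hNn : N ≤ 2 * (n + 1) ^ scaleExp A) (htqN : (t : ℝ) * q ≤ N)
    (hdT : (d : ℝ) ≤ T) (hrlt : (r : ℝ) ≤ T ^ 33) (hqT : (q : ℝ) ≤ T ^ 32) (ht57 : (t : ℝ) ≤ T ^ 57)
    (hG1 : 12 * ((n : ℝ) + 1) ^ scaleExp A ≤ Real.exp n)
    (hexp1 : 20000 * T ^ (128 * A + 193) * Real.exp (-T) ≤ 1) :
    3 * (r * S) + 2 * (n * S) + t * q * (6 * Real.exp (-(n : ℝ))) +
      2 * (t * (d * (4 * Real.log (3 / Real.exp (-T) ^ 2) + q * (5 * Real.exp (-T))))) ≤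
        T ^ 60 := by
  have hT1 : 1 ≤ T := by linarith
  have hTp : 0 < T := by linarith
  have hη1 : Real.exp (-T) ≤ 1 := Real.exp_le_one_iff.2 (by linarith)
  set η := Real.exp (-T) with hη
  have hST : S ≤ T := hSn.trans hnT
  have a1 : 3 * (r * S) ≤ 3 * T ^ 59 := by
    calc 3 * (r * S) ≤ 3 * (T ^ 33 * T) := by gcongr
      _ = 3 * T ^ 34 := by ring
      _ ≤ _ := by gcongr; norm_num [hT1]
  have a2 : 2 * (n * S) ≤ 2 * T ^ 59 := by
    calc 2 * (n * S) ≤ 2 * (T * T) := by gcongr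
      _ = 2 * T ^ 2 := by ring
      _ ≤ _ := by gcongr; norm_num [hT1]
  have a3 : (t : ℝ) * q * (6 * Real.exp (-(n : ℝ))) ≤ T ^ 59 := by
    have hNn' : (N : ℝ) ≤ 2 * ((n : ℝ) + 1) ^ scaleExp A := by exact_mod_cast hNn
    calc (t : ℝ) * q * (6 * Real.exp (-(n : ℝ)))
        ≤ (2 * ((n : ℝ) + 1) ^ scaleExp A) * (6 * Real.exp (-(n : ℝ))) :=
            mul_le_mul_of_nonneg_right (htqN.trans hNn') (by positivity)
      _ = 12 * ((n : ℝ) + 1) ^ scaleExp A * Real.exp (-(n : ℝ)) := by ring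
      _ ≤ Real.exp n * Real.exp (-(n : ℝ)) := by gcongr
      _ = 1 := by rw [← Real.exp_add]; simp
      _ ≤ _ := one_le_pow₀ hT1
  have hlog3 : Real.log (3 / η ^ 2) ≤ 3 * T := by
    rw [Real.log_div (by norm_num) (by positivity), Real.log_pow, hη, Real.log_exp]
    have : Real.log 3 ≤ 2 := by
      have := Real.log_le_sub_one_of_pos (show (0 : ℝ) < 3 by norm_num); linarith
    push_cast
    linarith
  have hqη : (q : ℝ) * (5 * η) ≤ T := by
    calc (q : ℝ) * (5 * η) ≤ T ^ 32 * (5 * η) := by gcongr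
      _ ≤ T ^ (128 * A + 193) * (5 * η) := by
        gcongr
        omega
      _ ≤ 1 := by
        have : 0 ≤ T ^ (128 * A + 193) * η := by positivity
        linarith
      _ ≤ T := hT1
  have a4 : 2 * ((t : ℝ) * (d * (4 * Real.log (3 / η ^ 2) + q * (5 * η)))) ≤ 26 * T ^ 59 := by
    have hlog0 : 0 ≤ Real.log (3 / η ^ 2) := Real.log_nonneg (by
      rw [le_div_iff₀ (by positivity)]
      have : 0 < η := Real.exp_pos _
      nlinarith)
    calc 2 * ((t : ℝ) * (d * (4 * Real.log (3 / η ^ 2) + q * (5 * η))))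
        ≤ 2 * (T ^ 57 * (T * (4 * (3 * T) + T))) := by gcongr
      _ = _ := by ring
  have : T ^ 60 = T * T ^ 59 := by ring
  have h0 : 0 ≤ T ^ 59 := by positivity
  nlinarith

/-- A decomposition `N = r + t q n` with `q` a denominator of moderate size for `n ω`. -/
theorem exists_block_decomposition {κ ω : ℝ} (hκ : 0 < κ) (hω : ω ∈ diophantine κ) {n N : ℕ} {T : ℝ}
    (hn4 : 4 ≤ n) (hTN : T ^ 64 = N) (hnT : (n : ℝ) ≤ T) (hTκ : 2 * Real.pi / κ ≤ T)
    (hT601 : 601 ≤ T) :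
    ∃ (q : ℕ) (p : ℤ) (t r : ℕ), GoodApprox (n * ω) q p ∧ N = r + t * q * n ∧ 2 ≤ t * q ∧
      (t : ℝ) * q ≤ N ∧ (r : ℝ) ≤ T ^ 33 ∧ (q : ℝ) ≤ T ^ 32 ∧ (t : ℝ) ≤ T ^ 57 := by
  have hT1 : 1 ≤ T := by linarith
  have hTp : 0 < T := by linarith
  have hQ1 : 1 ≤ ⌊T ^ 32⌋₊ := Nat.one_le_floor_iff _ |>.2 (one_le_pow₀ hT1)
  obtain ⟨q, p, hgood, hqQ, hqκ⟩ := exists_goodApprox hω (show 1 ≤ n by omega) hQ1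
  have hqT : (q : ℝ) ≤ T ^ 32 :=
    (Nat.cast_le.2 hqQ).trans (Nat.floor_le (by positivity))
  have hq1 : 1 ≤ q := hgood.pos
  have hqn : T ^ 7 ≤ (q : ℝ) * n := by
    have h1 : (T ^ 7) ^ 4 ≤ ((q : ℝ) * n) ^ 4 := by
      have h2 : κ * T ^ 32 ≤ 2 * Real.pi * ((q : ℝ) * n) ^ 4 := by
        refine le_trans ?_ hqκ
        gcongr
        exact (Nat.lt_floor_add_one _).le
      have h3 : 2 * Real.pi * (T ^ 7) ^ 4 ≤ κ * T ^ 32 := by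
        rw [div_le_iff₀ hκ] at hTκ
        have h4 : T ≤ T ^ 4 := le_self_pow₀ hT1 (by norm_num)
        calc 2 * Real.pi * (T ^ 7) ^ 4 ≤ (T * κ) * (T ^ 7) ^ 4 := by gcongr
          _ ≤ (T ^ 4 * κ) * (T ^ 7) ^ 4 := by gcongr
          _ = _ := by ring
      exact le_of_mul_le_mul_left (h3.trans h2) Real.two_pi_pos
    exact le_of_pow_le_pow_left₀ (by norm_num) (by positivity) h1
  have hnqT : (n * q : ℝ) ≤ T ^ 33 := by
    calc (n * q : ℝ) ≤ T * T ^ 32 := by gcongr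
      _ = _ := by ring
  set t := N / (n * q) with ht
  set r := N % (n * q) with hr
  have hNrt : N = r + t * q * n := by
    have := Nat.mod_add_div N (n * q)
    rw [← hr, ← ht] at this
    rw [← this]; ring
  have hnq0 : 0 < n * q := Nat.mul_pos (by omega) hq1
  have hrlt : (r : ℝ) ≤ T ^ 33 := by
    have : r < n * q := Nat.mod_lt _ hnq0
    have h2 : (r : ℝ) ≤ n * q := by exact_mod_cast this.le
    exact h2.trans hnqT
  have htN : (t : ℝ) * (q * n) ≤ T ^ 64 := by
    rw [hTN]
    have : t * q * n ≤ N := by omega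
    rw [← mul_assoc]; exact_mod_cast this
  have ht57 : (t : ℝ) ≤ T ^ 57 := by
    have h1 : (t : ℝ) * T ^ 7 ≤ T ^ 57 * T ^ 7 := by
      calc (t : ℝ) * T ^ 7 ≤ t * (q * n) := by gcongr
        _ ≤ T ^ 64 := htN
        _ = _ := by ring
    exact le_of_mul_le_mul_right h1 (by positivity)
  have ht2 : 2 ≤ t := by
    rw [ht, Nat.le_div_iff_mul_le hnq0]
    have h1 : (2 : ℝ) * (n * q) ≤ N := by
      rw [← hTN]
      have h2 : T * T ^ 33 ≤ T ^ 64 := by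
        calc T * T ^ 33 = T ^ 34 := by ring
          _ ≤ T ^ 64 := pow_le_pow_right₀ hT1 (by norm_num)
      have h3 : (0 : ℝ) ≤ T ^ 33 := by positivity
      nlinarith
    exact_mod_cast h1
  have htq : 2 ≤ t * q := ht2.trans (Nat.le_mul_of_pos_right t hq1)
  have htqN : (t : ℝ) * q ≤ N := by
    have h1 : t * q ≤ N := (Nat.le_mul_of_pos_right (t * q) (show 0 < n by omega)).trans (by omega)
    exact_mod_cast h1
  exact ⟨q, p, t, r, hgood, hNrt, htq, htqN, hrlt, hqT, ht57⟩

/-- The inductive step: a weak lower bound at scales `n` and `2 n` gives a strong deviation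
estimate at all scales `N` comparable to `n ^ scaleExp A`. -/
theorem exists_scale_step (hvc : Continuous v) (hvp : Function.Periodic v (2 * Real.pi))
    {B κ : ℝ} (hB1 : 1 ≤ B) (hκ : 0 < κ) (hv : ∀ x, |v x| ≤ B - 1) {A n₁ : ℕ}
    (happ : ∀ n ≥ n₁, ∃ w, IsTrigPoly (n ^ A) w ∧ ∀ x, |v x - w x| ≤ Real.exp (-(n : ℝ) ^ 3)) :
    ∃ n₂ : ℕ, ∀ n ≥ n₂, ∀ (N : ℕ) (T : ℝ), 0 ≤ T → T ^ 64 = N → n ^ scaleExp A ≤ N →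
      N ≤ 2 * (n + 1) ^ scaleExp A → ∀ ω ∈ diophantine κ, ∀ l E S : ℝ,
      S = Real.log (|l| * B + |E| + 2) → 2 ≤ S → S ≤ n →
      circleMeasure.real {x | logHS v ω l E n x < 9 / 10 * (n * S)} ≤ 1 / (n : ℝ) ^ measExp A →
      circleMeasure.real {x | logHS v ω l E (2 * n) x < 18 / 10 * (n * S)} ≤
        1 / (n : ℝ) ^ measExp A →
      |meanHS v ω l E N - N * ((meanHS v ω l E (2 * n) - meanHS v ω l E n) / n)| ≤ T ^ 62 ∧
      circleMeasure.real {x | T ^ 62 < |logHS v ω l E N x -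
        N * ((meanHS v ω l E (2 * n) - meanHS v ω l E n) / n)|} ≤ Real.exp (-(T / 2)) := by
  have hF2 : ∀ᶠ n : ℕ in atTop, ∀ T : ℝ, (n : ℝ) ≤ T →
      20000 * T ^ (128 * A + 193) ≤ Real.exp (T / 2) ∧ 2 * Real.pi / κ ≤ T ∧ 601 ≤ T := by
    have h1 := (eventually_pow_le_exp 20000 (128 * A + 193)).and
      ((eventually_ge_atTop (2 * Real.pi / κ)).and (eventually_ge_atTop (601 : ℝ)))
    obtain ⟨T₀, hT₀⟩ := eventually_atTop.1 h1
    filter_upwards [tendsto_natCast_atTop_atTop.eventually (eventually_ge_atTop T₀)] with n hn T hT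
    exact hT₀ T (hn.trans hT)
  have hF1 : ∀ᶠ n : ℕ in atTop, 12 * ((n : ℝ) + 1) ^ scaleExp A ≤ Real.exp n := by
    have h1 := eventually_pow_le_exp (12 * 2 ^ scaleExp A) (scaleExp A)
    filter_upwards [tendsto_natCast_atTop_atTop.eventually h1, eventually_ge_atTop 1] with n hn hn1
    have hn1' : (1 : ℝ) ≤ n := by exact_mod_cast hn1
    calc 12 * ((n : ℝ) + 1) ^ scaleExp A ≤ 12 * (2 * n : ℝ) ^ scaleExp A := by gcongr; linarith
      _ = 12 * 2 ^ scaleExp A * (n : ℝ) ^ scaleExp A := by rw [mul_pow]; ring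
      _ ≤ _ := hn
      _ ≤ _ := Real.exp_le_exp.2 (by linarith)
  obtain ⟨n₂, hn₂⟩ := eventually_atTop.1 (hF1.and (hF2.and
    ((eventually_ge_atTop n₁).and (eventually_ge_atTop (2 ^ (A + 4))))))
  refine ⟨n₂, fun n hn N T hT0 hTN hnN hNn ω hω l E S hSdef hS2 hSn hβ₁ hβ₂ => ?_⟩
  obtain ⟨hG1, hG2, hnn₁, hnA⟩ := hn₂ n hn
  have hn4 : 4 ≤ n := le_trans (by
    calc 4 ≤ 2 ^ 4 := by norm_num
      _ ≤ 2 ^ (A + 4) := Nat.pow_le_pow_right (by norm_num) (by omega)) hnA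
  have hn4' : (4 : ℝ) ≤ n := by exact_mod_cast hn4
  have hn0 : (0 : ℝ) < n := by linarith
  have hnT' : (n : ℝ) ^ (A + 6) ≤ T := by
    have h1 : ((n : ℝ) ^ (A + 6)) ^ 64 ≤ T ^ 64 := by
      rw [hTN, ← pow_mul, mul_comm, ← scaleExp_eq]
      exact_mod_cast hnN
    exact le_of_pow_le_pow_left₀ (by norm_num) hT0 h1
  have hnT : (n : ℝ) ≤ T := (le_self_pow₀ (by linarith) (by omega)).trans hnT'
  obtain ⟨hexp, hTκ, hT601⟩ := hG2 T hnT
  have hT1 : 1 ≤ T := by linarith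
  have hTp : 0 < T := by linarith
  have hN0 : (0 : ℝ) < N := by rw [← hTN]; positivity
  have hnN' : n ≤ N := (Nat.le_self_pow (scaleExp_ne_zero A) n).trans hnN
  set R := |l| * B + |E| + 2 with hRdef
  have hRstep : ∀ y, hs (stepMatrix v l E y) ≤ R :=
    hs_stepMatrix_le fun x => (hv x).trans (by linarith)
  obtain ⟨q, p, t, r, hgood, hNrt, htq, htqN, hrlt, hqT, ht57⟩ :=
    exists_block_decomposition hκ hω hn4 hTN hnT hTκ hT601
  -- polynomial approximations at the scales `n`, `2 n` and `N`
  set d := 4 * (2 * n) ^ (A + 1) with hd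
  have hdT : (d : ℝ) ≤ T := by
    have h1 : d ≤ n ^ (A + 6) := by
      calc d = 2 ^ (A + 3) * n ^ (A + 1) := by rw [hd, mul_pow]; ring
        _ ≤ 2 ^ (A + 4) * n ^ (A + 1) := by gcongr <;> omega
        _ ≤ n * n ^ (A + 1) := by gcongr
        _ = n ^ (A + 2) := by ring
        _ ≤ n ^ (A + 6) := Nat.pow_le_pow_right (by omega) (by omega)
    have h2 : (d : ℝ) ≤ (n : ℝ) ^ (A + 6) := by exact_mod_cast h1
    exact h2.trans hnT'
  have hP₁deg : 4 * n ^ (A + 1) ≤ d := by rw [hd]; gcongr; omega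
  have hP₂deg : 4 * (2 * n) ^ (A + 1) ≤ d := hd.ge
  clear_value d
  have hSn' : Real.log R ≤ n := hSdef ▸ hSn
  obtain ⟨w₁, hw₁, hvw₁⟩ := happ n hnn₁
  obtain ⟨P₁, hP₁d, hP₁, hU₁⟩ := exists_polynomial_approx_logHS (ω := ω) hv hn4 hw₁ hvw₁ hSn' hB1
  obtain ⟨w₂, hw₂, hvw₂⟩ := happ (2 * n) (by omega)
  obtain ⟨P₂, hP₂d, hP₂, hU₂⟩ := exists_polynomial_approx_logHS (ω := ω) (l := l) (E := E) hv
    (show 4 ≤ 2 * n by omega) hw₂ hvw₂ (hSn'.trans (by push_cast; linarith)) hB1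
  obtain ⟨w₃, hw₃, hvw₃⟩ := happ N (by omega)
  obtain ⟨P₃, hP₃d, hP₃, hU₃⟩ := exists_polynomial_approx_logHS (ω := ω) (l := l) (E := E) hv
    (show 4 ≤ N by omega) hw₃ hvw₃ (hSn'.trans (by exact_mod_cast hnN')) hB1
  clear_value R
  have hP₁d' : P₁.natDegree ≤ d := hP₁d.trans hP₁deg
  set η := Real.exp (-T) with hη
  have hη4 : η ≤ 1 / 4 := by
    rw [hη, Real.exp_neg, one_div]
    exact inv_anti₀ (by norm_num) (by linarith [Real.add_one_le_exp T])
  obtain ⟨Z, hZ, hxZ⟩ := exists_weak_deviation hvc hvp hRstep hn4 (hSdef ▸ hS2) hgood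
    hP₁d' (hP₂d.trans hP₂deg)
    hP₁ hP₂ hU₁ (fun x => (hU₂ x).trans (Real.exp_le_exp.2 (by push_cast; linarith)))
    (Real.exp_pos (-T)) hη4 hNrt htq (hSdef ▸ hβ₁) (hSdef ▸ hβ₂)
  rw [← hSdef] at hxZ
  have hexp1 : 20000 * T ^ (128 * A + 193) * η ≤ 1 := by
    calc 20000 * T ^ (128 * A + 193) * η ≤ Real.exp (T / 2) * η := by gcongr
      _ ≤ Real.exp T * η := by gcongr; linarith
      _ = 1 := by rw [hη, ← Real.exp_add]; simp
  refine boosted_deviation hvc hRstep (P := P₃) (Z := Z) (by linarith) hTN hexp (by linarith)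
    (hSn'.trans hnT) ?_ hP₃d hP₃
    (fun x => (hU₃ x).trans (Real.exp_le_one_iff.2 (by linarith))) ?_ ?_
  · have m1 := meanHS_nonneg (v := v) (ω := ω) (l := l) (E := E) n
    have m2 := meanHS_nonneg (v := v) (ω := ω) (l := l) (E := E) (2 * n)
    have m3 := meanHS_le (ω := ω) hvc hRstep (show 1 ≤ n by omega)
    have m4 := meanHS_le (ω := ω) hvc hRstep (show 1 ≤ 2 * n by omega)
    push_cast at m4
    rw [abs_div, abs_of_pos hn0, div_le_iff₀ hn0, abs_le]
    have : 0 ≤ (n : ℝ) * Real.log R := by rw [← hSdef]; positivity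
    constructor <;> nlinarith
  · exact hZ.trans_lt (scale_measure_lt hn4 hTN hT601 hNn htqN hdT (Real.exp_pos _) hexp1)
  · intro x hx
    exact (hxZ x hx).trans
      (scale_error_le hS2 hSn hnT hT601 hNn htqN hdT hrlt hqT ht57 hG1 hexp1)

end

section
variable {v : ℝ → ℝ}

/-- At large disorder, the diagonal entry of the one-step matrix is almost as large as its norm,
off a set of small measure, uniformly in the energy. -/
theorem exists_small_entry_bound {B C b : ℝ} (hB1 : 1 ≤ B) (hv : ∀ x, |v x| ≤ B) (hC : 0 < C)
    (hb : 0 < b) (hsub : ∀ e t, 0 < t → t ≤ 1 →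
      circleMeasure.real {x | |v x - e| < t} ≤ C * t ^ b) :
    ∃ C₁ > 0, ∃ b₁ > 0, ∃ S₀ : ℝ, ∀ l E S : ℝ, 2 ≤ |l| → S = Real.log (|l| * B + |E| + 2) →
      S₀ ≤ S → circleMeasure.real {x | |l * v x - E| < Real.exp (99 / 100 * S)} ≤
        C₁ * Real.exp (-(b₁ * S)) := by
  refine ⟨C * (4 * B) ^ b, by positivity, b / 100, by positivity,
    100 * Real.log (8 * B), fun l E S hl hS hS₀ => ?_⟩
  have hR0 : 0 < |l| * B + |E| + 2 := by positivity
  have hRS : Real.exp S = |l| * B + |E| + 2 := by rw [hS, Real.exp_log hR0]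
  have h8 : 8 * B ≤ Real.exp (S / 100) := by
    rw [← Real.log_le_iff_le_exp (by positivity)]; linarith
  have hsplit : Real.exp S = Real.exp (99 / 100 * S) * Real.exp (S / 100) := by
    rw [← Real.exp_add]; congr 1; ring
  have hρ0 := Real.exp_pos (99 / 100 * S)
  have hl0 : 0 < |l| := by linarith
  have hlB : |l| ≤ |l| * B := le_mul_of_one_le_right hl0.le hB1
  have hbound : Real.exp (99 / 100 * S) * (8 * B) ≤ Real.exp S := by
    rw [hsplit]; gcongr
  by_cases hE : |E| ≤ 2 * B * |l|
  · have hset : {x | |l * v x - E| < Real.exp (99 / 100 * S)} ⊆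
        {x | |v x - E / l| < Real.exp (99 / 100 * S) / |l|} := by
      intro x hx
      rw [Set.mem_ofPred_eq] at hx ⊢
      have hl' : l ≠ 0 := abs_pos.1 hl0
      rw [lt_div_iff₀ hl0, ← abs_mul]
      have e : (v x - E / l) * l = l * v x - E := by field_simp
      rwa [e]
    have hR4 : Real.exp S ≤ 4 * B * |l| := by rw [hRS]; nlinarith
    have ht : Real.exp (99 / 100 * S) / |l| ≤ 4 * B * Real.exp (-(S / 100)) := by
      rw [div_le_iff₀ hl0]
      have : Real.exp (99 / 100 * S) = Real.exp S * Real.exp (-(S / 100)) := by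
        rw [← Real.exp_add]; congr 1; ring
      rw [this]
      calc Real.exp S * Real.exp (-(S / 100)) ≤ 4 * B * |l| * Real.exp (-(S / 100)) := by gcongr
        _ = _ := by ring
    have ht1 : Real.exp (99 / 100 * S) / |l| ≤ 1 := by
      refine ht.trans ?_
      rw [Real.exp_neg, ← div_eq_mul_inv, div_le_one (Real.exp_pos _)]
      linarith
    refine (measureReal_mono hset (measure_ne_top _ _)).trans
      ((hsub _ _ (by positivity) ht1).trans ?_)
    have h1 : (Real.exp (99 / 100 * S) / |l|) ^ b ≤ (4 * B * Real.exp (-(S / 100))) ^ b :=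
      Real.rpow_le_rpow (by positivity) ht hb.le
    rw [Real.mul_rpow (by positivity) (Real.exp_pos _).le, ← Real.exp_mul] at h1
    calc C * (Real.exp (99 / 100 * S) / |l|) ^ b ≤
          C * ((4 * B) ^ b * Real.exp (-(S / 100) * b)) := by gcongr
      _ = _ := by rw [← mul_assoc]; congr 2; ring
  · push Not at hE
    have hempty : {x | |l * v x - E| < Real.exp (99 / 100 * S)} = ∅ := by
      ext x
      simp only [Set.mem_ofPred_eq, Set.mem_empty_iff_false, iff_false, not_lt]
      have h1 : |E| - |l| * B ≤ |l * v x - E| := by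
        have h2 : |l * v x| ≤ |l| * B := by
          rw [abs_mul]; exact mul_le_mul_of_nonneg_left (hv x) hl0.le
        have h3 := abs_sub_abs_le_abs_sub E (l * v x)
        rw [abs_sub_comm E] at h3
        linarith
      refine le_trans ?_ h1
      nlinarith
    rw [hempty, measureReal_empty]
    positivity

/-- The initial scales: uniform lower bounds at all scales up to a power of the norm. -/
theorem exists_initial_scales {B C b : ℝ} (hB1 : 1 ≤ B)
    (hvc : Continuous v) (hvp : Function.Periodic v (2 * Real.pi))
    (hv : ∀ x, |v x| ≤ B) (hC : 0 < C)
    (hb : 0 < b) (hsub : ∀ e t, 0 < t → t ≤ 1 →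
      circleMeasure.real {x | |v x - e| < t} ≤ C * t ^ b) (Q : ℕ) :
    ∃ c > 0, ∃ S₀ : ℝ, ∀ l E S ω : ℝ, 2 ≤ |l| → S = Real.log (|l| * B + |E| + 2) →
      S₀ ≤ S → ∀ n : ℕ, 1 ≤ n → (n : ℝ) ≤ Real.exp (c * S) →
        circleMeasure.real {x | logHS v ω l E n x < 98 / 100 * (n * S)} ≤
          1 / (100 * (n : ℝ) ^ Q) := by
  obtain ⟨C₁, hC₁, b₁, hb₁, S₁, hS₁⟩ := exists_small_entry_bound hB1 hv hC hb hsub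
  refine ⟨b₁ / (2 * (Q + 1)), by positivity,
    max (max S₁ 100) (2 / b₁ * Real.log (100 * C₁)), fun l E S ω hl hS hS₀ n hn hnS => ?_⟩
  have hS1 : S₁ ≤ S := (le_max_left _ _).trans ((le_max_left _ _).trans hS₀)
  have hS100 : 100 ≤ S := (le_max_right _ _).trans ((le_max_left _ _).trans hS₀)
  have hSC : 100 * C₁ ≤ Real.exp (b₁ / 2 * S) := by
    rw [← Real.log_le_iff_le_exp (by positivity)]
    have h := (le_max_right _ _).trans hS₀
    calc Real.log (100 * C₁) = b₁ / 2 * (2 / b₁ * Real.log (100 * C₁)) := by field_simp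
      _ ≤ _ := by gcongr
  have hent := hS₁ l E S hl hS hS1
  set G := {x | |l * v x - E| < Real.exp (99 / 100 * S)} with hG
  have hGm : MeasurableSet G :=
    (isOpen_lt (by fun_prop : Continuous fun x => |l * v x - E|) continuous_const).measurableSet
  have hn0 : (0 : ℝ) < n := by exact_mod_cast hn
  have hexp2 : 2 ≤ Real.exp (S / 100) := by
    linarith [Real.add_one_le_exp (S / 100)]
  have hρ : Real.exp (98 / 100 * S) ≤ Real.exp (99 / 100 * S) - 1 := by
    have h1 : Real.exp (99 / 100 * S) = Real.exp (98 / 100 * S) * Real.exp (S / 100) := by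
      rw [← Real.exp_add]; congr 1; ring
    have h2 : 1 ≤ Real.exp (98 / 100 * S) := Real.one_le_exp (by linarith)
    rw [h1]; nlinarith
  have hsubset : {x | logHS v ω l E n x < 98 / 100 * (n * S)} ⊆
      ⋃ j ∈ Finset.range n, {x | x + ((j + 1 : ℕ) : ℝ) * ω ∈ G} := by
    intro x hx
    by_contra h
    simp only [Set.mem_iUnion, Finset.mem_range, not_exists] at h
    have h1 : ∀ j < n, Real.exp (99 / 100 * S) ≤ |l * v (x + ((j + 1 : ℕ) : ℝ) * ω) - E| :=
      fun j hj => not_lt.1 (h j hj)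
    have h98 : 1 ≤ Real.exp (98 / 100 * S) := Real.one_le_exp (by linarith)
    have h2 := pow_le_hs_transferMatrix (by linarith) h1
    have h3 : Real.exp (98 / 100 * S) ^ n ≤ hs (transferMatrix v ω l E n x) :=
      (pow_le_pow_left₀ (Real.exp_pos _).le hρ n).trans h2
    have h4 := Real.log_le_log (by positivity) h3
    rw [Real.log_pow, Real.log_exp] at h4
    refine absurd (show logHS v ω l E n x < 98 / 100 * (n * S) from hx) (not_lt.2 ?_)
    rw [logHS]; linarith
  have hμ : circleMeasure.real {x | logHS v ω l E n x < 98 / 100 * (n * S)} ≤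
      n * (C₁ * Real.exp (-(b₁ * S))) := by
    refine (measureReal_mono hsubset (measure_ne_top _ _)).trans
      ((measureReal_biUnion_finset_le _ _).trans ?_)
    refine (Finset.sum_le_sum fun j _ => ?_).trans (by simp : ∑ _j ∈ Finset.range n,
      (C₁ * Real.exp (-(b₁ * S))) ≤ _)
    rw [circleMeasure_real_shift hGm (fun x => by
      simp only [hG, Set.mem_ofPred_eq, hvp x])]
    exact hent
  refine hμ.trans ?_
  rw [le_div_iff₀ (by positivity)]
  have hpow : (n : ℝ) ^ (Q + 1) ≤ Real.exp (b₁ / 2 * S) := by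
    calc (n : ℝ) ^ (Q + 1) ≤ Real.exp (b₁ / (2 * (Q + 1)) * S) ^ (Q + 1) := by gcongr
      _ = _ := by
        rw [← Real.exp_nat_mul]; congr 1; push_cast; field_simp
  calc n * (C₁ * Real.exp (-(b₁ * S))) * (100 * (n : ℝ) ^ Q)
      = (100 * C₁) * (n : ℝ) ^ (Q + 1) * Real.exp (-(b₁ * S)) := by ring
    _ ≤ Real.exp (b₁ / 2 * S) * Real.exp (b₁ / 2 * S) * Real.exp (-(b₁ * S)) := by gcongr
    _ = 1 := by rw [← Real.exp_add, ← Real.exp_add, ← Real.exp_zero]; congr 1; ring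

/-- A lower bound off a small set passes to the mean. -/
theorem le_meanHS_of_measure_le (hvc : Continuous v) {ω l E R : ℝ}
    (hR : ∀ y, hs (stepMatrix v l E y) ≤ R) {n : ℕ} (hn : 1 ≤ n) (hS : 0 ≤ Real.log R)
    (h : circleMeasure.real {x | logHS v ω l E n x < 98 / 100 * (n * Real.log R)} ≤ 1 / 100) :
    97 / 100 * (n * Real.log R) ≤ meanHS v ω l E n := by
  have hnS : 0 ≤ n * Real.log R := by positivity
  have h1 := abs_mean_sub_le (continuous_logHS (ω := ω) (l := l) (E := E) hvc n)
    (c := n * Real.log R) (ε := 2 / 100 * (n * Real.log R)) (H := n * Real.log R) (β := 1 / 100)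
    (by positivity) hnS (fun x => by
      have h2 := logHS_le (ω := ω) hR hn x
      have h3 := logHS_nonneg v ω l E n x
      rw [abs_le]; constructor <;> linarith)
    ((measureReal_mono (fun x hx => by
      have h2 := logHS_le (ω := ω) hR hn x
      rw [Set.mem_ofPred_eq, abs_of_nonpos (by linarith)] at hx
      rw [Set.mem_ofPred_eq]; linarith) (measure_ne_top _ _)).trans h)
  change |meanHS v ω l E n - _| ≤ _ at h1
  rw [abs_le] at h1
  linarith [h1.1]

end

/-- The `64`-th root of the scale `N`. -/
noncomputable def scaleRoot (N : ℕ) : ℝ := (N : ℝ) ^ ((1 : ℝ) / 64)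

theorem scaleRoot_nonneg (N : ℕ) : 0 ≤ scaleRoot N := by unfold scaleRoot; positivity

theorem scaleRoot_pow (N : ℕ) : scaleRoot N ^ 64 = N := by
  rw [scaleRoot, ← Real.rpow_natCast, ← Real.rpow_mul (by positivity)]
  norm_num

theorem scaleRoot_mono {m n : ℕ} (h : m ≤ n) : scaleRoot m ≤ scaleRoot n := by
  unfold scaleRoot
  exact Real.rpow_le_rpow (by positivity) (by exact_mod_cast h) (by norm_num)

theorem scaleRoot_le_self {n : ℕ} (hn : 1 ≤ n) : scaleRoot n ≤ n := by
  have h1 : (1 : ℝ) ≤ n := by exact_mod_cast hn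
  unfold scaleRoot
  calc (n : ℝ) ^ ((1 : ℝ) / 64) ≤ (n : ℝ) ^ (1 : ℝ) :=
        Real.rpow_le_rpow_of_exponent_le h1 (by norm_num)
    _ = n := Real.rpow_one _

theorem one_le_scaleRoot {n : ℕ} (hn : 1 ≤ n) : 1 ≤ scaleRoot n := by
  unfold scaleRoot
  exact Real.one_le_rpow (by exact_mod_cast hn) (by norm_num)

theorem pow_six_le_scaleRoot {k m a : ℕ} (hk : 1 ≤ k) (ha : 384 ≤ a) (h : k ^ a ≤ m) :
    (k : ℝ) ^ 6 ≤ scaleRoot m := by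
  refine le_of_pow_le_pow_left₀ (n := 64) (by norm_num) (scaleRoot_nonneg m) ?_
  have h1 : (k ^ 6) ^ 64 ≤ m := by
    calc (k ^ 6) ^ 64 = k ^ (6 * 64) := (pow_mul k 6 64).symm
      _ ≤ k ^ a := pow_le_pow_right₀ hk (by omega)
      _ ≤ m := h
  rw [scaleRoot_pow]
  exact_mod_cast h1

theorem exists_nat_root {a : ℕ} (ha : a ≠ 0) (N : ℕ) : ∃ n : ℕ, n ^ a ≤ N ∧ N < (n + 1) ^ a := by
  have hex : ∃ n : ℕ, N < (n + 1) ^ a :=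
    ⟨N, (Nat.lt_succ_self N).trans_le (Nat.le_self_pow ha _)⟩
  classical
  refine ⟨Nat.find hex, ?_, Nat.find_spec hex⟩
  rcases Nat.eq_zero_or_pos (Nat.find hex) with h | h
  · rw [h, zero_pow ha]; exact Nat.zero_le _
  · have h1 := Nat.find_min hex (Nat.sub_lt h one_pos)
    rwa [Nat.sub_add_cancel (show 1 ≤ Nat.find hex from h), not_lt] at h1

theorem le_nat_root {a m n N : ℕ} (hm : m ^ a ≤ N) (hn : N < (n + 1) ^ a) : m ≤ n := by
  by_contra! h
  exact absurd (hm.trans_lt hn) (not_lt.2 (Nat.pow_le_pow_left h a))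

section
variable {v : ℝ → ℝ} {ω l E S : ℝ}

/-- The lower bounds at scale `n` that drive the induction on scales. -/
structure ScaleBound (v : ℝ → ℝ) (ω l E S : ℝ) (Q n : ℕ) : Prop where
  measure_le : circleMeasure.real {x | logHS v ω l E n x < 9 / 10 * (n * S)} ≤ 1 / (n : ℝ) ^ Q
  measure_two_mul_le :
    circleMeasure.real {x | logHS v ω l E (2 * n) x < 18 / 10 * (n * S)} ≤ 1 / (n : ℝ) ^ Q
  le_exponent : 905 / 1000 * S + 1 / scaleRoot n ^ 2 ≤
    (meanHS v ω l E (2 * n) - meanHS v ω l E n) / n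

theorem ScaleBound.of_initial {Q n : ℕ} (hn : 1 ≤ n) (hS : 200 ≤ S)
    (h₁ : circleMeasure.real {x | logHS v ω l E n x < 98 / 100 * (n * S)} ≤ 1 / (n : ℝ) ^ Q)
    (h₂ : circleMeasure.real {x | logHS v ω l E (2 * n) x < 98 / 100 * ((2 * n : ℕ) * S)} ≤
      1 / (n : ℝ) ^ Q)
    (hm₁ : meanHS v ω l E n ≤ n * S) (hm₂ : 97 / 100 * ((2 * n : ℕ) * S) ≤ meanHS v ω l E (2 * n)) :
    ScaleBound v ω l E S Q n := by
  have hn0 : (0 : ℝ) < n := by exact_mod_cast hn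
  have hnS : 0 ≤ n * S := by positivity
  push_cast at h₂ hm₂
  refine ⟨(measureReal_mono (fun x hx => ?_) (measure_ne_top _ _)).trans h₁,
    (measureReal_mono (fun x hx => ?_) (measure_ne_top _ _)).trans h₂, ?_⟩
  · rw [Set.mem_ofPred_eq] at hx ⊢; linarith
  · rw [Set.mem_ofPred_eq] at hx ⊢; linarith
  · have h1 : 1 / scaleRoot n ^ 2 ≤ 1 := by
      have := one_le_scaleRoot hn
      rw [div_le_one (by positivity)]
      exact one_le_pow₀ this
    rw [le_div_iff₀ hn0]
    nlinarith

/-- Pass from scale `k` to a scale `m` comparable to `k ^ a`. -/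
theorem ScaleBound.step {a Q k m : ℕ} (hS : 200 ≤ S) (hk : 2 ≤ k) (ha : 384 ≤ a) (hkm : k ^ a ≤ m)
    (hexp : scaleRoot m ^ (64 * Q) ≤ Real.exp (scaleRoot m / 2))
    (hk' : ScaleBound v ω l E S Q k)
    (hstep : ∀ N : ℕ, m ≤ N → N ≤ 2 * m →
      |meanHS v ω l E N - N * ((meanHS v ω l E (2 * k) - meanHS v ω l E k) / k)| ≤
        scaleRoot N ^ 62 ∧
      circleMeasure.real {x | scaleRoot N ^ 62 < |logHS v ω l E N x -
        N * ((meanHS v ω l E (2 * k) - meanHS v ω l E k) / k)|} ≤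
        Real.exp (-(scaleRoot N / 2))) :
    ScaleBound v ω l E S Q m := by
  obtain ⟨hmean₁, hdev₁⟩ := hstep m le_rfl (by omega)
  obtain ⟨hmean₂, hdev₂⟩ := hstep (2 * m) (by omega) le_rfl
  have hΛ := hk'.le_exponent
  set Λ := (meanHS v ω l E (2 * k) - meanHS v ω l E k) / k
  have hk2 : (2 : ℝ) ≤ k := by exact_mod_cast hk
  have hk6 := pow_six_le_scaleRoot (show 1 ≤ k by omega) ha hkm
  have hτ1 := one_le_scaleRoot (show 1 ≤ k by omega)
  have hτk := scaleRoot_le_self (show 1 ≤ k by omega)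
  have hTT := scaleRoot_mono (show m ≤ 2 * m by omega)
  have hTm := scaleRoot_pow m
  have hT2m := scaleRoot_pow (2 * m)
  push_cast at hT2m hmean₂ hdev₂
  rw [← hTm] at hT2m
  set τ := scaleRoot k
  set T := scaleRoot m with hTdef
  set T' := scaleRoot (2 * m)
  clear_value Λ τ T T'
  have hT4 : 4 * τ ≤ T := by
    calc 4 * τ ≤ 4 * k := by linarith
      _ ≤ 2 ^ 5 * k := by linarith
      _ ≤ (k : ℝ) ^ 5 * k := by gcongr
      _ = (k : ℝ) ^ 6 := by ring
      _ ≤ T := hk6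
  have hT1 : 1 ≤ T := by linarith
  have hT0 : 0 < T := by linarith
  have hm0 : (0 : ℝ) < m := by rw [← hTm]; positivity
  have h62 : T' ^ 62 ≤ 2 * T ^ 62 := by
    have h1 : T' ^ 62 * T ^ 2 ≤ 2 * T ^ 62 * T ^ 2 := by
      calc T' ^ 62 * T ^ 2 ≤ T' ^ 62 * T' ^ 2 :=
            mul_le_mul_of_nonneg_left (pow_le_pow_left₀ hT0.le hTT 2)
              (pow_nonneg (hT0.le.trans hTT) _)
        _ = T' ^ 64 := by ring
        _ = _ := by rw [hT2m]; ring
    exact le_of_mul_le_mul_right h1 (by positivity)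
  have hm62 : (m : ℝ) * (1 / T ^ 2) = T ^ 62 := by
    rw [mul_one_div, div_eq_iff (pow_ne_zero 2 hT0.ne'), ← hTm, ← pow_add]
  have hinv1 : 1 / T ^ 2 ≤ 1 := by
    rw [div_le_one (by positivity)]; exact one_le_pow₀ hT1
  have hinv : 4 * (1 / T ^ 2) ≤ 1 / τ ^ 2 := by
    rw [mul_one_div, div_le_div_iff₀ (by positivity) (by positivity)]
    nlinarith
  have hinv0 : 0 < 1 / T ^ 2 := by positivity
  have hmΛ : m * (905 / 1000 * S + 4 * (1 / T ^ 2)) ≤ m * Λ := by gcongr; linarith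
  have hmS : (m : ℝ) * (1 / T ^ 2) ≤ m * (5 / 1000 * S) := by gcongr; linarith
  have hsmall : Real.exp (-(T / 2)) ≤ 1 / (m : ℝ) ^ Q := by
    rw [Real.exp_neg, ← one_div, ← hTm, ← pow_mul]
    exact one_div_le_one_div_of_le (by positivity) hexp
  have hT60 : 0 < T ^ 62 := by positivity
  refine ⟨?_, ?_, ?_⟩
  · refine (measureReal_mono (fun x hx => ?_) (measure_ne_top _ _)).trans (hdev₁.trans hsmall)
    rw [Set.mem_ofPred_eq] at hx ⊢
    rw [lt_abs]
    right
    nlinarith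
  · refine (measureReal_mono (fun x hx => ?_) (measure_ne_top _ _)).trans
      ((hdev₂.trans (Real.exp_le_exp.2 (by linarith))).trans hsmall)
    rw [Set.mem_ofPred_eq] at hx ⊢
    rw [lt_abs]
    right
    nlinarith
  · rw [abs_le] at hmean₁ hmean₂
    rw [le_div_iff₀ hm0, ← hTdef]
    nlinarith [hmean₁.1, hmean₁.2, hmean₂.1, hmean₂.2]

/-- The induction on scales. -/
theorem ScaleBound.induction {a Q n₀ n₁ : ℕ} (hS : 200 ≤ S) (hn₀ : 2 ≤ n₀) (ha : 384 ≤ a)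
    (hn₁ : n₀ ^ a ≤ n₁) (hexp : ∀ T : ℝ, (n₀ : ℝ) ≤ T → T ^ (64 * Q) ≤ Real.exp (T / 2))
    (hbase : ∀ n, n₀ ≤ n → n ≤ n₁ → ScaleBound v ω l E S Q n)
    (hstep : ∀ k ≥ n₀, ScaleBound v ω l E S Q k → ∀ N : ℕ, k ^ a ≤ N → N ≤ 2 * (k + 1) ^ a →
      |meanHS v ω l E N - N * ((meanHS v ω l E (2 * k) - meanHS v ω l E k) / k)| ≤
        scaleRoot N ^ 62 ∧
      circleMeasure.real {x | scaleRoot N ^ 62 < |logHS v ω l E N x -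
        N * ((meanHS v ω l E (2 * k) - meanHS v ω l E k) / k)|} ≤
        Real.exp (-(scaleRoot N / 2))) {m : ℕ} (hm : n₀ ≤ m) : ScaleBound v ω l E S Q m := by
  induction m using Nat.strong_induction_on with
  | _ m ih =>
    by_cases hmn : m ≤ n₁
    · exact hbase m hm hmn
    · obtain ⟨k, hk1, hk2⟩ := exists_nat_root (show a ≠ 0 by omega) m
      have hk0 : n₀ ≤ k := le_nat_root (hn₁.trans (by omega)) hk2
      have hkm : k < m := by
        refine lt_of_lt_of_le ?_ hk1
        calc k < k * k := by nlinarith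
          _ = k ^ 2 := by ring
          _ ≤ k ^ a := Nat.pow_le_pow_right (by omega) (by omega)
      have hk := ih k hkm hk0
      refine hk.step hS (by omega) ha hk1 (hexp _ ?_) fun N h1 h2 =>
        hstep k hk0 hk N (hk1.trans h1) (by omega)
      have h6 := pow_six_le_scaleRoot (show 1 ≤ k by omega) ha hk1
      have hk1' : (1 : ℝ) ≤ k := by exact_mod_cast (show 1 ≤ k by omega)
      have : (n₀ : ℝ) ≤ k := by exact_mod_cast hk0
      exact this.trans ((le_self_pow₀ hk1' (by norm_num)).trans h6)

end

theorem eventually_mul_add_pow_le_exp (K : ℝ) (a : ℕ) {c : ℝ} (hc : 0 < c) :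
    ∀ᶠ S : ℝ in atTop, 2 * (K + S) ^ a ≤ Real.exp (c * S) := by
  have h := (isLittleO_pow_exp_pos_mul_atTop a hc).const_mul_left (2 * 2 ^ a)
  filter_upwards [h.bound one_pos, eventually_ge_atTop |K|] with S hS hK
  have hS0 : 0 ≤ S := (abs_nonneg K).trans hK
  rw [one_mul, Real.norm_eq_abs, Real.norm_eq_abs, abs_of_pos (Real.exp_pos _)] at hS
  refine le_trans ?_ ((le_abs_self _).trans hS)
  have hKS : 0 ≤ K + S := by linarith [neg_abs_le K]
  calc 2 * (K + S) ^ a ≤ 2 * (2 * S) ^ a := by gcongr; linarith [le_abs_self K]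
    _ = _ := by rw [mul_pow]; ring

section
variable {v : ℝ → ℝ}

/-- The deviation estimate at every scale past a threshold that depends on the energy through the
logarithm of the norm of the one-step matrix only. -/
theorem exists_deviation (hvc : Continuous v) (hvp : Function.Periodic v (2 * Real.pi))
    {B κ C b : ℝ} (hB1 : 1 ≤ B) (hκ : 0 < κ) (hv : ∀ x, |v x| ≤ B - 1) {A n₁ : ℕ}
    (happ : ∀ n ≥ n₁, ∃ w, IsTrigPoly (n ^ A) w ∧ ∀ x, |v x - w x| ≤ Real.exp (-(n : ℝ) ^ 3))
    (hC : 0 < C) (hb : 0 < b) (hsub : ∀ e t, 0 < t → t ≤ 1 →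
      circleMeasure.real {x | |v x - e| < t} ≤ C * t ^ b) :
    ∃ (n₃ : ℕ) (S₀ : ℝ), ∀ ω ∈ diophantine κ, ∀ l E S : ℝ, 2 ≤ |l| →
      S = Real.log (|l| * B + |E| + 2) → S₀ ≤ S →
      ∀ N : ℕ, max n₃ ⌈S⌉₊ ^ scaleExp A ≤ N → ∃ Λ, 9 / 10 * S ≤ Λ ∧
        |meanHS v ω l E N - N * Λ| ≤ scaleRoot N ^ 62 ∧
        circleMeasure.real {x | scaleRoot N ^ 62 < |logHS v ω l E N x - N * Λ|} ≤
          Real.exp (-(scaleRoot N / 2)) := by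
  have hvB : ∀ x, |v x| ≤ B := fun x => (hv x).trans (by linarith)
  obtain ⟨n₂, hn₂⟩ := exists_scale_step hvc hvp hB1 hκ hv happ
  obtain ⟨c, hc, S₁, hS₁⟩ := exists_initial_scales hB1 hvc hvp hvB hC hb hsub (measExp A)
  obtain ⟨T₀, hT₀⟩ := eventually_atTop.1 (eventually_pow_le_exp 1 (64 * measExp A))
  set n₃ := max (max n₂ 2) ⌈T₀⌉₊ with hn₃
  obtain ⟨S₂, hS₂⟩ := eventually_atTop.1
    (eventually_mul_add_pow_le_exp (n₃ + 1) (scaleExp A) hc)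
  refine ⟨n₃, max (max S₁ S₂) 200, fun ω hω l E S hl hS hS₀ N hN => ?_⟩
  have hSS₁ : S₁ ≤ S := (le_max_left _ _).trans ((le_max_left _ _).trans hS₀)
  have hSS₂ : S₂ ≤ S := (le_max_right _ _).trans ((le_max_left _ _).trans hS₀)
  have hS200 : 200 ≤ S := (le_max_right _ _).trans hS₀
  have ha : 384 ≤ scaleExp A := by rw [scaleExp_eq]; omega
  have hn₃2 : 2 ≤ n₃ := (le_max_right _ _).trans (le_max_left _ _)
  have hn₃n₂ : n₂ ≤ n₃ := (le_max_left _ _).trans (le_max_left _ _)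
  have hn₃T : T₀ ≤ n₃ := (Nat.le_ceil _).trans (by exact_mod_cast le_max_right _ _)
  clear_value n₃
  set n₀ := max n₃ ⌈S⌉₊ with hn₀
  have hn₃₀ : n₃ ≤ n₀ := le_max_left _ _
  have hSn₀ : S ≤ n₀ := (Nat.le_ceil _).trans (by exact_mod_cast le_max_right _ _)
  have hn₀S : (n₀ : ℝ) ≤ n₃ + 1 + S := by
    have h1 := Nat.ceil_lt_add_one (show 0 ≤ S by linarith)
    rw [hn₀, Nat.cast_max]
    refine max_le (by linarith) (by linarith [(Nat.cast_nonneg n₃ : (0 : ℝ) ≤ n₃)])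
  clear_value n₀
  have hRstep : ∀ y, hs (stepMatrix v l E y) ≤ |l| * B + |E| + 2 := hs_stepMatrix_le hvB
  have hinit : ∀ n : ℕ, 1 ≤ n → n ≤ 2 * n₀ ^ scaleExp A →
      circleMeasure.real {x | logHS v ω l E n x < 98 / 100 * (n * S)} ≤
          1 / (100 * (n : ℝ) ^ measExp A) := by
    intro n hn1 hn
    refine hS₁ l E S ω hl hS hSS₁ n hn1 (le_trans ?_ (hS₂ S hSS₂))
    have h1 : (n : ℝ) ≤ 2 * (n₀ : ℝ) ^ scaleExp A := by exact_mod_cast hn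
    refine h1.trans ?_
    gcongr
  have hbase : ∀ n, n₀ ≤ n → n ≤ n₀ ^ scaleExp A → ScaleBound v ω l E S (measExp A) n := by
    intro n hn hn'
    have hn1 : 1 ≤ n := by omega
    have hn1' : (1 : ℝ) ≤ n := by exact_mod_cast hn1
    have h1 := hinit n hn1 (by omega)
    have h2 := hinit (2 * n) (by omega) (by omega)
    have hp1 : 1 ≤ (n : ℝ) ^ measExp A := one_le_pow₀ hn1'
    have hp2 : (n : ℝ) ^ measExp A ≤ ((2 * n : ℕ) : ℝ) ^ measExp A := by
      gcongr; linarith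
    refine ScaleBound.of_initial hn1 hS200
      (h1.trans (one_div_le_one_div_of_le (by positivity) (by linarith)))
      (h2.trans (one_div_le_one_div_of_le (by positivity) (by linarith))) ?_ ?_
    · rw [hS]; exact meanHS_le hvc hRstep hn1
    · rw [hS] at h2 ⊢
      refine le_meanHS_of_measure_le hvc hRstep (by omega) (by rw [← hS]; linarith)
        (h2.trans (one_div_le_one_div_of_le (by norm_num) (by linarith)))
  have hstep : ∀ k ≥ n₀, ScaleBound v ω l E S (measExp A) k → ∀ N : ℕ, k ^ scaleExp A ≤ N →
      N ≤ 2 * (k + 1) ^ scaleExp A →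
      |meanHS v ω l E N - N * ((meanHS v ω l E (2 * k) - meanHS v ω l E k) / k)| ≤
        scaleRoot N ^ 62 ∧
      circleMeasure.real {x | scaleRoot N ^ 62 < |logHS v ω l E N x -
        N * ((meanHS v ω l E (2 * k) - meanHS v ω l E k) / k)|} ≤
        Real.exp (-(scaleRoot N / 2)) := by
    intro k hk hkb N h1 h2
    exact hn₂ k (by omega) N (scaleRoot N) (scaleRoot_nonneg N) (scaleRoot_pow N) h1 h2 ω hω l E S
      hS (by linarith) (hSn₀.trans (by exact_mod_cast hk)) hkb.measure_le hkb.measure_two_mul_le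
  obtain ⟨k, hk1, hk2⟩ := exists_nat_root (scaleExp_ne_zero A) N
  have hk0 : n₀ ≤ k := le_nat_root hN hk2
  have hkb : ScaleBound v ω l E S (measExp A) k :=
    ScaleBound.induction hS200 (hn₃2.trans hn₃₀) ha le_rfl (fun T hT => by
      have h3 : (n₃ : ℝ) ≤ n₀ := by exact_mod_cast hn₃₀
      simpa using hT₀ T (by linarith)) hbase hstep hk0
  obtain ⟨h1, h2⟩ := hstep k hk0 hkb N hk1 (by omega)
  refine ⟨_, ?_, h1, h2⟩
  refine le_trans ?_ hkb.le_exponent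
  have : 0 ≤ 1 / scaleRoot k ^ 2 := by positivity
  linarith

/-- At energies that are very large compared with the scale, `log ‖M_N‖` is almost constant. -/
theorem abs_logHS_sub_meanHS_le (hvc : Continuous v) {B ω l E : ℝ} (hB : 0 ≤ B)
    (hv : ∀ x, |v x| ≤ B) {N : ℕ} (hN : 1 ≤ N)
    (hE : (N + 1) * (2 * (|l| * B) + 3) ≤ |l| * B + |E| + 2) (x : ℝ) :
    |logHS v ω l E N x - meanHS v ω l E N| ≤ 1 := by
  have hN1 : (1 : ℝ) ≤ N := by exact_mod_cast hN
  set R := |l| * B + |E| + 2 with hR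
  set D := 2 * (|l| * B) + 3 with hD
  have hlB : 0 ≤ |l| * B := by positivity
  have hD3 : 3 ≤ D := by linarith
  have hρ : N * D ≤ R - D := by linarith
  have hρ3 : 3 ≤ R - D := by nlinarith
  have hup : ∀ y, logHS v ω l E N y ≤ N * Real.log R :=
    fun y => logHS_le (hs_stepMatrix_le hv) hN y
  have hlow : ∀ y, N * Real.log (R - D) ≤ logHS v ω l E N y := by
    intro y
    have h1 : ∀ j < N, R - D + 1 ≤ |l * v (y + ((j + 1 : ℕ) : ℝ) * ω) - E| := by
      intro j _
      have h2 : |l * v (y + ((j + 1 : ℕ) : ℝ) * ω)| ≤ |l| * B := by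
        rw [abs_mul]; exact mul_le_mul_of_nonneg_left (hv _) (abs_nonneg l)
      have h3 := abs_sub_abs_le_abs_sub E (l * v (y + ((j + 1 : ℕ) : ℝ) * ω))
      rw [abs_sub_comm E] at h3
      linarith
    have h2 := pow_le_hs_transferMatrix (by linarith) h1
    rw [add_sub_cancel_right] at h2
    have h3 := Real.log_le_log (by positivity) h2
    rwa [Real.log_pow] at h3
  have hgap : N * Real.log R ≤ N * Real.log (R - D) + 1 := by
    have h1 : Real.log R - Real.log (R - D) ≤ D / (R - D) := by
      rw [← Real.log_div (by linarith) (by linarith)]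
      refine (Real.log_le_sub_one_of_pos (div_pos (by linarith) (by linarith))).trans (le_of_eq ?_)
      have : R - D ≠ 0 := by linarith
      field_simp
      ring
    have h2 : N * (D / (R - D)) ≤ 1 := by
      rw [← mul_div_assoc, div_le_one (by linarith)]; exact hρ
    nlinarith
  have hm1 : meanHS v ω l E N ≤ N * Real.log R := meanHS_le hvc (hs_stepMatrix_le hv) hN
  have hm2 : N * Real.log (R - D) ≤ meanHS v ω l E N := by
    rw [← mean_const (N * Real.log (R - D))]
    exact mean_mono continuous_const (continuous_logHS hvc N) hlow
  rw [abs_le]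
  constructor <;> linarith [hup x, hlow x]

end

section
open scoped Matrix.Norms.L2Operator

theorem l2_opNorm_le_hs (M : Matrix (Fin 2) (Fin 2) ℝ) : ‖M‖ ≤ hs M := by
  rw [← Matrix.l2_opNorm_toEuclideanCLM]
  refine ContinuousLinearMap.opNorm_le_bound _ (hs_nonneg M) fun x => ?_
  refine abs_le_of_sq_le_sq' ?_ (mul_nonneg (hs_nonneg _) (norm_nonneg _)) |>.2
  rw [mul_pow, hs_sq, EuclideanSpace.real_norm_sq_eq, EuclideanSpace.real_norm_sq_eq]
  simp only [Matrix.ofLp_toEuclideanCLM, Matrix.mulVec, dotProduct, Fin.sum_univ_two]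
  nlinarith [sq_nonneg (M 0 0 * x.ofLp 1 - M 0 1 * x.ofLp 0),
    sq_nonneg (M 1 0 * x.ofLp 1 - M 1 1 * x.ofLp 0)]

theorem hs_le_two_mul_l2_opNorm (M : Matrix (Fin 2) (Fin 2) ℝ) : hs M ≤ 2 * ‖M‖ := by
  have hcol : ∀ j : Fin 2, M 0 j ^ 2 + M 1 j ^ 2 ≤ ‖M‖ ^ 2 := by
    intro j
    have h := Matrix.l2_opNorm_mulVec M (EuclideanSpace.single j (1 : ℝ))
    rw [PiLp.norm_single, norm_one, mul_one] at h
    have h2 := pow_le_pow_left₀ (norm_nonneg _) h 2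
    rw [EuclideanSpace.real_norm_sq_eq] at h2
    simpa [Fin.sum_univ_two, Matrix.mulVec_single_one] using h2
  refine abs_le_of_sq_le_sq' ?_ (by positivity) |>.2
  rw [hs_sq]
  nlinarith [hcol 0, hcol 1, sq_nonneg ‖M‖]

theorem abs_log_l2_opNorm_sub_le {M : Matrix (Fin 2) (Fin 2) ℝ} (h : 1 ≤ hs M) :
    |Real.log ‖M‖ - Real.log (hs M)| ≤ 1 := by
  have h1 := l2_opNorm_le_hs M
  have h2 := hs_le_two_mul_l2_opNorm M
  have h0 : 0 < ‖M‖ := by linarith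
  have h3 := Real.log_le_log h0 h1
  have h4 := Real.log_le_log (by linarith) h2
  rw [Real.log_mul (by norm_num) h0.ne'] at h4
  have h5 := Real.log_two_lt_d9
  rw [abs_le]
  constructor <;> linarith

variable {v : ℝ → ℝ} {ω l E : ℝ}

theorem abs_mul_logNorm_sub_logHS_le {N : ℕ} (hN : 1 ≤ N) (x : ℝ) :
    |N * logNorm v ω l E N x - logHS v ω l E N x| ≤ 1 := by
  have hN0 : (N : ℝ) ≠ 0 := by exact_mod_cast (show N ≠ 0 by omega)
  rw [logNorm, ← mul_assoc, mul_one_div_cancel hN0, one_mul]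
  exact abs_log_l2_opNorm_sub_le (one_le_hs_transferMatrix v ω l E N x)

theorem continuous_logNorm (hvc : Continuous v) (N : ℕ) : Continuous (logNorm v ω l E N) := by
  have h := continuous_transferMatrix (ω := ω) (l := l) (E := E) hvc N
  unfold logNorm
  refine continuous_const.mul (Continuous.log h.norm fun x => ?_)
  have h1 := hs_le_two_mul_l2_opNorm (transferMatrix v ω l E N x)
  have h2 := one_le_hs_transferMatrix v ω l E N x
  exact (by linarith : 0 < ‖transferMatrix v ω l E N x‖).ne'

theorem abs_mul_lyapunovN_sub_meanHS_le (hvc : Continuous v) {N : ℕ} (hN : 1 ≤ N) :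
    |N * lyapunovN v ω l E N - meanHS v ω l E N| ≤ 1 := by
  have hc : Continuous fun x => (N : ℝ) * logNorm v ω l E N x :=
    continuous_const.mul (continuous_logNorm hvc N)
  have h := abs_mean_sub_mean_le hc
    (continuous_logHS (ω := ω) (l := l) (E := E) hvc N)
    (fun x => abs_mul_logNorm_sub_logHS_le hN x)
  rw [intervalIntegral.integral_const_mul] at h
  rw [lyapunovN, meanHS]
  rwa [mul_left_comm]

theorem subadditive_meanHS (hvc : Continuous v) (hvp : Function.Periodic v (2 * Real.pi)) :
    Subadditive (meanHS v ω l E) := by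
  intro m n
  have hm := continuous_logHS (ω := ω) (l := l) (E := E) hvc m
  have hn := continuous_logHS (ω := ω) (l := l) (E := E) hvc n
  have hmn : Continuous fun x => logHS v ω l E m (x + n * ω) := hm.comp (by fun_prop)
  have hadd : Continuous fun x => logHS v ω l E m (x + n * ω) + logHS v ω l E n x := hmn.add hn
  have h := mean_mono (continuous_logHS hvc (m + n)) hadd (logHS_add_le m n)
  rw [intervalIntegral.integral_add (hmn.intervalIntegrable _ _) (hn.intervalIntegrable _ _),
    mul_add, intervalIntegral.integral_comp_add_right (fun x => logHS v ω l E m x), zero_add,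
    add_comm (2 * Real.pi),
    (logHS_periodic hvp m).intervalIntegral_add_eq (n * ω) 0, zero_add] at h
  exact h

/-- The Lyapunov exponent exists as a limit. -/
theorem tendsto_lyapunovN (hvc : Continuous v) (hvp : Function.Periodic v (2 * Real.pi)) :
    Tendsto (fun N : ℕ => lyapunovN v ω l E N) atTop (𝓝 (lyapunov v ω l E)) := by
  have h1 : Tendsto (fun N : ℕ => meanHS v ω l E N / N) atTop
      (𝓝 (subadditive_meanHS hvc hvp).lim) :=
    (subadditive_meanHS hvc hvp).tendsto_lim ⟨0, by
      rintro _ ⟨n, rfl⟩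
      exact div_nonneg (meanHS_nonneg n) (Nat.cast_nonneg n)⟩
  have h2 : Tendsto (fun N : ℕ => lyapunovN v ω l E N - meanHS v ω l E N / N) atTop (𝓝 0) := by
    refine squeeze_zero_norm' ?_ tendsto_one_div_atTop_nhds_zero_nat
    filter_upwards [eventually_ge_atTop 1] with N hN
    have hN0 : (0 : ℝ) < N := by exact_mod_cast hN
    have h := abs_mul_lyapunovN_sub_meanHS_le (ω := ω) (l := l) (E := E) hvc hN
    rw [Real.norm_eq_abs, le_div_iff₀ hN0, ← abs_of_pos hN0, ← abs_mul, abs_of_pos hN0]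
    refine le_trans (le_of_eq ?_) h
    congr 1
    field_simp
  have h3 := h2.add h1
  simp only [sub_add_cancel, zero_add] at h3
  rw [lyapunov, h3.limUnder_eq]
  exact h3

/-- Deviations of `log` of the Hilbert–Schmidt norm control those of `log` of the operator norm. -/
theorem abs_logNorm_sub_lyapunovN_le (hvc : Continuous v) {N : ℕ} (hN : 1 ≤ N)
    (hT : 4 ≤ scaleRoot N) {x : ℝ}
    (h : |logHS v ω l E N x - meanHS v ω l E N| ≤ 2 * scaleRoot N ^ 62) :
    |logNorm v ω l E N x - lyapunovN v ω l E N| ≤ (N : ℝ) ^ (-(1 / 64 : ℝ)) := by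
  have h1 := abs_mul_logNorm_sub_logHS_le (v := v) (ω := ω) (l := l) (E := E) hN x
  have h2 := abs_mul_lyapunovN_sub_meanHS_le (ω := ω) (l := l) (E := E) hvc hN
  have hN0 : (0 : ℝ) < N := by exact_mod_cast hN
  rw [Real.rpow_neg hN0.le]
  change _ ≤ (scaleRoot N)⁻¹
  have hTN := scaleRoot_pow N
  set T := scaleRoot N
  clear_value T
  have hT0 : 0 < T := by linarith
  have h62 : 1 ≤ T ^ 62 := one_le_pow₀ (by linarith)
  have h3 : N * |logNorm v ω l E N x - lyapunovN v ω l E N| ≤ 4 * T ^ 62 := by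
    rw [← abs_of_pos hN0, ← abs_mul, mul_sub]
    rw [abs_le] at *
    constructor <;> linarith [h.1, h.2, h1.1, h1.2, h2.1, h2.2]
  have h4 : N * T⁻¹ = T * T ^ 62 := by
    rw [← hTN, ← div_eq_mul_inv, div_eq_iff hT0.ne']; ring
  refine le_of_mul_le_mul_left (h3.trans ?_) hN0
  rw [h4]
  exact mul_le_mul_of_nonneg_right hT (by positivity)

end

theorem volume_Ico_inter_eq {S : Set ℝ} (hS : MeasurableSet S) :
    volume {x | x ∈ Set.Ico 0 (2 * Real.pi) ∧ x ∈ S} = ENNReal.ofReal (circleMeasure.real S) := by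
  have h : volume.restrict (Set.Ico 0 (2 * Real.pi)) = circleMeasure :=
    Measure.restrict_congr_set Ico_ae_eq_Ioc
  rw [ofReal_measureReal, ← h, Measure.restrict_apply hS, Set.inter_comm]
  rfl

theorem exp_neg_scaleRoot_lt {N : ℕ} (hT : 8 ≤ scaleRoot N) :
    Real.exp (-(scaleRoot N / 2)) < Real.exp (-(N : ℝ) ^ (1 / 128 : ℝ)) := by
  have h0 : (0 : ℝ) ≤ (N : ℝ) ^ (1 / 128 : ℝ) := by positivity
  have h1 : ((N : ℝ) ^ (1 / 128 : ℝ)) ^ 2 = scaleRoot N := by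
    rw [scaleRoot, ← Real.rpow_natCast, ← Real.rpow_mul (by positivity)]
    norm_num
  rw [Real.exp_lt_exp, ← h1]
  rw [← h1] at hT
  nlinarith

theorem eight_le_scaleRoot {N : ℕ} (h : 8 ^ 64 ≤ N) : 8 ≤ scaleRoot N := by
  refine le_of_pow_le_pow_left₀ (n := 64) (by norm_num) (scaleRoot_nonneg N) ?_
  rw [scaleRoot_pow]
  exact_mod_cast h

/-- Past a threshold depending on the disorder, a scale is either in the range of the induction or
negligible compared with the energy. -/
theorem exists_scale_dichotomy (a n₃ : ℕ) (D : ℝ) :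
    ∃ N₀ : ℕ, ∀ N ≥ N₀, ∀ S : ℝ, 0 ≤ S →
      max n₃ ⌈S⌉₊ ^ a ≤ N ∨ (N + 1) * D ≤ Real.exp S := by
  obtain ⟨S₁, hS₁⟩ := eventually_atTop.1
    ((eventually_mul_add_pow_le_exp 1 a (show (0 : ℝ) < 1 / 2 by norm_num)).and
      (eventually_ge_atTop (2 * |D|)))
  set S₂ := max S₁ 0 with hS₂
  refine ⟨max (n₃ ^ a) ⌈(S₂ + 1) ^ a⌉₊, fun N hN S hS0 => ?_⟩
  have hN1 : n₃ ^ a ≤ N := (le_max_left _ _).trans hN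
  have hN2 : (S₂ + 1) ^ a ≤ N :=
    (Nat.le_ceil _).trans (by exact_mod_cast (le_max_right _ _).trans hN)
  rcases le_or_gt (max n₃ ⌈S⌉₊ ^ a) N with h | h
  · exact Or.inl h
  right
  have hceil : N < ⌈S⌉₊ ^ a := by
    rcases max_choice n₃ ⌈S⌉₊ with h' | h' <;> rw [h'] at h
    · omega
    · exact h
  have hNS : (N : ℝ) + 1 ≤ (1 + S) ^ a := by
    have h1 : (N : ℝ) + 1 ≤ (⌈S⌉₊ : ℝ) ^ a := by exact_mod_cast hceil
    refine h1.trans ?_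
    gcongr
    linarith [Nat.ceil_lt_add_one hS0]
  have hSS : S₁ ≤ S := by
    by_contra! hlt
    have h2 : (1 + S) ^ a ≤ (S₂ + 1) ^ a :=
      pow_le_pow_left₀ (by linarith) (by linarith [le_max_left S₁ 0]) a
    linarith
  obtain ⟨h1, h2⟩ := hS₁ S hSS
  have hD : D ≤ Real.exp (1 / 2 * S) := by
    linarith [le_abs_self D, Real.add_one_le_exp (1 / 2 * S)]
  have hpos : 0 ≤ (1 + S) ^ a := by positivity
  calc (N + 1) * D ≤ (N + 1) * Real.exp (1 / 2 * S) := by gcongr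
    _ ≤ Real.exp (1 / 2 * S) * Real.exp (1 / 2 * S) := by gcongr; linarith
    _ = Real.exp S := by rw [← Real.exp_add]; congr 1; ring

theorem theorem5p1 :
    ∃ τ > (0 : ℝ), ∃ σ > (0 : ℝ),
      ∀ (s : ℝ), 1 < s → ∀ (v : ℝ → ℝ), IsGevrey s v → IsTransversal v →
      ∀ (κ : ℝ), 0 < κ →
      ∃ l₀ > (0 : ℝ), ∀ (l : ℝ), l₀ ≤ |l| →
        -- large deviations, with a threshold uniform in the frequency and the energy
        (∃ N₀ : ℕ, ∀ ω ∈ diophantine κ, ∀ (E : ℝ) (N : ℕ), N₀ ≤ N →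
          volume {x : ℝ | x ∈ Set.Ico 0 (2 * Real.pi) ∧
              (N : ℝ) ^ (-τ) < |logNorm v ω l E N x - lyapunovN v ω l E N|}
            < ENNReal.ofReal (Real.exp (-(N : ℝ) ^ σ))) ∧
        -- the Lyapunov exponent exists as a limit and is bounded below
        (∀ ω ∈ diophantine κ, ∀ (E : ℝ),
          Tendsto (fun N : ℕ => lyapunovN v ω l E N) atTop (𝓝 (lyapunov v ω l E)) ∧
          1 / 4 * Real.log |l| ≤ lyapunov v ω l E ∧
          0 < 1 / 4 * Real.log |l|) := by
  refine ⟨1 / 64, by norm_num, 1 / 128, by norm_num, fun s _ v hG htr κ hκ => ?_⟩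
  have hvc := hG.smooth.continuous
  have hvp := hG.periodic
  obtain ⟨A, n₁, happ⟩ := hG.exists_approx
  obtain ⟨C, hC, b, hb, hsub⟩ := exists_sublevel_bound hG.smooth htr
  obtain ⟨M, hM, K, hK, hMK⟩ := hG.bound
  set B := M + 1 with hBdef
  have hB1 : 1 ≤ B := by linarith
  have hv : ∀ x, |v x| ≤ B - 1 := by
    intro x
    have h := hMK 0 x
    simp only [iteratedDeriv_zero, pow_zero, mul_one, Nat.factorial_zero, Nat.cast_one,
      Real.one_rpow] at h
    linarith
  have hvB : ∀ x, |v x| ≤ B := fun x => (hv x).trans (by linarith)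
  obtain ⟨n₃, S₀, hdev⟩ := exists_deviation hvc hvp hB1 hκ hv happ hC hb hsub
  refine ⟨max 3 (Real.exp (max S₀ 4)), by positivity, fun l hl => ?_⟩
  have hl3 : 3 ≤ |l| := (le_max_left _ _).trans hl
  have hlogl : max S₀ 4 ≤ Real.log |l| := by
    rw [Real.le_log_iff_exp_le (by linarith)]
    exact (le_max_right _ _).trans hl
  have hlog4 : 4 ≤ Real.log |l| := (le_max_right _ _).trans hlogl
  have hS₀l : S₀ ≤ Real.log |l| := (le_max_left _ _).trans hlogl
  have hlS : ∀ E : ℝ, Real.log |l| ≤ Real.log (|l| * B + |E| + 2) := by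
    intro E
    refine Real.log_le_log (by linarith) ?_
    nlinarith [abs_nonneg E]
  constructor
  · obtain ⟨N₁, hN₁⟩ := exists_scale_dichotomy (scaleExp A) n₃ (2 * (|l| * B) + 3)
    refine ⟨max N₁ (8 ^ 64), fun ω hω E N hN => ?_⟩
    have hNN₁ : N₁ ≤ N := (le_max_left _ _).trans hN
    have hT8 := eight_le_scaleRoot ((le_max_right _ _).trans hN)
    have hN1 : 1 ≤ N := le_trans (Nat.one_le_pow _ _ (by norm_num)) ((le_max_right _ _).trans hN)
    have hopen : MeasurableSet {x | (N : ℝ) ^ (-(1 / 64 : ℝ)) <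
        |logNorm v ω l E N x - lyapunovN v ω l E N|} :=
      (isOpen_lt continuous_const
        ((continuous_logNorm hvc N).sub continuous_const).abs).measurableSet
    refine (volume_Ico_inter_eq hopen).trans_lt
      ((ENNReal.ofReal_lt_ofReal_iff (Real.exp_pos _)).2 ?_)
    have hR0 : 0 < |l| * B + |E| + 2 := by positivity
    rcases hN₁ N hNN₁ (Real.log (|l| * B + |E| + 2)) (by linarith [hlS E]) with h | h
    · obtain ⟨Λ, -, hmean, hμ⟩ := hdev ω hω l E _ (by linarith) rfl (hS₀l.trans (hlS E)) N h
      refine lt_of_le_of_lt ?_ (exp_neg_scaleRoot_lt hT8)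
      refine (measureReal_mono (fun x hx => ?_) (measure_ne_top _ _)).trans hμ
      by_contra hcon
      rw [Set.mem_ofPred_eq, not_lt] at hcon
      refine absurd hx (not_lt.2 (abs_logNorm_sub_lyapunovN_le hvc hN1 (by linarith) ?_))
      rw [abs_le] at *
      constructor <;> linarith [hmean.1, hmean.2, hcon.1, hcon.2]
    · rw [Real.exp_log hR0] at h
      have hempty : {x | (N : ℝ) ^ (-(1 / 64 : ℝ)) <
          |logNorm v ω l E N x - lyapunovN v ω l E N|} = ∅ := by
        ext x
        simp only [Set.mem_ofPred_eq, Set.mem_empty_iff_false, iff_false, not_lt]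
        refine abs_logNorm_sub_lyapunovN_le hvc hN1 (by linarith) ?_
        refine (abs_logHS_sub_meanHS_le hvc (by linarith) hvB hN1 h x).trans ?_
        have : 1 ≤ scaleRoot N ^ 62 := one_le_pow₀ (by linarith)
        linarith
      rw [hempty, measureReal_empty]
      exact Real.exp_pos _
  · intro ω hω E
    have hlim := tendsto_lyapunovN (ω := ω) (l := l) (E := E) hvc hvp
    refine ⟨hlim, ge_of_tendsto hlim ?_, by linarith⟩
    filter_upwards [eventually_ge_atTop (max n₃ ⌈Real.log (|l| * B + |E| + 2)⌉₊ ^ scaleExp A),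
      eventually_ge_atTop 1] with N hN hN1
    obtain ⟨Λ, hΛ, hmean, -⟩ := hdev ω hω l E _ (by linarith) rfl (hS₀l.trans (hlS E)) N hN
    have hLN := abs_mul_lyapunovN_sub_meanHS_le (ω := ω) (l := l) (E := E) hvc hN1
    have hN1' : (1 : ℝ) ≤ N := by exact_mod_cast hN1
    have hT1 := one_le_scaleRoot hN1
    have hTN : scaleRoot N ^ 62 ≤ N := by
      rw [← scaleRoot_pow N]
      exact pow_le_pow_right₀ hT1 (by norm_num)
    rw [abs_le] at hmean hLN
    have h1 : N * (Λ - 2) ≤ N * lyapunovN v ω l E N := by linarith [hmean.1, hLN.1]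
    have h2 := le_of_mul_le_mul_left h1 (by linarith)
    linarith [hlS E]
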